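/- Let $F\subset\mathbb R$ be a non-empty compact, totally disconnected set without isolated points, let $[a,b]$ be the least closed interval containing $F$, and let $(a_n,b_n)$, $n\ge 1$, be the connected components (gaps) of $[a,b]\setminus F$. Let $\mathcal A=\mathrm{Lip}(F)$ be the algebra of complex Lipschitz functions on $F$, acting by $(f\xi)(x)=f(x)\xi(x)$ on $\mathcal H=\bigoplus_n \ell^2(\{a_n,b_n\})$, and let $$D=\bigoplus_n \frac1{b_n-a_n}\begin{pmatrix}0&1\\1&0\end{pmatrix}$$ (Connes' spectral triple of $F$). For a compact operator $A$ let $\mu_1(A)\ge\mu_2(A)\ge\dots$ be the eigenvalues of $|A|$ with multiplicity; let $\mathcal L^{1,\infty}$ (resp. $\mathcal L^{1,\infty}_0$) be the set of compact operators $A$ with $\sum_{k\le n}\mu_k(A)=O(\log n)$ (resp. $o(\log n)$). The dimension of the spectral triple is $$d(\mathcal A,D,\mathcal H)=\inf\{d>0:\ |D|^{-d}\in\mathcal L^{1,\infty}_0\}\in[0,\infty].$$ A singular trace on $\mathcal B(\mathcal H)$ is a tracial weight $\mathcal B(\mathcal H)_+\to[0,\infty]$ that vanishes on finite rank projections; it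 is extended linearly to the span of the positive operators on which it is finite. The upper box dimension is $\overline{\dim}_B F=\limsup_{\varepsilon\to0^+}\log N_\varepsilon(F)/(-\log\varepsilon)$, where $N_\varepsilon(F)$ is the least number of closed balls of radius $\varepsilon$ covering $F$. Then: 1. If $F$ has Lebesgue measure zero, then $d(\mathcal A,D,\mathcal H)=\overline{\dim}_B F$ (whether or not $F$ is Minkowski measurable). 2. $d(\mathcal A,D,\mathcal H)=\sup\{d>0:\ |D|^{-d}\notin\mathcal L^{1,\infty}\}$ (with $\sup\emptyset=0$). 3. If $d:=d(\mathcal A,D,\mathcal H)\neq0$ (equivalently, when $F$ has Lebesgue measure zero, if $\overline{\dim}_B F\ne0$), then $d<\infty$ and there is a singular trace $\tau$ with $\tau(|D|^{-d})=1$, hence a Hausdorff–Besicovitch functional $f\mapsto\tau(f|D|^{-d})$ on $\mathcal A$, and this functional is given by a non-trivial measure on $F$: there is a finite non-zero Borel measure $\mu$ on $F$ with $\tau(f|D|^{-d})=\int_F f\,d\mu$ for all $f\in\mathrm{Lip}(F)$. -/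

import Mathlib

open Set Filter Topology MeasureTheory
open scoped NNReal ENNReal

noncomputable section

/-! ### Box dimension -/

/-- The upper box dimension `limsup_{ε → 0+} log N_ε(E) / (- log ε)` of a totally bounded set `E`, where
`N_ε(E)` is the least number of closed balls of radius `ε` needed to cover `E`. -/
def upperBoxDim {X : Type*} [PseudoMetricSpace X] (E : Set X) : EReal :=
  limsup (fun ε : ℝ≥0 =>
    ((Real.log ((Metric.externalCoveringNumber ε E).toNat : ℝ) / (-Real.log (ε : ℝ)) : ℝ) : EReal))
    (𝓝[>] (0 : ℝ≥0))

/-! ### Compact operators and singular traces -/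

section Operators

variable {H : Type*} [NormedAddCommGroup H] [InnerProductSpace ℂ H] [CompleteSpace H]

/-- `singVal A n` (with `n = 0, 1, 2, …`) is the `n`-th eigenvalue of `|A|`, in non-increasing order
and counted with multiplicity: the least `t ≥ 0` such that the eigenvalues of `|A|` that are greater
than `t` have total multiplicity at most `n`. -/
def singVal (A : H →L[ℂ] H) (n : ℕ) : ℝ :=
  sInf {t : ℝ | 0 ≤ t ∧
    Module.rank ℂ ↥(⨆ (s : ℝ) (_ : t < s),
      Module.End.eigenspace ((CFC.abs A : H →L[ℂ] H) : Module.End ℂ H) (s : ℂ)) ≤ (n : Cardinal)}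

/-- The ideal `𝓛^{1,∞}`: compact operators with `∑_{k ≤ n} μ_k(A) = O(log n)`. -/
def MemL1Infty (A : H →L[ℂ] H) : Prop :=
  IsCompactOperator A ∧
    (fun n : ℕ => ∑ k ∈ Finset.range n, singVal A k) =O[atTop] (fun n : ℕ => Real.log n)

/-- The ideal `𝓛₀^{1,∞}`: compact operators with `∑_{k ≤ n} μ_k(A) = o(log n)`. -/
def MemL1InftyZero (A : H →L[ℂ] H) : Prop :=
  IsCompactOperator A ∧
    (fun n : ℕ => ∑ k ∈ Finset.range n, singVal A k) =o[atTop] (fun n : ℕ => Real.log n)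

end Operators

/-- A singular trace on `𝓑(H)`: a tracial weight `𝓑(H)₊ → [0, ∞]` that vanishes on the finite rank
projections. Only the values of `toFun` at positive operators are meaningful. -/
structure SingularTrace (H : Type*) [NormedAddCommGroup H] [InnerProductSpace ℂ H]
    [CompleteSpace H] where
  toFun : (H →L[ℂ] H) → ℝ≥0∞
  map_add : ∀ A B : H →L[ℂ] H, 0 ≤ A → 0 ≤ B → toFun (A + B) = toFun A + toFun B
  map_smul : ∀ (c : ℝ≥0) (A : H →L[ℂ] H), 0 ≤ A → toFun (((c : ℝ) : ℂ) • A) = c * toFun A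
  tracial : ∀ A : H →L[ℂ] H, toFun (star A * A) = toFun (A * star A)
  finiteRank : ∀ P : H →L[ℂ] H, IsStarProjection P →
    FiniteDimensional ℂ (LinearMap.range (P : H →ₗ[ℂ] H)) → toFun P = 0

namespace SingularTrace

variable {H : Type*} [NormedAddCommGroup H] [InnerProductSpace ℂ H] [CompleteSpace H]

/-- The domain of a singular trace as a linear functional: the linear span of the positive operators
on which it is finite. -/
def domain (τ : SingularTrace H) : Submodule ℂ (H →L[ℂ] H) :=
  Submodule.span ℂ {A | 0 ≤ A ∧ τ.toFun A < ⊤}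

/-- `σ` is the (unique) linear extension of the weight `τ` to its domain. -/
def IsLinearExtension (τ : SingularTrace H) (σ : τ.domain →ₗ[ℂ] ℂ) : Prop :=
  ∀ X : τ.domain, 0 ≤ (X : H →L[ℂ] H) → τ.toFun X < ⊤ → σ X = ((τ.toFun X).toReal : ℂ)

end SingularTrace

/-! ### Spectral triples -/

/-- A spectral triple `(𝓐, D, H)`: a `*`-algebra `𝓐` acting on `H` and a self-adjoint (unbounded)
operator `D` on `H` such that `[D, a]` is bounded for every `a` in `𝓐`, `D` has compact resolvent,
and `0` is not an eigenvalue of `D`. The last two conditions say that `D` has a compact inverse. -/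
structure SpectralTriple (𝓐 : Type*) [Ring 𝓐] [StarRing 𝓐] [Algebra ℂ 𝓐]
    (H : Type*) [NormedAddCommGroup H] [InnerProductSpace ℂ H] [CompleteSpace H] where
  rep : 𝓐 →⋆ₐ[ℂ] (H →L[ℂ] H)
  D : H →ₗ.[ℂ] H
  selfAdjoint : IsSelfAdjoint D
  rep_mem_domain : ∀ (a : 𝓐) (ξ : D.domain), rep a (ξ : H) ∈ D.domain
  commutator_bounded : ∀ a : 𝓐, ∃ C : ℝ, ∀ ξ : D.domain,
    ‖D ⟨rep a (ξ : H), rep_mem_domain a ξ⟩ - rep a (D ξ)‖ ≤ C * ‖(ξ : H)‖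
  inv : H →L[ℂ] H
  inv_compact : IsCompactOperator inv
  inv_mem_domain : ∀ ξ : H, inv ξ ∈ D.domain
  apply_inv : ∀ ξ : H, D ⟨inv ξ, inv_mem_domain ξ⟩ = ξ
  inv_apply : ∀ ξ : D.domain, inv (D ξ) = (ξ : H)

namespace SpectralTriple

variable {𝓐 : Type*} [Ring 𝓐] [StarRing 𝓐] [Algebra ℂ 𝓐]
  {H : Type*} [NormedAddCommGroup H] [InnerProductSpace ℂ H] [CompleteSpace H]

/-- The operator `|D|^{-α}`, for `α > 0`, where `|D|^{-1} = |D^{-1}|`. -/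
def absNegPow (T : SpectralTriple 𝓐 H) (α : ℝ) : H →L[ℂ] H :=
  CFC.rpow (CFC.abs T.inv) α

/-- The dimension `d(𝓐, D, H) = inf {d > 0 : |D|^{-d} ∈ 𝓛₀^{1,∞}}` of a spectral triple,
an element of `[0, ∞]`. -/
def dim (T : SpectralTriple 𝓐 H) : ℝ≥0∞ :=
  sInf (ENNReal.ofReal '' {d : ℝ | 0 < d ∧ MemL1InftyZero (T.absNegPow d)})

/-- The other expression `sup {d > 0 : |D|^{-d} ∉ 𝓛^{1,∞}}` (in `[0, ∞]`) for the dimension. -/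
def supDim (T : SpectralTriple 𝓐 H) : ℝ≥0∞ :=
  sSup (ENNReal.ofReal '' {d : ℝ | 0 < d ∧ ¬ MemL1Infty (T.absNegPow d)})

/-- `φ` is a Hausdorff–Besicovitch functional on the spectral triple with exponent `d`:
there is a singular trace `τ` with `τ(|D|^{-d}) = 1`, and `φ(a) = τ(a |D|^{-d})` for `a` in `𝓐`. -/
def IsHausdorffBesicovitch (T : SpectralTriple 𝓐 H) (d : ℝ) (φ : 𝓐 →ₗ[ℂ] ℂ) : Prop :=
  0 < d ∧ ∃ τ : SingularTrace H, τ.toFun (T.absNegPow d) = 1 ∧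
    ∃ σ : τ.domain →ₗ[ℂ] ℂ, τ.IsLinearExtension σ ∧
      ∀ a : 𝓐, ∃ h : T.rep a * T.absNegPow d ∈ τ.domain, φ a = σ ⟨T.rep a * T.absNegPow d, h⟩

end SpectralTriple

/-! ### Operators on `ℓ²` that permute and rescale the coordinates -/

section L2

variable {ι : Type*}

lemma memlp_scale {c : ι → ℂ} {C : ℝ} (hc : ∀ i, ‖c i‖ ≤ C) (e : Equiv.Perm ι)
    {ξ : ι → ℂ} (hξ : Memℓp ξ 2) : Memℓp (fun i => c i * ξ (e i)) 2 := by
  rw [memℓp_gen_iff (by norm_num)] at hξ ⊢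
  simp only [ENNReal.toReal_ofNat, Real.rpow_two] at hξ ⊢
  refine Summable.of_nonneg_of_le (fun _ => by positivity) (fun i => ?_)
    ((e.summable_iff.mpr hξ).mul_left (C ^ 2))
  rw [norm_mul, mul_pow]
  have := hc i
  simp only [Function.comp_apply]
  gcongr

lemma l2_norm_sq (ξ : lp (fun _ : ι => ℂ) 2) : ‖ξ‖ ^ 2 = ∑' i, ‖ξ i‖ ^ 2 := by
  have := lp.norm_rpow_eq_tsum (p := 2) (by norm_num) ξ
  simpa using this

lemma l2_summable (ξ : lp (fun _ : ι => ℂ) 2) : Summable fun i => ‖ξ i‖ ^ 2 := by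
  have := (memℓp_gen_iff (by norm_num)).mp (lp.memℓp ξ)
  simpa using this

lemma l2_norm_le {C : ℝ} (hC : 0 ≤ C) (e : Equiv.Perm ι) (ξ η : lp (fun _ : ι => ℂ) 2)
    (h : ∀ i, ‖η i‖ ≤ C * ‖ξ (e i)‖) : ‖η‖ ≤ C * ‖ξ‖ := by
  refine (pow_le_pow_iff_left₀ (norm_nonneg _) (by positivity) two_ne_zero).mp ?_
  rw [mul_pow, l2_norm_sq, l2_norm_sq, ← e.tsum_eq (fun i => ‖ξ i‖ ^ 2), ← tsum_mul_left]
  refine Summable.tsum_le_tsum (fun i => ?_) (l2_summable η)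
    (((e.summable_iff (f := fun i => ‖ξ i‖ ^ 2)).mpr (l2_summable ξ)).mul_left _)
  rw [← mul_pow]
  have := h i
  gcongr

/-- The bounded operator `(T ξ)(i) = c i * ξ (e i)` on `ℓ²(ι)`, for a bounded family `c` and a
permutation `e` of `ι`. -/
def scaleOp (c : ι → ℂ) (C : ℝ) (hC : 0 ≤ C) (hc : ∀ i, ‖c i‖ ≤ C) (e : Equiv.Perm ι) :
    lp (fun _ : ι => ℂ) 2 →L[ℂ] lp (fun _ : ι => ℂ) 2 :=
  LinearMap.mkContinuous
    { toFun := fun ξ => ⟨fun i => c i * ξ (e i), memlp_scale hc e (lp.memℓp ξ)⟩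
      map_add' := fun ξ η => by ext i; exact mul_add _ _ _
      map_smul' := fun z ξ => by ext i; exact mul_left_comm _ _ _ }
    C (fun ξ => l2_norm_le hC e _ _ fun i => by
      simp only [LinearMap.coe_mk, AddHom.coe_mk, norm_mul]
      have := hc i
      gcongr)

@[simp] lemma scaleOp_apply (c : ι → ℂ) (C : ℝ) (hC : 0 ≤ C) (hc : ∀ i, ‖c i‖ ≤ C)
    (e : Equiv.Perm ι) (ξ : lp (fun _ : ι => ℂ) 2) (i : ι) :
    scaleOp c C hC hc e ξ i = c i * ξ (e i) := rfl

lemma inner_scaleOp {c c' : ι → ℂ} {C C' : ℝ} (hC : 0 ≤ C) (hC' : 0 ≤ C')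
    (hc : ∀ i, ‖c i‖ ≤ C) (hc' : ∀ i, ‖c' i‖ ≤ C') (e e' : Equiv.Perm ι)
    (he : ∀ i, e' (e i) = i) (hcc : ∀ i, c' (e i) = star (c i)) (ξ η : lp (fun _ : ι => ℂ) 2) :
    inner ℂ (scaleOp c C hC hc e ξ) η = inner ℂ ξ (scaleOp c' C' hC' hc' e' η) := by
  rw [lp.inner_eq_tsum, lp.inner_eq_tsum,
    ← e.tsum_eq (fun i => inner ℂ (ξ i) (scaleOp c' C' hC' hc' e' η i))]
  refine tsum_congr fun i => ?_
  simp only [scaleOp_apply, he, hcc, RCLike.inner_apply, map_mul, starRingEnd_apply]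
  ring

/-- Such an operator is compact if the coefficients tend to `0`. -/
lemma scaleOp_compact {c : ι → ℂ} {C : ℝ} (hC : 0 ≤ C) (hc : ∀ i, ‖c i‖ ≤ C) (e : Equiv.Perm ι)
    (h0 : ∀ δ : ℝ, 0 < δ → {i | δ < ‖c i‖}.Finite) :
    IsCompactOperator (scaleOp c C hC hc e) := by
  classical
  have hcS : ∀ (S : Set ι) (i : ι), ‖S.indicator c i‖ ≤ C := fun S i =>
    (norm_indicator_le_norm_self c i).trans (hc i)
  have key : ∀ n : ℕ, ∃ A : lp (fun _ : ι => ℂ) 2 →L[ℂ] lp (fun _ : ι => ℂ) 2,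
      IsCompactOperator A ∧ ‖A - scaleOp c C hC hc e‖ ≤ 1 / ((n : ℝ) + 1) := by
    intro n
    have hδ : (0 : ℝ) < 1 / ((n : ℝ) + 1) := by positivity
    set S := {i | 1 / ((n : ℝ) + 1) < ‖c i‖} with hS
    have hfin : S.Finite := h0 _ hδ
    refine ⟨scaleOp (S.indicator c) C hC (hcS S) e, ?_, ?_⟩
    · have hsum : scaleOp (S.indicator c) C hC (hcS S) e =
          ∑ i ∈ hfin.toFinset, (ContinuousLinearMap.toSpanSingleton ℂ
            (lp.single (E := fun _ : ι => ℂ) 2 i (c i))).comp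
            (lp.evalCLM ℂ (fun _ : ι => ℂ) 2 (e i)) := by
        ext ξ j
        rw [sum_apply, lp.coeFn_sum, Finset.sum_apply]
        by_cases hj : j ∈ S
        · rw [Finset.sum_eq_single j]
          · have : lp.evalCLM ℂ (fun _ : ι => ℂ) 2 (e j) ξ = ξ (e j) := rfl
            simp [hj, mul_comm, this]
          · intro b _ hb
            simp [lp.single_apply, hb.symm]
          · intro h
            exact absurd (hfin.mem_toFinset.mpr hj) h
        · rw [Finset.sum_eq_zero]
          · simp [hj]
          · intro b hb
            have : b ≠ j := fun h => hj (h ▸ hfin.mem_toFinset.mp hb)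
            simp [lp.single_apply, this.symm]
      rw [hsum]
      refine Submodule.sum_mem (compactOperator (RingHom.id ℂ) (lp (fun _ : ι => ℂ) 2)
        (lp (fun _ : ι => ℂ) 2)) fun i _ => ?_
      have h1 : IsCompactOperator (lp.evalCLM ℂ (fun _ : ι => ℂ) 2 (e i)) :=
        isCompactOperator_of_locallyCompactSpace_dom _
      exact h1.clm_comp (ContinuousLinearMap.toSpanSingleton ℂ
        (lp.single (E := fun _ : ι => ℂ) 2 i (c i)))
    · refine ContinuousLinearMap.opNorm_le_bound _ hδ.le fun ξ => ?_
      refine l2_norm_le hδ.le e _ _ fun i => ?_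
      simp only [sub_apply, lp.coeFn_sub, Pi.sub_apply, scaleOp_apply]
      rw [← sub_mul, norm_mul]
      gcongr
      by_cases hi : i ∈ S
      · simpa [hi] using hδ.le
      · simp only [hi, not_false_eq_true, Set.indicator_of_notMem, zero_sub, norm_neg]
        exact not_lt.mp hi
  choose A hA hAc using key
  refine isCompactOperator_of_tendsto (F := A) (l := atTop) ?_ (Eventually.of_forall hA)
  rw [tendsto_iff_norm_sub_tendsto_zero]
  exact squeeze_zero (fun _ => norm_nonneg _) hAc tendsto_one_div_add_atTop_nhds_zero_nat

end L2

/-! ### Connes' spectral triple of a compact subset of the real line -/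

/-- The gaps of `F`: the pairs `(a, b)` such that the interval `(a, b)` is a bounded connected
component of `ℝ \ F`. For compact `F` these intervals are the components of `[min F, max F] \ F`. -/
def Gap (F : Set ℝ) : Type :=
  {p : ℝ × ℝ // p.1 < p.2 ∧ p.1 ∈ F ∧ p.2 ∈ F ∧ Disjoint (Ioo p.1 p.2) F}

namespace Gap

variable {F : Set ℝ}

/-- The length `b - a` of the gap `(a, b)`. -/
def length (g : Gap F) : ℝ := g.1.2 - g.1.1

lemma length_pos (g : Gap F) : 0 < g.length := sub_pos.mpr g.2.1

/-- The end points of the gap `g = (a, b)`: `a` is labelled `(g, false)` and `b` is labelled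
`(g, true)`. -/
def endpoint (p : Gap F × Bool) : F :=
  if p.2 then ⟨p.1.1.2, p.1.2.2.2.1⟩ else ⟨p.1.1.1, p.1.2.2.1⟩

/-- The exchange of the two end points of each gap. -/
def swap : Equiv.Perm (Gap F × Bool) := (Equiv.refl _).prodCongr Equiv.boolNot

@[simp] lemma swap_fst (p : Gap F × Bool) : (swap p).1 = p.1 := rfl

@[simp] lemma swap_swap (p : Gap F × Bool) : swap (swap p) = p := by
  rcases p with ⟨g, b⟩; simp [swap]

lemma dist_endpoint_swap (p : Gap F × Bool) :
    dist (endpoint p) (endpoint (swap p)) = p.1.length := by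
  rcases p with ⟨g, b⟩
  have h := g.length_pos
  have h' : |g.1.2 - g.1.1| = g.1.2 - g.1.1 := abs_of_pos h
  cases b
  · simpa [endpoint, swap, Subtype.dist_eq, Real.dist_eq, length, abs_sub_comm] using h'
  · simpa [endpoint, swap, Subtype.dist_eq, Real.dist_eq, length] using h'

lemma length_le [CompactSpace F] (g : Gap F) : g.length ≤ Metric.diam F := by
  have hb : Bornology.IsBounded F := (isCompact_iff_compactSpace.mpr inferInstance).isBounded
  have h := Metric.dist_le_diam_of_mem hb g.2.2.2.1 g.2.2.1
  rwa [Real.dist_eq, abs_of_pos (sub_pos.mpr g.2.1)] at h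

lemma pairwise_disjoint : Pairwise (Function.onFun Disjoint fun g : Gap F => Ioo g.1.1 g.1.2) := by
  intro g g' hne
  rw [Function.onFun, Set.disjoint_left]
  intro x hx hx'
  apply hne
  have h1 : ¬ g.1.1 < g'.1.1 := fun h =>
    Set.disjoint_left.mp g.2.2.2.2 ⟨h, hx'.1.trans hx.2⟩ g'.2.2.1
  have h2 : ¬ g'.1.1 < g.1.1 := fun h =>
    Set.disjoint_left.mp g'.2.2.2.2 ⟨h, hx.1.trans hx'.2⟩ g.2.2.1
  have h3 : ¬ g.1.2 < g'.1.2 := fun h =>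
    Set.disjoint_left.mp g'.2.2.2.2 ⟨hx'.1.trans hx.2, h⟩ g.2.2.2.1
  have h4 : ¬ g'.1.2 < g.1.2 := fun h =>
    Set.disjoint_left.mp g.2.2.2.2 ⟨hx.1.trans hx'.2, h⟩ g'.2.2.2.1
  exact Subtype.ext (Prod.ext (le_antisymm (not_lt.mp h2) (not_lt.mp h1))
    (le_antisymm (not_lt.mp h4) (not_lt.mp h3)))

lemma finite_length_gt [CompactSpace F] {δ : ℝ} (hδ : 0 < δ) :
    {g : Gap F | δ < g.length}.Finite := by
  have hb : Bornology.IsBounded F := (isCompact_iff_compactSpace.mpr inferInstance).isBounded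
  obtain ⟨R, hR⟩ := hb.subset_closedBall 0
  refine (Measure.finite_const_le_meas_of_disjoint_iUnion (volume : Measure ℝ)
    (ENNReal.ofReal_pos.mpr hδ) (As := fun g : Gap F => Ioo g.1.1 g.1.2)
    (fun _ => measurableSet_Ioo) pairwise_disjoint ?_).subset ?_
  · refine ((measure_mono (iUnion_subset fun g => ?_)).trans_lt
      (measure_closedBall_lt_top (μ := (volume : Measure ℝ)) (x := 0) (r := R))).ne
    have h1 := hR g.2.2.1
    have h2 := hR g.2.2.2.1
    rw [Real.closedBall_eq_Icc] at h1 h2 ⊢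
    exact fun x hx => ⟨h1.1.trans hx.1.le, hx.2.le.trans h2.2⟩
  · intro g hg
    simp only [Set.mem_ofPred_eq, Real.volume_Ioo] at hg ⊢
    exact ENNReal.ofReal_le_ofReal hg.le

end Gap

/-- The algebra `Lip(F)` of complex-valued Lipschitz functions on `F`. -/
def lipAlgebra (F : Set ℝ) [CompactSpace F] : StarSubalgebra ℂ C(F, ℂ) where
  carrier := {f | ∃ K : ℝ≥0, LipschitzWith K f}
  mul_mem' := by
    rintro f g ⟨K, hf⟩ ⟨L, hg⟩
    refine ⟨K * ‖g‖₊ + ‖f‖₊ * L, LipschitzWith.of_dist_le_mul fun x y => ?_⟩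
    have h1 := hf.dist_le_mul x y
    have h2 := hg.dist_le_mul x y
    rw [dist_eq_norm] at h1 h2 ⊢
    have e : (f * g) x - (f * g) y = (f x - f y) * g x + f y * (g x - g y) := by
      simp only [ContinuousMap.mul_apply]; ring
    rw [e]
    refine (norm_add_le _ _).trans ?_
    rw [norm_mul, norm_mul]
    have h3 : ‖g x‖ ≤ ‖g‖ := g.norm_coe_le_norm x
    have h4 : ‖f y‖ ≤ ‖f‖ := f.norm_coe_le_norm y
    have h5 : ‖f x - f y‖ * ‖g x‖ ≤ (K * dist x y) * ‖g‖ := by gcongr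
    have h6 : ‖f y‖ * ‖g x - g y‖ ≤ ‖f‖ * (L * dist x y) := by gcongr
    have h7 : ((K * ‖g‖₊ + ‖f‖₊ * L : ℝ≥0) : ℝ) = K * ‖g‖ + ‖f‖ * L := by simp
    rw [h7]
    linarith
  add_mem' := by
    rintro f g ⟨K, hf⟩ ⟨L, hg⟩
    exact ⟨K + L, hf.add hg⟩
  algebraMap_mem' := fun z => ⟨0, LipschitzWith.const z⟩
  star_mem' := by
    rintro f ⟨K, hf⟩
    refine ⟨K, LipschitzWith.of_dist_le_mul fun x y => ?_⟩
    have := hf.dist_le_mul x y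
    rw [dist_eq_norm] at this ⊢
    rwa [ContinuousMap.star_apply, ContinuousMap.star_apply, ← star_sub, norm_star]

namespace Connes

/-- The Hilbert space `⊕_n ℓ²({a_n, b_n})`, i.e. the `ℓ²` space of all (labelled) end points of
gaps `(a_n, b_n)` of `F`. -/
abbrev Hilb (F : Set ℝ) : Type := lp (fun _ : Gap F × Bool => ℂ) 2

variable (F : Set ℝ)

/-- The action `(f ξ)(x) = f(x) ξ(x)` of `Lip(F)`. -/
def rep [CompactSpace F] : lipAlgebra F →⋆ₐ[ℂ] (Hilb F →L[ℂ] Hilb F) where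
  toFun f := scaleOp (fun p => (f : C(F, ℂ)) (Gap.endpoint p)) ‖(f : C(F, ℂ))‖ (norm_nonneg _)
    (fun p => (f : C(F, ℂ)).norm_coe_le_norm _) (Equiv.refl _)
  map_one' := by ext ξ p; simp
  map_mul' f g := by ext ξ p; simp [mul_assoc]
  map_zero' := by ext ξ p; simp
  map_add' f g := by ext ξ p; simp [add_mul]
  commutes' z := by ext ξ p; simp
  map_star' f := by
    rw [ContinuousLinearMap.star_eq_adjoint, ContinuousLinearMap.eq_adjoint_iff]
    intro ξ η
    exact inner_scaleOp _ _ _ _ _ _ (fun _ => rfl) (fun p => by simp) ξ η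

/-- The operator `D = ⊕_n (b_n - a_n)⁻¹ (0 1; 1 0)` with its maximal domain. -/
def dirac : Hilb F →ₗ.[ℂ] Hilb F where
  domain :=
    { carrier := {ξ | Memℓp (fun p : Gap F × Bool => ((p.1.length : ℂ))⁻¹ * ξ (Gap.swap p)) 2}
      add_mem' := by
        intro ξ η hξ hη
        have h := Memℓp.add hξ hη
        simp only [Set.mem_ofPred_eq, lp.coeFn_add, Pi.add_apply, mul_add]
        exact h
      zero_mem' := by
        simp only [Set.mem_ofPred_eq, lp.coeFn_zero, Pi.zero_apply, mul_zero]
        exact zero_memℓp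
      smul_mem' := by
        intro z ξ hξ
        have h := Memℓp.const_smul hξ z
        simp only [Set.mem_ofPred_eq, lp.coeFn_smul, Pi.smul_apply, smul_eq_mul,
          mul_left_comm _ z]
        exact h }
  toFun :=
    { toFun := fun ξ => ⟨fun p => ((p.1.length : ℂ))⁻¹ * (ξ : Hilb F) (Gap.swap p), ξ.2⟩
      map_add' := fun ξ η => by ext p; exact mul_add _ _ _
      map_smul' := fun z ξ => by ext p; exact mul_left_comm _ _ _ }

@[simp] lemma dirac_apply (ξ : (dirac F).domain) (p : Gap F × Bool) :
    dirac F ξ p = ((p.1.length : ℂ))⁻¹ * (ξ : Hilb F) (Gap.swap p) := rfl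

/-- The inverse `D⁻¹ = ⊕_n (b_n - a_n) (0 1; 1 0)`. -/
def diracInv [CompactSpace F] : Hilb F →L[ℂ] Hilb F :=
  scaleOp (fun p => (p.1.length : ℂ)) (Metric.diam F) Metric.diam_nonneg
    (fun p => by
      rw [Complex.norm_real, Real.norm_of_nonneg p.1.length_pos.le]
      exact p.1.length_le) Gap.swap

lemma diracInv_apply [CompactSpace F] (ξ : Hilb F) (p : Gap F × Bool) :
    diracInv F ξ p = (p.1.length : ℂ) * ξ (Gap.swap p) := rfl

lemma diracInv_compact [CompactSpace F] : IsCompactOperator (diracInv F) := by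
  refine scaleOp_compact _ _ _ fun δ hδ => ?_
  refine ((Gap.finite_length_gt (F := F) hδ).prod (Set.finite_univ (α := Bool))).subset ?_
  intro p hp
  simp only [Set.mem_ofPred_eq, Complex.norm_real, Real.norm_of_nonneg p.1.length_pos.le] at hp
  exact ⟨hp, trivial⟩

lemma length_ne {F : Set ℝ} (g : Gap F) : (g.length : ℂ) ≠ 0 :=
  Complex.ofReal_ne_zero.mpr g.length_pos.ne'

lemma diracInv_mem [CompactSpace F] (ξ : Hilb F) : diracInv F ξ ∈ (dirac F).domain := by
  have h : (fun p : Gap F × Bool => ((p.1.length : ℂ))⁻¹ * diracInv F ξ (Gap.swap p)) = ξ := by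
    ext p
    simp [diracInv_apply, inv_mul_cancel_left₀ (length_ne p.1)]
  change Memℓp _ 2
  rw [h]
  exact lp.memℓp ξ

lemma dirac_diracInv [CompactSpace F] (ξ : Hilb F) :
    dirac F ⟨diracInv F ξ, diracInv_mem F ξ⟩ = ξ := by
  ext p
  simp [diracInv_apply, inv_mul_cancel_left₀ (length_ne p.1)]

lemma diracInv_dirac [CompactSpace F] (ξ : (dirac F).domain) : diracInv F (dirac F ξ) = ξ := by
  ext p
  simp [diracInv_apply, mul_inv_cancel_left₀ (length_ne p.1)]

lemma inner_diracInv [CompactSpace F] (ξ η : Hilb F) :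
    inner ℂ (diracInv F ξ) η = inner ℂ ξ (diracInv F η) :=
  inner_scaleOp _ _ _ _ _ _ (fun p => by simp) (fun p => by simp) ξ η

lemma dirac_dense [CompactSpace F] : Dense ((dirac F).domain : Set (Hilb F)) := by
  rw [Submodule.dense_iff_topologicalClosure_eq_top, Submodule.topologicalClosure_eq_top_iff,
    Submodule.eq_bot_iff]
  intro η hη
  have h0 : diracInv F η = 0 := by
    rw [← inner_self_eq_zero (𝕜 := ℂ), inner_diracInv, ← inner_diracInv]
    rw [inner_diracInv, ← inner_conj_symm,
      (Submodule.mem_orthogonal _ _).mp hη _ (diracInv_mem F (diracInv F η)), map_zero]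
  have h1 := dirac_diracInv F η
  rw [← h1]
  ext p
  simp [h0]

lemma dirac_selfAdjoint [CompactSpace F] : IsSelfAdjoint (dirac F) := by
  have hd := dirac_dense F
  have hsymm : (dirac F).IsFormalAdjoint (dirac F) := by
    intro x y
    rw [← diracInv_dirac F y, ← inner_diracInv, diracInv_dirac]
  have key : ∀ y : (LinearPMap.adjoint (dirac F)).domain,
      diracInv F (LinearPMap.adjoint (dirac F) y) = y := by
    intro y
    refine ext_inner_right ℂ fun z => ?_
    have h := LinearPMap.adjoint_isFormalAdjoint hd y ⟨diracInv F z, diracInv_mem F z⟩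
    rw [inner_diracInv]
    rw [dirac_diracInv] at h
    exact h
  rw [LinearPMap.isSelfAdjoint_def]
  have hle : LinearPMap.adjoint (dirac F) ≤ dirac F := by
    refine ⟨fun y hy => ?_, fun y x hxy => ?_⟩
    · have h := diracInv_mem F (LinearPMap.adjoint (dirac F) ⟨y, hy⟩)
      rw [key] at h
      exact h
    rw [← dirac_diracInv F (LinearPMap.adjoint (dirac F) y)]
    congr 1
    exact Subtype.ext ((key y).trans hxy)
  exact le_antisymm hle (hsymm.le_adjoint hd)

lemma rep_mem_domain [CompactSpace F] (f : lipAlgebra F) (ξ : (dirac F).domain) :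
    rep F f (ξ : Hilb F) ∈ (dirac F).domain := by
  have h := memlp_scale (c := fun p : Gap F × Bool => (f : C(F, ℂ)) (Gap.endpoint (Gap.swap p)))
    (fun p => (f : C(F, ℂ)).norm_coe_le_norm _) (Equiv.refl _) ξ.2
  change Memℓp _ 2
  convert h using 2 with p
  exact mul_left_comm _ _ _

lemma commutator_bounded [CompactSpace F] (f : lipAlgebra F) : ∃ C : ℝ, ∀ ξ : (dirac F).domain,
    ‖dirac F ⟨rep F f (ξ : Hilb F), rep_mem_domain F f ξ⟩ - rep F f (dirac F ξ)‖
      ≤ C * ‖(ξ : Hilb F)‖ := by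
  obtain ⟨K, hK⟩ := f.2
  refine ⟨K, fun ξ => l2_norm_le K.2 Gap.swap _ _ fun p => ?_⟩
  have h1 : (dirac F ⟨rep F f (ξ : Hilb F), rep_mem_domain F f ξ⟩ - rep F f (dirac F ξ)) p =
      (p.1.length : ℂ)⁻¹ * ((f : C(F, ℂ)) (Gap.endpoint (Gap.swap p)) -
        (f : C(F, ℂ)) (Gap.endpoint p)) * (ξ : Hilb F) (Gap.swap p) := by
    have h2 : (dirac F ⟨rep F f (ξ : Hilb F), rep_mem_domain F f ξ⟩ - rep F f (dirac F ξ)) p =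
      (p.1.length : ℂ)⁻¹ * ((f : C(F, ℂ)) (Gap.endpoint (Gap.swap p)) *
        (ξ : Hilb F) (Gap.swap p)) - (f : C(F, ℂ)) (Gap.endpoint p) *
        ((p.1.length : ℂ)⁻¹ * (ξ : Hilb F) (Gap.swap p)) := rfl
    rw [h2]; ring
  have h3 := hK.dist_le_mul (Gap.endpoint (Gap.swap p)) (Gap.endpoint p)
  rw [dist_comm (Gap.endpoint (Gap.swap p)), Gap.dist_endpoint_swap, dist_eq_norm] at h3
  rw [h1, norm_mul, norm_mul, norm_inv, Complex.norm_real,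
    Real.norm_of_nonneg p.1.length_pos.le]
  refine mul_le_mul_of_nonneg_right ?_ (norm_nonneg _)
  rw [inv_mul_le_iff₀ p.1.length_pos, mul_comm]
  exact h3

end Connes

/-- Connes' spectral triple `(Lip(F), D, H)` of a compact set `F ⊆ ℝ`. -/
def connesTriple (F : Set ℝ) [CompactSpace F] : SpectralTriple (lipAlgebra F) (Connes.Hilb F) where
  rep := Connes.rep F
  D := Connes.dirac F
  selfAdjoint := Connes.dirac_selfAdjoint F
  rep_mem_domain := Connes.rep_mem_domain F
  commutator_bounded := Connes.commutator_bounded F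
  inv := Connes.diracInv F
  inv_compact := Connes.diracInv_compact F
  inv_mem_domain := Connes.diracInv_mem F
  apply_inv := Connes.dirac_diracInv F
  inv_apply := Connes.diracInv_dirac F

/-! `D⁻¹` exchanges the two ends of each gap and multiplies by its length ℓ, so |D|^{-α} is diagonal
in the basis of end points, with each eigenvalue ℓ^α repeated for the two ends. Everything depends
on the exponent of convergence of ∑ ℓ^α, which is at most 1 because the gaps are disjoint and
bounded.

Dimension. If ∑ ℓ^α converges, the partial sums of singular values are bounded, so |D|^{-α} lies in
𝓛₀^{1,∞}. Conversely, if |D|^{-α} lies in 𝓛^{1,∞}, then log n = O(n^θ) for every θ > 0 bounds the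
number of eigenvalues above t by a multiple of t^{-ρ} for any ρ > 1, and ∑ ℓ^β converges for every β
> α (`summable_of_memL1Infty`). Hence both expressions for the dimension equal the exponent of
convergence.

Box dimension. Distinct gaps longer than 2ε need distinct balls of radius ε
(`card_le_externalCoveringNumber`). In the other direction, when F is null the distance of two of
its points is the total length of the gaps between them, so for α ≤ 1 its α-th power is at most the
sum of ℓ^α over these gaps. Cutting F at equal increments of that sum gives O(ε^{-α}) balls
(`externalCoveringNumber_le`).

Singular trace. Put A = |D|^{-d} with eigenvalues a = ℓ^d; the exponent of convergence of ∑ a^t is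
then 1. The trace is an ultrafilter limit of T ↦ Tr φ(T) / Tr φ(A), where φ behaves like t^{1+ε} if
∑ a diverges, and like t^{1-ε}, made linear near 0, if ∑ a converges. In both cases Tr φ(A) is
finite but large compared with φ(1), so finite rank projections vanish in the limit. For additivity,
φ is a weighted sum over dyadic s of t²/(s+t) or t/(s+t). For these, one of the two inequalities is
exact because the resolvent is operator decreasing, and the other holds after halving s because the
inverse is operator convex. Halving s shifts the dyadic index and costs a factor 2^ε, which tends to
1.

Measure. The operators with diagonal f·a, for f continuous on F, lie in the domain of the trace, so
f ↦ τ(f A) extends from Lip(F) to a positive functional on C(F), and the Riesz theorem applies. Its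
total mass is τ(A) = 1. -/

/-! ### The trace of positive operators -/

section Trace

variable {ι H : Type*} [NormedAddCommGroup H] [InnerProductSpace ℂ H]

/-- The trace `∑ ⟨A e_i, e_i⟩ ∈ [0, ∞]` of a positive operator. -/
def opTrace (b : HilbertBasis ι ℂ H) (A : H →L[ℂ] H) : ℝ≥0∞ :=
  ∑' i, ENNReal.ofReal (A.reApplyInnerSelf (b i))

lemma reApplyInnerSelf_mono {A B : H →L[ℂ] H} (h : A ≤ B) (x : H) :
    A.reApplyInnerSelf x ≤ B.reApplyInnerSelf x := by
  have h1 := ((ContinuousLinearMap.le_def A B).mp h).re_inner_nonneg_left x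
  rw [sub_apply, inner_sub_left, map_sub] at h1
  exact sub_nonneg.mp h1

lemma reApplyInnerSelf_nonneg {A : H →L[ℂ] H} (h : 0 ≤ A) (x : H) :
    0 ≤ A.reApplyInnerSelf x :=
  ((ContinuousLinearMap.nonneg_iff_isPositive A).mp h).re_inner_nonneg_left x

lemma opTrace_mono (b : HilbertBasis ι ℂ H) {A B : H →L[ℂ] H} (h : A ≤ B) :
    opTrace b A ≤ opTrace b B :=
  ENNReal.tsum_le_tsum fun i => ENNReal.ofReal_le_ofReal (reApplyInnerSelf_mono h (b i))

lemma opTrace_add (b : HilbertBasis ι ℂ H) {A B : H →L[ℂ] H} (hA : 0 ≤ A) (hB : 0 ≤ B) :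
    opTrace b (A + B) = opTrace b A + opTrace b B := by
  rw [opTrace, opTrace, opTrace, ← ENNReal.tsum_add]
  refine tsum_congr fun i => ?_
  rw [← ENNReal.ofReal_add (reApplyInnerSelf_nonneg hA _) (reApplyInnerSelf_nonneg hB _)]
  simp [ContinuousLinearMap.reApplyInnerSelf, inner_add_left]

lemma opTrace_smul (b : HilbertBasis ι ℂ H) {c : ℝ} (hc : 0 ≤ c) (A : H →L[ℂ] H) :
    opTrace b (c • A) = ENNReal.ofReal c * opTrace b A := by
  rw [opTrace, opTrace, ← ENNReal.tsum_mul_left]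
  refine tsum_congr fun i => ?_
  rw [← ENNReal.ofReal_mul hc]
  simp [ContinuousLinearMap.reApplyInnerSelf, inner_smul_left_eq_smul]

lemma hasSum_norm_inner_sq (b : HilbertBasis ι ℂ H) (x : H) :
    HasSum (fun i => ‖inner ℂ (b i) x‖ ^ 2) (‖x‖ ^ 2) := by
  have h := (b.hasSum_inner_mul_inner x x).mapL Complex.reCLM
  have h1 : Complex.reCLM (inner ℂ x x) = ‖x‖ ^ 2 := inner_self_eq_norm_sq (𝕜 := ℂ) x
  rw [h1] at h
  refine h.congr_fun fun i => ?_
  rw [← inner_conj_symm x (b i), RCLike.conj_mul]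
  norm_cast

variable [CompleteSpace H]

lemma opTrace_star_mul_self (b : HilbertBasis ι ℂ H) (X : H →L[ℂ] H) :
    opTrace b (star X * X) = ∑' i, ∑' j, ENNReal.ofReal (‖inner ℂ (b j) (X (b i))‖ ^ 2) := by
  refine tsum_congr fun i => ?_
  rw [← ENNReal.ofReal_tsum_of_nonneg (fun _ => by positivity)
    (hasSum_norm_inner_sq b _).summable, (hasSum_norm_inner_sq b _).tsum_eq]
  congr 1
  rw [ContinuousLinearMap.reApplyInnerSelf, ContinuousLinearMap.star_eq_adjoint,
    mul_apply_eq_comp,  ContinuousLinearMap.adjoint_inner_left, inner_self_eq_norm_sq]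

/-- Both sides are the double sum of the squared moduli of the matrix entries. The terms are
nonnegative, so the order of summation is free and no trace class assumption is needed. -/
lemma opTrace_star_mul_self_comm (b : HilbertBasis ι ℂ H) (X : H →L[ℂ] H) :
    opTrace b (star X * X) = opTrace b (X * star X) := by
  have h := opTrace_star_mul_self b (star X)
  rw [star_star] at h
  rw [h, opTrace_star_mul_self, ENNReal.tsum_comm]
  refine tsum_congr fun i => tsum_congr fun j => ?_
  rw [ContinuousLinearMap.star_eq_adjoint, ContinuousLinearMap.adjoint_inner_right,
    ← inner_conj_symm, RCLike.norm_conj]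

/-- The number `Tr(X^{1/2} Y X^{1/2})`, for positive `X` and `Y`. -/
def tracePair (b : HilbertBasis ι ℂ H) (X Y : H →L[ℂ] H) : ℝ≥0∞ :=
  opTrace b (CFC.sqrt X * Y * CFC.sqrt X)

/-- This is traciality for Y^{1/2} X^{1/2}. It transfers additivity from the second argument to the
first even when X and Y do not commute. -/
lemma tracePair_comm (b : HilbertBasis ι ℂ H) {X Y : H →L[ℂ] H} (hX : 0 ≤ X) (hY : 0 ≤ Y) :
    tracePair b X Y = tracePair b Y X := by
  have h := opTrace_star_mul_self_comm b (CFC.sqrt Y * CFC.sqrt X)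
  have hx : star (CFC.sqrt X) = CFC.sqrt X := (CFC.sqrt_nonneg X).isSelfAdjoint
  have hy : star (CFC.sqrt Y) = CFC.sqrt Y := (CFC.sqrt_nonneg Y).isSelfAdjoint
  rw [star_mul, hx, hy] at h
  rw [tracePair, tracePair]
  have hX' := CFC.sqrt_mul_sqrt_self X
  have hY' := CFC.sqrt_mul_sqrt_self Y
  generalize CFC.sqrt X = S at *
  generalize CFC.sqrt Y = T at *
  subst hX' hY'
  simpa only [mul_assoc] using h

lemma conj_sqrt_nonneg (X : H →L[ℂ] H) {Y : H →L[ℂ] H} (hY : 0 ≤ Y) :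
    0 ≤ CFC.sqrt X * Y * CFC.sqrt X := by
  simpa using conjugate_le_conjugate_of_nonneg hY (CFC.sqrt_nonneg X)

lemma tracePair_add_right (b : HilbertBasis ι ℂ H) (X : H →L[ℂ] H) {Y Z : H →L[ℂ] H}
    (hY : 0 ≤ Y) (hZ : 0 ≤ Z) :
    tracePair b X (Y + Z) = tracePair b X Y + tracePair b X Z := by
  rw [tracePair, mul_add, add_mul, opTrace_add b (conj_sqrt_nonneg X hY) (conj_sqrt_nonneg X hZ)]
  rfl

lemma tracePair_add_left (b : HilbertBasis ι ℂ H) {X Y Z : H →L[ℂ] H}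
    (hX : 0 ≤ X) (hY : 0 ≤ Y) (hZ : 0 ≤ Z) :
    tracePair b (X + Y) Z = tracePair b X Z + tracePair b Y Z := by
  rw [tracePair_comm b (add_nonneg hX hY) hZ, tracePair_add_right b Z hX hY,
    tracePair_comm b hX hZ, tracePair_comm b hY hZ]

lemma tracePair_mono_right (b : HilbertBasis ι ℂ H) (X : H →L[ℂ] H) {Y Z : H →L[ℂ] H}
    (h : Y ≤ Z) : tracePair b X Y ≤ tracePair b X Z :=
  opTrace_mono b (conjugate_le_conjugate_of_nonneg h (CFC.sqrt_nonneg X))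

lemma tracePair_of_commute (b : HilbertBasis ι ℂ H) {X Y : H →L[ℂ] H} (hX : 0 ≤ X)
    (h : Commute X Y) : tracePair b X Y = opTrace b (X * Y) := by
  have h1 : Commute (CFC.sqrt X) Y := h.cfcₙ_nnreal _
  rw [tracePair, mul_assoc, ← h1.eq, ← mul_assoc, CFC.sqrt_mul_sqrt_self X]

/-- The function `T ↦ Tr(T ψ(T))` is invariant under `A* A ↦ A A*` if `ψ` intertwines. -/
lemma tracePair_star_mul_self (b : HilbertBasis ι ℂ H) {A P Q : H →L[ℂ] H} (hP : 0 ≤ P)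
    (hQ : 0 ≤ Q) (h : A * P = Q * A) :
    tracePair b (star A * A) P = tracePair b (A * star A) Q := by
  have hA : 0 ≤ A * star A := mul_star_self_nonneg A
  have hA' : 0 ≤ star A * A := star_mul_self_nonneg A
  have hp : star (CFC.sqrt P) = CFC.sqrt P := (CFC.sqrt_nonneg P).isSelfAdjoint
  have h' : P * star A = star A * Q := by
    have := congrArg star h
    simpa [star_mul, hP.isSelfAdjoint.star_eq, hQ.isSelfAdjoint.star_eq] using this
  -- The relation and its adjoint give A A* Q = A P A* = Q A A*.
  have hc : Commute (A * star A) Q := by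
    rw [Commute, SemiconjBy, mul_assoc, ← h', ← mul_assoc, h, mul_assoc]
  have h1 := opTrace_star_mul_self_comm b (A * CFC.sqrt P)
  rw [star_mul, hp] at h1
  rw [tracePair_comm b hA' hP, tracePair_of_commute b hA hc, hc.eq, tracePair]
  have h2 : A * CFC.sqrt P * (CFC.sqrt P * star A) = Q * (A * star A) := by
    rw [mul_assoc, ← mul_assoc (CFC.sqrt P), CFC.sqrt_mul_sqrt_self P, ← mul_assoc, h, mul_assoc]
  rw [h2] at h1
  rw [← h1]
  simp only [mul_assoc]

lemma opTrace_lt_top_of_isStarProjection (b : HilbertBasis ι ℂ H) {P : H →L[ℂ] H}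
    (hP : IsStarProjection P) (hfin : FiniteDimensional ℂ (LinearMap.range (P : H →ₗ[ℂ] H))) :
    opTrace b P < ⊤ := by
  set K := LinearMap.range (P : H →ₗ[ℂ] H)
  set v := stdOrthonormalBasis ℂ K
  have hPP : star P * P = P := by rw [hP.isSelfAdjoint.star_eq, hP.isIdempotentElem.eq]
  -- The quadratic form of `P` is ‖P x‖², which is expanded in an orthonormal basis of the range;
  -- the trace becomes a finite sum of Parseval sums.
  have key : ∀ x : H, P.reApplyInnerSelf x ≤ ∑ j, ‖inner ℂ x (v j : H)‖ ^ 2 := by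
    intro x
    have h1 : P.reApplyInnerSelf x = ‖P x‖ ^ 2 := by
      nth_rw 1 [← hPP]
      rw [ContinuousLinearMap.reApplyInnerSelf, ContinuousLinearMap.star_eq_adjoint,
        mul_apply_eq_comp,  ContinuousLinearMap.adjoint_inner_left,
        inner_self_eq_norm_sq]
    have h2 := v.sum_sq_norm_inner_right (⟨P x, ⟨x, rfl⟩⟩ : K)
    have h3 : ‖(⟨P x, ⟨x, rfl⟩⟩ : K)‖ = ‖P x‖ := rfl
    rw [h1, ← h3, ← h2]
    refine le_of_eq (Finset.sum_congr rfl fun j _ => ?_)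
    congr 1
    rw [Submodule.coe_inner]
    change ‖inner ℂ (v j : H) (P x)‖ = _
    obtain ⟨y, hy⟩ := (v j).2
    have h4 : P (v j : H) = v j := by
      rw [← hy]
      exact congrArg (fun T : H →L[ℂ] H => T y) hP.isIdempotentElem.eq
    have h5 : star P = P := hP.isSelfAdjoint.star_eq
    rw [← ContinuousLinearMap.adjoint_inner_left, ← ContinuousLinearMap.star_eq_adjoint, h5, h4,
      ← inner_conj_symm, RCLike.norm_conj]
  calc opTrace b P ≤ ∑' i, ∑ j, ENNReal.ofReal (‖inner ℂ (b i) (v j : H)‖ ^ 2) := by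
        refine ENNReal.tsum_le_tsum fun i => ?_
        rw [← ENNReal.ofReal_sum_of_nonneg (fun _ _ => by positivity)]
        exact ENNReal.ofReal_le_ofReal (key _)
    _ = ∑ j, ∑' i, ENNReal.ofReal (‖inner ℂ (b i) (v j : H)‖ ^ 2) :=
        Summable.tsum_finsetSum fun _ _ => ENNReal.summable
    _ < ⊤ := by
        refine ENNReal.sum_lt_top.mpr fun j _ => ?_
        rw [← ENNReal.ofReal_tsum_of_nonneg (fun _ => by positivity)
          (hasSum_norm_inner_sq b _).summable]
        exact ENNReal.ofReal_lt_top

end Trace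


/-! ### Resolvents of positive operators and the functionals built from them -/

section Resolvent

variable {ι H : Type*} [NormedAddCommGroup H] [InnerProductSpace ℂ H]

/-- The operator `(s + T)⁻¹`. -/
def posResolvent (s : ℝ) (T : H →L[ℂ] H) : H →L[ℂ] H :=
  Ring.inverse (algebraMap ℝ (H →L[ℂ] H) s + T)

variable {s : ℝ} {S T : H →L[ℂ] H}

lemma posResolvent_eq_of_mul {R : H →L[ℂ] H} (h1 : (algebraMap ℝ (H →L[ℂ] H) s + T) * R = 1)
    (h2 : R * (algebraMap ℝ (H →L[ℂ] H) s + T) = 1) : posResolvent s T = R :=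
  Ring.inverse_unit (⟨_, R, h1, h2⟩ : (H →L[ℂ] H)ˣ)

variable [CompleteSpace H]

lemma isStrictlyPositive_algebraMap_add (hs : 0 < s) (hT : 0 ≤ T) :
    IsStrictlyPositive (algebraMap ℝ (H →L[ℂ] H) s + T) := by grind

lemma add_mul_posResolvent (hs : 0 < s) (hT : 0 ≤ T) :
    (algebraMap ℝ (H →L[ℂ] H) s + T) * posResolvent s T = 1 :=
  Ring.mul_inverse_cancel _ (isStrictlyPositive_algebraMap_add hs hT).isUnit

lemma posResolvent_mul_add (hs : 0 < s) (hT : 0 ≤ T) :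
    posResolvent s T * (algebraMap ℝ (H →L[ℂ] H) s + T) = 1 :=
  Ring.inverse_mul_cancel _ (isStrictlyPositive_algebraMap_add hs hT).isUnit

lemma posResolvent_nonneg (hs : 0 < s) (hT : 0 ≤ T) : 0 ≤ posResolvent s T :=
  (isStrictlyPositive_algebraMap_add hs hT).ringInverse.nonneg

lemma mul_posResolvent (hs : 0 < s) (hT : 0 ≤ T) :
    T * posResolvent s T = 1 - s • posResolvent s T := by
  have h := add_mul_posResolvent hs hT
  rw [add_mul, ← Algebra.smul_def] at h
  rw [← h]; abel

lemma posResolvent_mul (hs : 0 < s) (hT : 0 ≤ T) :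
    posResolvent s T * T = 1 - s • posResolvent s T := by
  have h := posResolvent_mul_add hs hT
  rw [mul_add, ← Algebra.commutes, ← Algebra.smul_def] at h
  rw [← h]; abel

lemma commute_posResolvent (hs : 0 < s) (hT : 0 ≤ T) : Commute T (posResolvent s T) :=
  (mul_posResolvent hs hT).trans (posResolvent_mul hs hT).symm

lemma one_sub_smul_posResolvent_nonneg (hs : 0 < s) (hT : 0 ≤ T) :
    0 ≤ 1 - s • posResolvent s T := by
  rw [← mul_posResolvent hs hT]
  exact (commute_posResolvent hs hT).mul_nonneg hT (posResolvent_nonneg hs hT)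

lemma posResolvent_anti (hs : 0 < s) (hS : 0 ≤ S) (h : S ≤ T) :
    posResolvent s T ≤ posResolvent s S :=
  CStarAlgebra.ringInverse_le_ringInverse (add_le_add_right h _)
    (isStrictlyPositive_algebraMap_add hs hS)

lemma posResolvent_two_smul (hs : 0 < s) (hT : 0 ≤ T) :
    posResolvent s ((2 : ℝ) • T) = (2⁻¹ : ℝ) • posResolvent (s / 2) T := by
  have h : algebraMap ℝ (H →L[ℂ] H) s + (2 : ℝ) • T =
      (2 : ℝ) • (algebraMap ℝ (H →L[ℂ] H) (s / 2) + T) := by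
    rw [smul_add, Algebra.algebraMap_eq_smul_one, Algebra.algebraMap_eq_smul_one, smul_smul]
    congr 2
    ring
  apply posResolvent_eq_of_mul <;> rw [h, smul_mul_smul_comm]
  · rw [add_mul_posResolvent (half_pos hs) hT]; norm_num
  · rw [posResolvent_mul_add (half_pos hs) hT]; norm_num

/-- Midpoint convexity of the inverse at 2S and 2T; pulling the 2 out of each resolvent turns s into
s/2 and 1/2 into 1/4. -/
lemma posResolvent_add_le (hs : 0 < s) (hS : 0 ≤ S) (hT : 0 ≤ T) :
    posResolvent s (S + T) ≤
      (4⁻¹ : ℝ) • (posResolvent (s / 2) S + posResolvent (s / 2) T) := by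
  have hS2 : 0 ≤ (2 : ℝ) • S := smul_nonneg zero_le_two hS
  have hT2 : 0 ≤ (2 : ℝ) • T := smul_nonneg zero_le_two hT
  have h := (CStarAlgebra.convexOn_ringInverse_algebraMap_add (A := H →L[ℂ] H) hs).2
    (mem_Ici.mpr hS2) (mem_Ici.mpr hT2) (by norm_num : (0 : ℝ) ≤ 2⁻¹)
    (by norm_num : (0 : ℝ) ≤ 2⁻¹) (by norm_num)
  have e : (2⁻¹ : ℝ) • (2 : ℝ) • S + (2⁻¹ : ℝ) • (2 : ℝ) • T = S + T := by
    simp [smul_smul]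
  change posResolvent s _ ≤ _ • posResolvent s _ + _ • posResolvent s _ at h
  rw [e, posResolvent_two_smul hs hS, posResolvent_two_smul hs hT, smul_smul, smul_smul] at h
  rw [smul_add]
  norm_num at h ⊢
  exact h

lemma posResolvent_intertwine (hs : 0 < s) (A : H →L[ℂ] H) :
    A * posResolvent s (star A * A) = posResolvent s (A * star A) * A := by
  have hA : 0 ≤ A * star A := mul_star_self_nonneg A
  have hA' : 0 ≤ star A * A := star_mul_self_nonneg A
  have h : A * (algebraMap ℝ (H →L[ℂ] H) s + star A * A) =
      (algebraMap ℝ (H →L[ℂ] H) s + A * star A) * A := by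
    rw [mul_add, add_mul, Algebra.commutes, mul_assoc]
  calc A * posResolvent s (star A * A)
      = posResolvent s (A * star A) * ((algebraMap ℝ (H →L[ℂ] H) s + A * star A) * A) *
        posResolvent s (star A * A) := by
        rw [← mul_assoc, posResolvent_mul_add hs hA, one_mul]
    _ = posResolvent s (A * star A) * A := by
        rw [← h, mul_assoc, mul_assoc, add_mul_posResolvent hs hA', mul_one]

lemma posResolvent_of_isStarProjection (hs : 0 < s) {P : H →L[ℂ] H} (hP : IsStarProjection P) :
    posResolvent s P = s⁻¹ • (1 - P) + (1 + s)⁻¹ • P := by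
  have hPP : P * P = P := hP.isIdempotentElem.eq
  have h1 : s * s⁻¹ = 1 := mul_inv_cancel₀ hs.ne'
  have h2 : s * (1 + s)⁻¹ + (1 + s)⁻¹ = 1 := by field_simp; ring
  have key : s • (s⁻¹ • (1 - P) + (1 + s)⁻¹ • P) + (1 + s)⁻¹ • P = 1 := by
    rw [smul_add, smul_smul, smul_smul, h1, one_smul, add_assoc, ← add_smul, h2, one_smul,
      sub_add_cancel]
  apply posResolvent_eq_of_mul
  · rw [add_mul, ← Algebra.smul_def, mul_add, mul_smul_comm, mul_smul_comm, mul_sub, mul_one, hPP,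
      sub_self, smul_zero, zero_add, key]
  · rw [mul_add, ← Algebra.commutes, ← Algebra.smul_def, add_mul, smul_mul_assoc, smul_mul_assoc,
      sub_mul, one_mul, hPP, sub_self, smul_zero, zero_add, key]

/-- The functional `T ↦ Tr(T (s + T)⁻¹)`. -/
def concaveTrace (b : HilbertBasis ι ℂ H) (s : ℝ) (T : H →L[ℂ] H) : ℝ≥0∞ :=
  tracePair b T (posResolvent s T)

/-- The functional `T ↦ Tr(T² (s + T)⁻¹)`. -/
def convexTrace (b : HilbertBasis ι ℂ H) (s : ℝ) (T : H →L[ℂ] H) : ℝ≥0∞ :=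
  tracePair b T (1 - s • posResolvent s T)

variable (b : HilbertBasis ι ℂ H)

lemma concaveTrace_eq (hs : 0 < s) (hT : 0 ≤ T) :
    concaveTrace b s T = opTrace b (T * posResolvent s T) :=
  tracePair_of_commute b hT (commute_posResolvent hs hT)

lemma convexTrace_eq (hs : 0 < s) (hT : 0 ≤ T) :
    convexTrace b s T = opTrace b (T * (1 - s • posResolvent s T)) :=
  tracePair_of_commute b hT
    ((Commute.one_right T).sub_right ((commute_posResolvent hs hT).smul_right s))

/-- Only the outer factor S + T is split; the resolvent of S + T is then bounded by that of S or of
T. The symmetric form of `tracePair` makes this legitimate without commutation. -/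
lemma concaveTrace_add_le (hs : 0 < s) (hS : 0 ≤ S) (hT : 0 ≤ T) :
    concaveTrace b s (S + T) ≤ concaveTrace b s S + concaveTrace b s T := by
  rw [concaveTrace, tracePair_add_left b hS hT (posResolvent_nonneg hs (add_nonneg hS hT))]
  exact add_le_add
    (tracePair_mono_right b S (posResolvent_anti hs hS (le_add_of_nonneg_right hT)))
    (tracePair_mono_right b T (posResolvent_anti hs hT (le_add_of_nonneg_left hS)))

/-- Here T is paired with 1 - s(s+T)⁻¹, which increases with T, so the argument for
`concaveTrace_add_le` gives the opposite inequality. -/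
lemma le_convexTrace_add (hs : 0 < s) (hS : 0 ≤ S) (hT : 0 ≤ T) :
    convexTrace b s S + convexTrace b s T ≤ convexTrace b s (S + T) := by
  rw [convexTrace, convexTrace, convexTrace,
    tracePair_add_left b hS hT (one_sub_smul_posResolvent_nonneg hs (add_nonneg hS hT))]
  exact add_le_add
    (tracePair_mono_right b S (sub_le_sub_left (smul_le_smul_of_nonneg_left
      (posResolvent_anti hs hS (le_add_of_nonneg_right hT)) hs.le) _))
    (tracePair_mono_right b T (sub_le_sub_left (smul_le_smul_of_nonneg_left
      (posResolvent_anti hs hT (le_add_of_nonneg_left hS)) hs.le) _))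

/-- Write T(s+T)⁻¹ = 1 - s(s+T)⁻¹ and multiply `posResolvent_add_le` by 2s: the coefficient becomes
s/2, the one that belongs to the parameter s/2. -/
lemma le_concaveTrace_add (hs : 0 < s) (hS : 0 ≤ S) (hT : 0 ≤ T) :
    concaveTrace b (s / 2) S + concaveTrace b (s / 2) T ≤ 2 * concaveTrace b s (S + T) := by
  have hs2 := half_pos hs
  have hST := add_nonneg hS hT
  have h2 : (2 : ℝ≥0∞) = ENNReal.ofReal 2 := by simp
  rw [concaveTrace_eq b hs hST, concaveTrace_eq b hs2 hS, concaveTrace_eq b hs2 hT,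
    mul_posResolvent hs hST, mul_posResolvent hs2 hS, mul_posResolvent hs2 hT,
    ← opTrace_add b (one_sub_smul_posResolvent_nonneg hs2 hS)
      (one_sub_smul_posResolvent_nonneg hs2 hT), h2, ← opTrace_smul b zero_le_two]
  refine opTrace_mono b ?_
  have h := smul_le_smul_of_nonneg_left (posResolvent_add_le hs hS hT)
    (by positivity : (0 : ℝ) ≤ 2 * s)
  rw [← sub_nonneg] at h ⊢
  convert h using 1
  module

/-- Write T²(s+T)⁻¹ = T - s + s²(s+T)⁻¹. After multiplying `posResolvent_add_le` by s² the
coefficient is (s/2)², and s splits as s/2 + s/2, so the right side consists of the same expressions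
at s/2. -/
lemma convexTrace_add_le (hs : 0 < s) (hS : 0 ≤ S) (hT : 0 ≤ T) :
    convexTrace b s (S + T) ≤ convexTrace b (s / 2) S + convexTrace b (s / 2) T := by
  have hs2 := half_pos hs
  have hST := add_nonneg hS hT
  have e : ∀ {r : ℝ} {X : H →L[ℂ] H}, 0 < r → 0 ≤ X → X * (1 - r • posResolvent r X) =
      X - r • (1 : H →L[ℂ] H) + (r * r) • posResolvent r X := by
    intro r X hr hX
    rw [mul_sub, mul_one, mul_smul_comm, mul_posResolvent hr hX]
    module
  have pos : ∀ {r : ℝ} {X : H →L[ℂ] H}, 0 < r → 0 ≤ X → 0 ≤ X * (1 - r • posResolvent r X) := by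
    intro r X hr hX
    exact ((Commute.one_right X).sub_right ((commute_posResolvent hr hX).smul_right r)).mul_nonneg
      hX (one_sub_smul_posResolvent_nonneg hr hX)
  rw [convexTrace_eq b hs hST, convexTrace_eq b hs2 hS, convexTrace_eq b hs2 hT,
    ← opTrace_add b (pos hs2 hS) (pos hs2 hT), e hs hST, e hs2 hS, e hs2 hT]
  refine opTrace_mono b ?_
  have h := smul_le_smul_of_nonneg_left (posResolvent_add_le hs hS hT)
    (by positivity : (0 : ℝ) ≤ s * s)
  rw [← sub_nonneg] at h ⊢
  convert h using 1
  module

lemma concaveTrace_star_mul_self (hs : 0 < s) (A : H →L[ℂ] H) :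
    concaveTrace b s (star A * A) = concaveTrace b s (A * star A) :=
  tracePair_star_mul_self b (posResolvent_nonneg hs (star_mul_self_nonneg A))
    (posResolvent_nonneg hs (mul_star_self_nonneg A)) (posResolvent_intertwine hs A)

lemma convexTrace_star_mul_self (hs : 0 < s) (A : H →L[ℂ] H) :
    convexTrace b s (star A * A) = convexTrace b s (A * star A) := by
  refine tracePair_star_mul_self b (one_sub_smul_posResolvent_nonneg hs (star_mul_self_nonneg A))
    (one_sub_smul_posResolvent_nonneg hs (mul_star_self_nonneg A)) ?_
  rw [mul_sub, sub_mul, mul_one, one_mul, mul_smul_comm, smul_mul_assoc,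
    posResolvent_intertwine hs A]

lemma mul_posResolvent_of_isStarProjection (hs : 0 < s) {P : H →L[ℂ] H}
    (hP : IsStarProjection P) : P * posResolvent s P = (1 + s)⁻¹ • P := by
  have hPP : P * P = P := hP.isIdempotentElem.eq
  rw [posResolvent_of_isStarProjection hs hP, mul_add, mul_smul_comm, mul_smul_comm, mul_sub,
    mul_one, hPP, sub_self, smul_zero, zero_add]

lemma concaveTrace_of_isStarProjection (hs : 0 < s) {P : H →L[ℂ] H} (hP : IsStarProjection P) :
    concaveTrace b s P = ENNReal.ofReal (1 + s)⁻¹ * opTrace b P := by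
  rw [concaveTrace_eq b hs hP.nonneg, mul_posResolvent_of_isStarProjection hs hP,
    opTrace_smul b (by positivity)]

lemma convexTrace_of_isStarProjection (hs : 0 < s) {P : H →L[ℂ] H} (hP : IsStarProjection P) :
    convexTrace b s P = ENNReal.ofReal (1 + s)⁻¹ * opTrace b P := by
  have h : (1 : ℝ) - s * (1 + s)⁻¹ = (1 + s)⁻¹ := by field_simp; ring
  rw [convexTrace_eq b hs hP.nonneg, mul_sub, mul_one, mul_smul_comm,
    mul_posResolvent_of_isStarProjection hs hP, smul_smul]
  nth_rw 1 [← one_smul ℝ P]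
  rw [← sub_smul, h, opTrace_smul b (by positivity)]

end Resolvent


/-! ### Singular traces as limits of approximately additive functionals -/

/-- An additive map into [0, ∞] is monotone and respects integer multiples, so its value at c is
squeezed by the fractions ⌊cn⌋/n and (⌊cn⌋+1)/n. Homogeneity of a weight thus follows from
additivity, also where it is infinite. -/
lemma ennreal_map_eq_mul_of_add {g : ℝ≥0 → ℝ≥0∞} (h0 : g 0 = 0)
    (hadd : ∀ c d, g (c + d) = g c + g d) (c : ℝ≥0) : g c = c * g 1 := by
  -- If g 1 = ∞, multiplication by g 1 is continuous only away from 0.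
  rcases eq_or_ne c 0 with rfl | hc
  · simp [h0]
  have hmono : Monotone g := fun x y hxy => by
    rw [← add_tsub_cancel_of_le hxy, hadd]
    exact le_self_add
  have hnat : ∀ (n : ℕ) (x : ℝ≥0), g (n * x) = n * g x := by
    intro n x
    induction n with
    | zero => simp [h0]
    | succ n ih => push_cast; rw [add_mul, one_mul, hadd, ih, add_mul, one_mul]
  have hnat1 : ∀ n : ℕ, g n = n * g 1 := fun n => by simpa using hnat n 1
  have hlim : Tendsto (fun n : ℕ => (⌊(c : ℝ) * n⌋₊ : ℝ) / n) atTop (𝓝 (c : ℝ)) :=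
    (tendsto_nat_floor_mul_div_atTop c.coe_nonneg).comp tendsto_natCast_atTop_atTop
  have hlim' : Tendsto (fun n : ℕ => ((⌊(c : ℝ) * n⌋₊ + 1 : ℕ) : ℝ) / n) atTop (𝓝 (c : ℝ)) := by
    have h := hlim.add (tendsto_inv_atTop_nhds_zero_nat (𝕜 := ℝ))
    rw [add_zero] at h
    refine h.congr fun n => ?_
    push_cast
    rw [add_div, one_div]
  have hofReal : ENNReal.ofReal (c : ℝ) = c := ENNReal.ofReal_coe_nnreal
  have hc' : (c : ℝ≥0∞) ≠ 0 := by simpa using hc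
  have hmul : ∀ {u : ℕ → ℝ}, Tendsto u atTop (𝓝 (c : ℝ)) →
      Tendsto (fun n => ENNReal.ofReal (u n) * g 1) atTop (𝓝 (c * g 1)) := by
    intro u hu
    have h := ENNReal.tendsto_ofReal hu
    rw [hofReal] at h
    exact ENNReal.Tendsto.mul_const h (Or.inl hc')
  have hq : ∀ {n : ℕ} (m : ℕ), 0 < n →
      ENNReal.ofReal ((m : ℝ) / n) * g 1 = (m * g 1) / n := by
    intro n m hn
    rw [ENNReal.ofReal_div_of_pos (by exact_mod_cast hn), ENNReal.ofReal_natCast,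
      ENNReal.ofReal_natCast, ENNReal.mul_div_right_comm]
  refine le_antisymm (ge_of_tendsto (hmul hlim') ?_) (le_of_tendsto (hmul hlim) ?_)
  · filter_upwards [eventually_gt_atTop 0] with n hn
    rw [hq _ hn, ENNReal.le_div_iff_mul_le (Or.inl (by exact_mod_cast hn.ne')) (Or.inl (by simp)),
      mul_comm, ← hnat, ← hnat1]
    refine hmono ?_
    rw [← NNReal.coe_le_coe, mul_comm]
    push_cast
    exact (Nat.lt_floor_add_one _).le
  · filter_upwards [eventually_gt_atTop 0] with n hn
    rw [hq _ hn]
    refine ENNReal.div_le_of_le_mul' ?_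
    rw [← hnat1, ← hnat]
    refine hmono ?_
    rw [← NNReal.coe_le_coe, mul_comm (n : ℝ≥0)]
    push_cast
    exact Nat.floor_le (by positivity)

section Limit

variable {H : Type*} [NormedAddCommGroup H] [InnerProductSpace ℂ H] [CompleteSpace H]

lemma coe_smul_nonneg (c : ℝ≥0) {T : H →L[ℂ] H} (hT : 0 ≤ T) : 0 ≤ ((c : ℝ) : ℂ) • T := by
  rw [Complex.coe_smul]
  exact smul_nonneg c.2 hT

/-- By compactness of [0, ∞] the limit along a nonprincipal ultrafilter exists at every operator.
The two approximate inequalities become one equality as `c` tends to 1, and traciality is exact at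
each stage. -/
theorem exists_singularTrace_of_approx {F : ℕ → (H →L[ℂ] H) → ℝ≥0∞} {c : ℕ → ℝ≥0∞}
    (hc : Tendsto c atTop (𝓝 1))
    (hsub : ∀ k S T, 0 ≤ S → 0 ≤ T → F k (S + T) ≤ c k * (F k S + F k T))
    (hsup : ∀ k S T, 0 ≤ S → 0 ≤ T → F k S + F k T ≤ c k * F k (S + T))
    (htr : ∀ k A, F k (star A * A) = F k (A * star A))
    (hfin : ∀ P : H →L[ℂ] H, IsStarProjection P →
      FiniteDimensional ℂ (LinearMap.range (P : H →ₗ[ℂ] H)) →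
      Tendsto (fun k => F k P) atTop (𝓝 0))
    {A : H →L[ℂ] H} (hA : ∀ k, F k A = 1) : ∃ τ : SingularTrace H, τ.toFun A = 1 := by
  let U : Ultrafilter ℕ := Filter.hyperfilter ℕ
  have hU : (U : Filter ℕ) ≤ atTop := Nat.hyperfilter_le_atTop
  let τ : (H →L[ℂ] H) → ℝ≥0∞ := fun T => (U.map fun k => F k T).lim
  have hτ : ∀ T, Tendsto (fun k => F k T) U (𝓝 (τ T)) := fun T =>
    (U.map fun k => F k T).le_nhds_lim
  have hcU : Tendsto c U (𝓝 1) := hc.mono_left hU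
  have hadd : ∀ S T : H →L[ℂ] H, 0 ≤ S → 0 ≤ T → τ (S + T) = τ S + τ T := by
    intro S T hS hT
    have h1 : Tendsto (fun k => c k * (F k S + F k T)) U (𝓝 (1 * (τ S + τ T))) :=
      ENNReal.Tendsto.mul hcU (Or.inl one_ne_zero) ((hτ S).add (hτ T)) (Or.inr ENNReal.one_ne_top)
    have h2 : Tendsto (fun k => c k * F k (S + T)) U (𝓝 (1 * τ (S + T))) :=
      ENNReal.Tendsto.mul hcU (Or.inl one_ne_zero) (hτ (S + T)) (Or.inr ENNReal.one_ne_top)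
    rw [one_mul] at h1 h2
    exact le_antisymm (le_of_tendsto_of_tendsto' (hτ _) h1 fun k => hsub k S T hS hT)
      (le_of_tendsto_of_tendsto' ((hτ S).add (hτ T)) h2 fun k => hsup k S T hS hT)
  have hfin' : ∀ P : H →L[ℂ] H, IsStarProjection P →
      FiniteDimensional ℂ (LinearMap.range (P : H →ₗ[ℂ] H)) → τ P = 0 := fun P hP hd =>
    tendsto_nhds_unique (hτ P) ((hfin P hP hd).mono_left hU)
  refine ⟨⟨τ, hadd, fun c T hT => ?_, fun X => ?_, hfin'⟩, ?_⟩
  · have hpos : ∀ c : ℝ≥0, 0 ≤ ((c : ℝ) : ℂ) • T := fun c =>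
      coe_smul_nonneg c hT
    have h0 : τ 0 = 0 := by
      refine hfin' 0 (.zero _) ?_
      have : LinearMap.range ((0 : H →L[ℂ] H) : H →ₗ[ℂ] H) = ⊥ := LinearMap.range_zero
      rw [this]
      infer_instance
    have h := ennreal_map_eq_mul_of_add (g := fun c : ℝ≥0 => τ (((c : ℝ) : ℂ) • T))
      (by simpa using h0) (fun c d => by
        rw [← hadd _ _ (hpos c) (hpos d), ← add_smul]
        push_cast
        rfl) c
    simpa using h
  · exact congrArg (fun f => (U.map f).lim) (funext fun k => htr k X)
  · exact tendsto_nhds_unique (hτ A) (by simp [hA])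

end Limit

/-! ### Linear extension of a singular trace -/

namespace SingularTrace

variable {H : Type*} [NormedAddCommGroup H] [InnerProductSpace ℂ H] [CompleteSpace H]
  (τ : SingularTrace H)

lemma mono {A B : H →L[ℂ] H} (hA : 0 ≤ A) (h : A ≤ B) : τ.toFun A ≤ τ.toFun B := by
  have := τ.map_add A (B - A) hA (sub_nonneg.mpr h)
  rw [add_sub_cancel] at this
  rw [this]
  exact le_self_add

lemma mem_domain {A : H →L[ℂ] H} (hA : 0 ≤ A) (h : τ.toFun A < ⊤) : A ∈ τ.domain :=
  Submodule.subset_span ⟨hA, h⟩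

lemma map_zero' : τ.toFun 0 = 0 := by
  simpa using τ.map_smul 0 0 le_rfl

lemma map_finset_sum {κ : Type*} (s : Finset κ) (A : κ → H →L[ℂ] H) (hA : ∀ i, 0 ≤ A i) :
    τ.toFun (∑ i ∈ s, A i) = ∑ i ∈ s, τ.toFun (A i) := by
  classical
  induction s using Finset.induction_on with
  | empty => simp [τ.map_zero']
  | insert i s hi ih =>
    rw [Finset.sum_insert hi, Finset.sum_insert hi, τ.map_add _ _ (hA i)
      (Finset.sum_nonneg fun j _ => hA j), ih]

/-- A real linear relation between positive operators is respected by the weight. -/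
lemma sum_mul_toReal_eq_zero {κ : Type*} (s : Finset κ) (r : κ → ℝ) (A : κ → H →L[ℂ] H)
    (hA : ∀ i, 0 ≤ A i) (hτ : ∀ i, τ.toFun (A i) < ⊤) (h : ∑ i ∈ s, (r i : ℂ) • A i = 0) :
    ∑ i ∈ s, r i * (τ.toFun (A i)).toReal = 0 := by
  have hs : ∀ c : κ → ℝ≥0, τ.toFun (∑ i ∈ s, ((c i : ℝ) : ℂ) • A i) =
      ∑ i ∈ s, c i * τ.toFun (A i) := by
    intro c
    rw [τ.map_finset_sum s _ fun i => coe_smul_nonneg (c i) (hA i)]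
    exact Finset.sum_congr rfl fun i _ => τ.map_smul _ _ (hA i)
  have hdec : ∀ i, r i = ((r i).toNNReal : ℝ) - ((-r i).toNNReal : ℝ) := fun i => by
    rw [Real.coe_toNNReal', Real.coe_toNNReal', max_zero_sub_eq_self]
  -- Negative coefficients are moved to the other side, so that the weight, known only on positive
  -- operators, can be applied to both; finiteness then permits subtraction.
  have h1 : ∑ i ∈ s, (((r i).toNNReal : ℝ) : ℂ) • A i =
      ∑ i ∈ s, (((-r i).toNNReal : ℝ) : ℂ) • A i := by
    rw [← sub_eq_zero, ← Finset.sum_sub_distrib, ← h]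
    refine Finset.sum_congr rfl fun i _ => ?_
    rw [← sub_smul, ← Complex.ofReal_sub, ← hdec]
  have h2 := congrArg ENNReal.toReal ((hs _).symm.trans ((congrArg τ.toFun h1).trans (hs _)))
  have hr : ∀ c : κ → ℝ≥0, (∑ i ∈ s, (c i : ℝ≥0∞) * τ.toFun (A i)).toReal =
      ∑ i ∈ s, (c i : ℝ) * (τ.toFun (A i)).toReal := by
    intro c
    rw [ENNReal.toReal_sum fun i _ => ENNReal.mul_ne_top ENNReal.coe_ne_top (hτ i).ne]
    simp
  rw [hr, hr, ← sub_eq_zero, ← Finset.sum_sub_distrib] at h2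
  rw [← h2]
  refine Finset.sum_congr rfl fun i _ => ?_
  rw [← sub_mul, ← hdec]

/-- The domain is a quotient of the free complex space on the positive operators of finite weight,
so it suffices that the weight respects linear relations. As positive operators are self-adjoint,
adding and subtracting the adjoint splits a complex relation into two real ones. -/
theorem exists_isLinearExtension : ∃ σ : τ.domain →ₗ[ℂ] ℂ, τ.IsLinearExtension σ := by
  set P := {A : H →L[ℂ] H | 0 ≤ A ∧ τ.toFun A < ⊤} with hP
  let f : (P →₀ ℂ) →ₗ[ℂ] (H →L[ℂ] H) := Finsupp.linearCombination ℂ (fun A : P => (A : H →L[ℂ] H))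
  let g : (P →₀ ℂ) →ₗ[ℂ] ℂ :=
    Finsupp.linearCombination ℂ (fun A : P => ((τ.toFun (A : H →L[ℂ] H)).toReal : ℂ))
  have hker : LinearMap.ker f ≤ LinearMap.ker g := by
    intro v hv
    have hv' : ∑ A ∈ v.support, v A • (A : H →L[ℂ] H) = 0 := hv
    have hstar : ∑ A ∈ v.support, star (v A) • (A : H →L[ℂ] H) = 0 := by
      have h := congrArg star hv'
      rw [star_sum, star_zero] at h
      rw [← h]
      refine Finset.sum_congr rfl fun A _ => ?_
      rw [star_smul, A.2.1.isSelfAdjoint.star_eq]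
    have hre : ∑ A ∈ v.support, ((v A).re : ℂ) • (A : H →L[ℂ] H) = 0 := by
      have h := congrArg ((2⁻¹ : ℂ) • ·) (congrArg₂ (· + ·) hv' hstar)
      simp only [add_zero, smul_zero, ← Finset.sum_add_distrib, Finset.smul_sum, ← add_smul,
        smul_smul] at h
      rw [← h]
      refine Finset.sum_congr rfl fun A _ => ?_
      congr 1
      rw [Complex.re_eq_add_conj, starRingEnd_apply]
      ring
    have him : ∑ A ∈ v.support, ((v A).im : ℂ) • (A : H →L[ℂ] H) = 0 := by
      have h := congrArg ((2 * Complex.I)⁻¹ • ·) (congrArg₂ (· - ·) hv' hstar)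
      simp only [sub_zero, smul_zero, ← Finset.sum_sub_distrib, Finset.smul_sum, ← sub_smul,
        smul_smul] at h
      rw [← h]
      refine Finset.sum_congr rfl fun A _ => ?_
      congr 1
      rw [Complex.im_eq_sub_conj, starRingEnd_apply]
      ring
    have h1 := τ.sum_mul_toReal_eq_zero v.support (fun A => (v A).re) (fun A : P => A)
      (fun A => A.2.1) (fun A => A.2.2) hre
    have h2 := τ.sum_mul_toReal_eq_zero v.support (fun A => (v A).im) (fun A : P => A)
      (fun A => A.2.1) (fun A => A.2.2) him
    change ∑ A ∈ v.support, v A • ((τ.toFun (A : H →L[ℂ] H)).toReal : ℂ) = 0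
    apply Complex.ext
    · simpa [Complex.re_sum] using h1
    · simpa [Complex.im_sum] using h2
  have hrange : LinearMap.range f = τ.domain := by
    rw [Finsupp.range_linearCombination, Subtype.range_coe]
    rfl
  let σ₀ : LinearMap.range f →ₗ[ℂ] ℂ :=
    (LinearMap.ker f).liftQ g hker ∘ₗ f.quotKerEquivRange.symm.toLinearMap
  have hσ₀ : ∀ v (h : f v ∈ LinearMap.range f), σ₀ ⟨f v, h⟩ = g v := by
    intro v h
    have : f.quotKerEquivRange.symm ⟨f v, h⟩ = (LinearMap.ker f).mkQ v :=
      f.quotKerEquivRange_symm_apply_image v h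
    simp [σ₀, this]
  refine ⟨σ₀ ∘ₗ (LinearEquiv.ofEq _ _ hrange.symm).toLinearMap, fun X hX hτX => ?_⟩
  have hfX : f (Finsupp.single ⟨X, hX, hτX⟩ 1) = X := by simp [f]
  have h := hσ₀ (Finsupp.single ⟨X, hX, hτX⟩ 1) ⟨_, rfl⟩
  have h' : (⟨f (Finsupp.single ⟨X, hX, hτX⟩ 1), ⟨_, rfl⟩⟩ : LinearMap.range f) =
      LinearEquiv.ofEq _ _ hrange.symm X := Subtype.ext hfX
  rw [h'] at h
  simpa [g] using h

end SingularTrace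


/-! ### Singular traces that are normalized at a given operator -/

section Construction

variable {ι κ H : Type*} [NormedAddCommGroup H] [InnerProductSpace ℂ H] [CompleteSpace H]

/-- `G` is tracial and additive up to the factor `2 ^ δ`, its values on projections are at most
`K` times their rank, and its value at `A` is finite and at least `M * K`. -/
structure IsApproxTrace (b : HilbertBasis ι ℂ H) (δ : ℝ) (M K : ℝ≥0∞) (A : H →L[ℂ] H)
    (G : (H →L[ℂ] H) → ℝ≥0∞) : Prop where
  add_le : ∀ S T, 0 ≤ S → 0 ≤ T → G (S + T) ≤ ENNReal.ofReal (2 ^ δ) * (G S + G T)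
  le_add : ∀ S T, 0 ≤ S → 0 ≤ T → G S + G T ≤ ENNReal.ofReal (2 ^ δ) * G (S + T)
  tracial : ∀ X, G (star X * X) = G (X * star X)
  projection_le : ∀ P, IsStarProjection P → G P ≤ K * opTrace b P
  mul_le : M * K ≤ G A
  ne_top : G A ≠ ⊤
  const_ne_zero : K ≠ 0
  const_ne_top : K ≠ ⊤

/-- After division by the value at `A`, a projection has value at most Tr P / (k+1), which tends to
0 when the rank is finite, and the additivity defect is 2^{1/(k+1)}. -/
theorem exists_singularTrace_of_isApproxTrace (b : HilbertBasis ι ℂ H) {A : H →L[ℂ] H}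
    (h : ∀ k : ℕ, ∃ K G, IsApproxTrace b (1 / ((k : ℝ) + 1)) ((k + 1 : ℕ) : ℝ≥0∞) K A G) :
    ∃ τ : SingularTrace H, τ.toFun A = 1 := by
  choose K G hG using h
  have hG0 : ∀ k, G k A ≠ 0 := fun k h0 => by
    have := (hG k).mul_le
    rw [h0, nonpos_iff_eq_zero, mul_eq_zero] at this
    rcases this with h | h
    · exact Nat.succ_ne_zero k (by exact_mod_cast h)
    · exact (hG k).const_ne_zero h
  refine exists_singularTrace_of_approx (F := fun k T => G k T / G k A)
    (c := fun k => ENNReal.ofReal (2 ^ (1 / ((k : ℝ) + 1)))) ?_ ?_ ?_ ?_ ?_ ?_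
  · have h1 : Tendsto (fun k : ℕ => (2 : ℝ) ^ (1 / ((k : ℝ) + 1))) atTop (𝓝 ((2 : ℝ) ^ (0 : ℝ))) :=
      tendsto_const_nhds.rpow tendsto_one_div_add_atTop_nhds_zero_nat (Or.inl two_ne_zero)
    rw [Real.rpow_zero] at h1
    simpa using ENNReal.tendsto_ofReal h1
  · intro k S T hS hT
    rw [← ENNReal.add_div, ← mul_div_assoc]
    exact ENNReal.div_le_div_right ((hG k).add_le S T hS hT) _
  · intro k S T hS hT
    rw [← ENNReal.add_div, ← mul_div_assoc]
    exact ENNReal.div_le_div_right ((hG k).le_add S T hS hT) _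
  · intro k X
    simp only [(hG k).tracial X]
  · intro P hP hfin
    have hlim : Tendsto (fun k : ℕ => opTrace b P / ((k + 1 : ℕ) : ℝ≥0∞)) atTop (𝓝 0) := by
      rw [← ENNReal.div_top (a := opTrace b P)]
      exact ENNReal.Tendsto.const_div
        (ENNReal.tendsto_nat_nhds_top.comp (tendsto_add_atTop_nat 1))
        (Or.inr (opTrace_lt_top_of_isStarProjection b hP hfin).ne)
    refine tendsto_of_tendsto_of_tendsto_of_le_of_le tendsto_const_nhds hlim
      (fun _ => zero_le) fun k => ?_
    calc G k P / G k A ≤ (K k * opTrace b P) / (K k * ((k + 1 : ℕ) : ℝ≥0∞)) :=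
          ENNReal.div_le_div ((hG k).projection_le P hP) (by
            rw [mul_comm]; exact (hG k).mul_le)
      _ = opTrace b P / ((k + 1 : ℕ) : ℝ≥0∞) :=
          ENNReal.mul_div_mul_left _ _ (hG k).const_ne_zero (hG k).const_ne_top
  · exact fun k => ENNReal.div_self (hG0 k) (hG k).ne_top

lemma summable_rpow_geometric {r t : ℝ} (hr : 0 < r) (hr1 : r < 1) (ht : 0 < t) :
    Summable fun n : ℕ => (r ^ n) ^ t := by
  have h : ∀ n : ℕ, (r ^ n) ^ t = (r ^ t) ^ n := fun n => by
    rw [← Real.rpow_natCast, ← Real.rpow_mul hr.le, mul_comm, Real.rpow_mul hr.le,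
      Real.rpow_natCast]
  simp only [h]
  exact summable_geometric_of_lt_one (by positivity) (Real.rpow_lt_one hr.le hr1 ht)

lemma tsum_ofReal_eq_top {a : κ → ℝ} (ha : ∀ p, 0 ≤ a p) (h : ¬ Summable a) :
    ∑' p, ENNReal.ofReal (a p) = ⊤ := by
  by_contra hne
  exact h (by
    have := ENNReal.summable_toReal hne
    simpa only [ENNReal.toReal_ofReal (ha _)] using this)

lemma exists_finset_le_sum {f : κ → ℝ≥0∞} (h : ∑' p, f p = ⊤) {M : ℝ≥0∞} (hM : M ≠ ⊤) :
    ∃ S : Finset κ, M ≤ ∑ p ∈ S, f p := by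
  have h1 : M < ∑' p, f p := by rw [h]; exact hM.lt_top
  rw [ENNReal.tsum_eq_iSup_sum] at h1
  obtain ⟨S, hS⟩ := lt_iSup_iff.mp h1
  exact ⟨S, hS.le⟩

lemma exists_pow_le_of_finset (S : Finset κ) {a : κ → ℝ} (ha : ∀ p, 0 < a p) :
    ∃ N : ℕ, 0 < N ∧ ∀ p ∈ S, (1 / 2 : ℝ) ^ N ≤ a p := by
  have h : ∀ᶠ N : ℕ in atTop, ∀ p ∈ S, (1 / 2 : ℝ) ^ N ≤ a p := by
    rw [Filter.eventually_all_finset]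
    intro p _
    exact ((tendsto_pow_atTop_nhds_zero_of_lt_one (by norm_num) (by norm_num)).eventually
      (gt_mem_nhds (ha p))).mono fun _ => le_of_lt
  obtain ⟨N, hN, h0⟩ := (h.and (eventually_gt_atTop 0)).exists
  exact ⟨N, h0, hN⟩

/-- The functional `∑ₙ sₙ^ε Tr(T² (sₙ + T)⁻¹)`, where `sₙ = 2⁻ⁿ`; it is comparable to
`Tr(T^{1+ε})`. -/
def convexSum (b : HilbertBasis ι ℂ H) (ε : ℝ) (T : H →L[ℂ] H) : ℝ≥0∞ :=
  ∑' n : ℕ, ENNReal.ofReal (((1 / 2 : ℝ) ^ n) ^ ε) * convexTrace b ((1 / 2 : ℝ) ^ n) T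

/-- Divergence of ∑ a makes the value at `A` large compared with that on projections, while
convergence of ∑ a^{1+ε/2} keeps it finite. -/
theorem isApproxTrace_convexSum (b : HilbertBasis ι ℂ H) {A : H →L[ℂ] H} {a : κ → ℝ}
    (ha : ∀ p, 0 < a p)
    (htr : ∀ s, 0 < s → convexTrace b s A = ∑' p, ENNReal.ofReal (a p ^ 2 / (s + a p)))
    (hsum : ∀ ε : ℝ, 0 < ε → Summable fun p => a p ^ (1 + ε)) (hdiv : ¬ Summable a)
    {δ : ℝ} (hδ : 0 < δ) (hδ1 : δ ≤ 1) (M : ℕ) :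
    ∃ K G, IsApproxTrace b δ M K A G := by
  -- One factor 2 pays for t²/(s+t) ≥ t/2 when s ≤ t, the other for discarding the first `N`
  -- weights.
  obtain ⟨S, hS⟩ := exists_finset_le_sum (tsum_ofReal_eq_top (fun p => (ha p).le) hdiv)
    (M := 4 * M) (ENNReal.mul_ne_top (by simp) (by simp))
  obtain ⟨N, hN0, hN⟩ := exists_pow_le_of_finset S ha
  -- With ε ≤ 1/N one has 2^{-Nε} ≥ 1/2, so the weights from index `N` on keep at least half of the
  -- total. The set `S` and `N` are therefore fixed before ε.
  set ε := min δ (1 / N) with hεdef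
  have hN0' : (0 : ℝ) < N := by exact_mod_cast hN0
  have hε : 0 < ε := lt_min hδ (by positivity)
  have hεδ : ε ≤ δ := min_le_left _ _
  have hs : ∀ n : ℕ, (0 : ℝ) < (1 / 2) ^ n := fun n => by positivity
  have hsucc : ∀ n : ℕ, (1 / 2 : ℝ) ^ n / 2 = (1 / 2) ^ (n + 1) := fun n => by ring
  have h2ε : ENNReal.ofReal (2 ^ ε) ≤ ENNReal.ofReal (2 ^ δ) :=
    ENNReal.ofReal_le_ofReal (Real.rpow_le_rpow_of_exponent_le one_le_two hεδ)
  have hwsucc : ∀ n : ℕ, ENNReal.ofReal (((1 / 2 : ℝ) ^ n) ^ ε) =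
      ENNReal.ofReal (2 ^ ε) * ENNReal.ofReal (((1 / 2 : ℝ) ^ (n + 1)) ^ ε) := by
    intro n
    rw [← ENNReal.ofReal_mul (by positivity), ← Real.mul_rpow (by norm_num) (hs _).le]
    congr 2
    ring
  refine ⟨∑' n : ℕ, ENNReal.ofReal (((1 / 2 : ℝ) ^ n) ^ ε), convexSum b ε, ?_, ?_, ?_, ?_, ?_, ?_,
    ?_, ?_⟩
  · intro S T hS hT
    refine le_trans ?_ (mul_le_mul_left h2ε _)
    have h1 : convexSum b ε (S + T) ≤ ∑' n : ℕ, ENNReal.ofReal (2 ^ ε) *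
        (ENNReal.ofReal (((1 / 2 : ℝ) ^ (n + 1)) ^ ε) *
          (convexTrace b ((1 / 2 : ℝ) ^ (n + 1)) S + convexTrace b ((1 / 2 : ℝ) ^ (n + 1)) T)) := by
      refine ENNReal.tsum_le_tsum fun n => ?_
      rw [← mul_assoc, ← hwsucc, ← hsucc]
      gcongr
      exact convexTrace_add_le b (hs n) hS hT
    refine h1.trans ?_
    rw [ENNReal.tsum_mul_left, convexSum, convexSum, ← ENNReal.tsum_add]
    refine mul_le_mul_right ?_ _
    simp only [← mul_add]
    exact ENNReal.tsum_comp_le_tsum_of_injective (f := fun n : ℕ => n + 1)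
      (add_left_injective 1) (fun n => ENNReal.ofReal (((1 / 2 : ℝ) ^ n) ^ ε) *
        (convexTrace b ((1 / 2 : ℝ) ^ n) S + convexTrace b ((1 / 2 : ℝ) ^ n) T))
  · intro S T hS hT
    have h1 : (1 : ℝ≥0∞) ≤ ENNReal.ofReal (2 ^ δ) := by
      rw [ENNReal.one_le_ofReal]
      exact Real.one_le_rpow one_le_two hδ.le
    refine le_trans ?_ (le_mul_of_one_le_left zero_le h1)
    rw [convexSum, convexSum, convexSum, ← ENNReal.tsum_add]
    refine ENNReal.tsum_le_tsum fun n => ?_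
    rw [← mul_add]
    gcongr
    exact le_convexTrace_add b (hs n) hS hT
  · intro X
    exact tsum_congr fun n => by rw [convexTrace_star_mul_self b (hs n)]
  · intro P hP
    rw [← ENNReal.tsum_mul_right]
    refine ENNReal.tsum_le_tsum fun n => ?_
    rw [convexTrace_of_isStarProjection b (hs n) hP]
    gcongr
    refine mul_le_of_le_one_left zero_le ?_
    rw [ENNReal.ofReal_le_one]
    exact inv_le_one_of_one_le₀ (by linarith [hs n])
  · set K := ∑' n : ℕ, ENNReal.ofReal (((1 / 2 : ℝ) ^ n) ^ ε) with hK
    have hshift : ENNReal.ofReal (1 / 2) * K ≤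
        ∑' n : ℕ, ENNReal.ofReal (((1 / 2 : ℝ) ^ (n + N)) ^ ε) := by
      rw [hK, ← ENNReal.tsum_mul_left]
      refine ENNReal.tsum_le_tsum fun n => ?_
      rw [← ENNReal.ofReal_mul (by norm_num), pow_add, Real.mul_rpow (hs n).le (hs N).le, mul_comm]
      refine ENNReal.ofReal_le_ofReal ?_
      gcongr
      rw [← Real.rpow_natCast, ← Real.rpow_mul (by norm_num)]
      calc (1 / 2 : ℝ) = (1 / 2) ^ (1 : ℝ) := (Real.rpow_one _).symm
        _ ≤ _ := Real.rpow_le_rpow_of_exponent_ge (by norm_num) (by norm_num) (by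
          calc (N : ℝ) * ε ≤ N * (1 / N) := by gcongr; exact min_le_right _ _
            _ = 1 := by field_simp)
    have h4 : (4 : ℝ≥0∞) * (ENNReal.ofReal (1 / 2) * ENNReal.ofReal (1 / 2)) = 1 := by
      rw [← ENNReal.ofReal_mul (by norm_num), ← ENNReal.ofReal_ofNat,
        ← ENNReal.ofReal_mul (by norm_num)]
      norm_num
    calc (M : ℝ≥0∞) * K
        = (4 * M) * ENNReal.ofReal (1 / 2) * (ENNReal.ofReal (1 / 2) * K) := by
          nth_rw 1 [← one_mul (M : ℝ≥0∞), ← h4]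
          ring
      _ ≤ (∑ p ∈ S, ENNReal.ofReal (a p)) * ENNReal.ofReal (1 / 2) *
          ∑' n : ℕ, ENNReal.ofReal (((1 / 2 : ℝ) ^ (n + N)) ^ ε) := by gcongr
      _ = ∑' n : ℕ, ENNReal.ofReal (((1 / 2 : ℝ) ^ (n + N)) ^ ε) *
          ∑ p ∈ S, ENNReal.ofReal (a p / 2) := by
          rw [ENNReal.tsum_mul_right, mul_comm, Finset.sum_mul]
          congr 1
          refine Finset.sum_congr rfl fun p _ => ?_
          rw [← ENNReal.ofReal_mul (ha p).le]
          congr 1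
          ring
      _ ≤ ∑' n : ℕ, ENNReal.ofReal (((1 / 2 : ℝ) ^ (n + N)) ^ ε) *
          convexTrace b ((1 / 2 : ℝ) ^ (n + N)) A := by
          refine ENNReal.tsum_le_tsum fun n => ?_
          gcongr
          rw [htr _ (hs _)]
          refine le_trans (Finset.sum_le_sum fun p hp => ?_) (ENNReal.sum_le_tsum S)
          refine ENNReal.ofReal_le_ofReal ?_
          have h1 : (1 / 2 : ℝ) ^ (n + N) ≤ a p :=
            (pow_le_pow_of_le_one (by norm_num) (by norm_num) (Nat.le_add_left N n)).trans (hN p hp)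
          have h2 := ha p
          have h3 := hs (n + N)
          rw [div_le_div_iff₀ (by norm_num) (by linarith)]
          nlinarith
      _ ≤ convexSum b ε A :=
          ENNReal.tsum_comp_le_tsum_of_injective (f := fun n : ℕ => n + N)
            (add_left_injective N) (fun n => ENNReal.ofReal (((1 / 2 : ℝ) ^ n) ^ ε) *
              convexTrace b ((1 / 2 : ℝ) ^ n) A)
  · have hε2 : 0 < ε / 2 := half_pos hε
    refine ne_top_of_le_ne_top (b := (∑' n : ℕ, ENNReal.ofReal (((1 / 2 : ℝ) ^ n) ^ (ε / 2))) *
      ∑' p, ENNReal.ofReal (a p ^ (1 + ε / 2))) (ENNReal.mul_ne_top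
        (summable_rpow_geometric (by norm_num) (by norm_num) hε2).tsum_ofReal_ne_top
        (hsum _ hε2).tsum_ofReal_ne_top) ?_
    rw [← ENNReal.tsum_mul_right]
    refine ENNReal.tsum_le_tsum fun n => ?_
    rw [htr _ (hs n), ← ENNReal.tsum_mul_left, ← ENNReal.tsum_mul_left]
    refine ENNReal.tsum_le_tsum fun p => ?_
    set s := (1 / 2 : ℝ) ^ n
    have hs0 : 0 < s := hs n
    have ha0 := ha p
    rw [← ENNReal.ofReal_mul (by positivity), ← ENNReal.ofReal_mul (by positivity)]
    refine ENNReal.ofReal_le_ofReal ?_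
    have hu1 : a p / (s + a p) ≤ 1 := (div_le_one (by positivity)).mpr (by linarith)
    -- The weight s^ε is divided in two: one half is traded for the extra power a^{ε/2}, the other
    -- makes the sum over n converge.
    have hu : a p / (s + a p) ≤ (a p / s) ^ (ε / 2) := by
      calc a p / (s + a p) = (a p / (s + a p)) ^ (1 : ℝ) := (Real.rpow_one _).symm
        _ ≤ (a p / (s + a p)) ^ (ε / 2) :=
          Real.rpow_le_rpow_of_exponent_ge (by positivity) hu1 (by linarith)
        _ ≤ (a p / s) ^ (ε / 2) := by
          gcongr
          linarith
    calc s ^ ε * (a p ^ 2 / (s + a p)) = s ^ ε * (a p * (a p / (s + a p))) := by ring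
      _ ≤ s ^ ε * (a p * (a p / s) ^ (ε / 2)) := by gcongr
      _ = s ^ (ε / 2) * a p ^ (1 + ε / 2) := by
        have e1 : s ^ ε = s ^ (ε / 2) * s ^ (ε / 2) := by
          rw [← Real.rpow_add hs0, add_halves]
        have e2 : s ^ (ε / 2) ≠ 0 := by positivity
        rw [Real.div_rpow ha0.le hs0.le, Real.rpow_add ha0, Real.rpow_one, e1]
        field_simp
  · have h := ENNReal.le_tsum (f := fun n : ℕ => ENNReal.ofReal (((1 / 2 : ℝ) ^ n) ^ ε)) 0
    simp only [pow_zero, Real.one_rpow, ENNReal.ofReal_one] at h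
    exact (zero_lt_one.trans_le h).ne'
  · exact (summable_rpow_geometric (by norm_num) (by norm_num) hε).tsum_ofReal_ne_top

end Construction


/-! ### Approximate traces when the eigenvalues are summable -/

section ConstructionConcave

variable {ι κ H : Type*} [NormedAddCommGroup H] [InnerProductSpace ℂ H] [CompleteSpace H]

/-- The functional `∑ₙ sₙ^{1-ε} Tr(T (sₙ + T)⁻¹)`, where `sₙ = 2ⁿ⁻ᴶ`; it is comparable to
`Tr(φ(T))` for the concave function `φ(t) = min (t^{1-ε}) (2^{εJ} t)`. -/
def concaveSum (b : HilbertBasis ι ℂ H) (ε : ℝ) (J : ℕ) (T : H →L[ℂ] H) : ℝ≥0∞ :=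
  ∑' n : ℕ, ENNReal.ofReal (((2 : ℝ) ^ ((n : ℤ) - J)) ^ (1 - ε)) *
    concaveTrace b ((2 : ℝ) ^ ((n : ℤ) - J)) T

lemma two_zpow_pos (j : ℤ) : (0 : ℝ) < 2 ^ j := by positivity

/-- The terms decay like 2^{-εj} at +∞ and like 2^{(1-ε)j} at -∞. The sum bounds `concaveSum` on
rank one projections, uniformly in the cutoff `J`. -/
lemma summable_zpow_rpow_div {ε : ℝ} (hε : 0 < ε) (hε1 : ε < 1) :
    Summable fun j : ℤ => ((2 : ℝ) ^ j) ^ (1 - ε) * (1 + 2 ^ j)⁻¹ := by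
  have hpos : ∀ j : ℤ, 0 ≤ ((2 : ℝ) ^ j) ^ (1 - ε) * (1 + 2 ^ j)⁻¹ := fun j => by positivity
  refine Summable.of_nat_of_neg ?_ ?_
  · refine Summable.of_nonneg_of_le (fun n => hpos n) (fun n => ?_)
      (summable_rpow_geometric (r := 1 / 2) (by norm_num) (by norm_num) hε)
    have hs := two_zpow_pos n
    calc ((2 : ℝ) ^ (n : ℤ)) ^ (1 - ε) * (1 + 2 ^ (n : ℤ))⁻¹
        ≤ ((2 : ℝ) ^ (n : ℤ)) ^ (1 - ε) * (2 ^ (n : ℤ))⁻¹ := by gcongr; linarith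
      _ = ((1 / 2 : ℝ) ^ n) ^ ε := by
        rw [Real.rpow_sub hs, Real.rpow_one, one_div, inv_pow, Real.inv_rpow (by positivity),
          zpow_natCast]
        field_simp
  · refine Summable.of_nonneg_of_le (fun n => hpos _) (fun n => ?_)
      (summable_rpow_geometric (r := 1 / 2) (by norm_num) (by norm_num) (sub_pos.mpr hε1))
    have h1 : (2 : ℝ) ^ (-(n : ℤ)) = (1 / 2) ^ n := by
      rw [zpow_neg, zpow_natCast, one_div, inv_pow]
    rw [h1]
    refine mul_le_of_le_one_right (by positivity) (inv_le_one_of_one_le₀ ?_)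
    have : (0 : ℝ) < (1 / 2) ^ n := by positivity
    linarith

/-- The constant `K` is a sum over all integers, hence independent of `J`. So a finite set carrying
enough of the divergent sum ∑ a^{1-ε} can be chosen first, and then a cutoff 2^{-J} below all its
eigenvalues. -/
theorem isApproxTrace_concaveSum (b : HilbertBasis ι ℂ H) {A : H →L[ℂ] H} {a : κ → ℝ}
    (ha : ∀ p, 0 < a p)
    (htr : ∀ s, 0 < s → concaveTrace b s A = ∑' p, ENNReal.ofReal (a p / (s + a p)))
    (hsum : Summable a) {ε : ℝ} (hε : 0 < ε) (hε1 : ε < 1)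
    (hdiv : ¬ Summable fun p => a p ^ (1 - ε)) (M : ℕ) :
    ∃ K G, IsApproxTrace b ε M K A G := by
  have hε1' : 0 < 1 - ε := sub_pos.mpr hε1
  set K : ℝ≥0∞ := ∑' j : ℤ, ENNReal.ofReal (((2 : ℝ) ^ j) ^ (1 - ε) * (1 + 2 ^ j)⁻¹) with hK
  have hKtop : K ≠ ⊤ := (summable_zpow_rpow_div hε hε1).tsum_ofReal_ne_top
  obtain ⟨S, hS⟩ := exists_finset_le_sum
    (tsum_ofReal_eq_top (fun p => (Real.rpow_pos_of_pos (ha p) _).le) hdiv)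
    (M := 4 * (M * K)) (ENNReal.mul_ne_top (by simp) (ENNReal.mul_ne_top (by simp) hKtop))
  obtain ⟨J, -, hJ⟩ := exists_pow_le_of_finset S ha
  have hs : ∀ n : ℕ, (0 : ℝ) < 2 ^ ((n : ℤ) - J) := fun n => two_zpow_pos _
  have hsucc : ∀ n : ℕ, (2 : ℝ) ^ (((n + 1 : ℕ) : ℤ) - J) = 2 * 2 ^ ((n : ℤ) - J) := by
    intro n
    rw [← zpow_one_add₀ two_ne_zero]
    congr 1
    push_cast
    ring
  have hhalf : ∀ n : ℕ, (2 : ℝ) ^ (((n + 1 : ℕ) : ℤ) - J) / 2 = 2 ^ ((n : ℤ) - J) := by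
    intro n
    rw [hsucc]
    ring
  have hwsucc : ∀ n : ℕ, ENNReal.ofReal (((2 : ℝ) ^ ((n : ℤ) - J)) ^ (1 - ε)) * 2 =
      ENNReal.ofReal (2 ^ ε) *
        ENNReal.ofReal (((2 : ℝ) ^ (((n + 1 : ℕ) : ℤ) - J)) ^ (1 - ε)) := by
    intro n
    rw [← ENNReal.ofReal_ofNat, ← ENNReal.ofReal_mul (by positivity),
      ← ENNReal.ofReal_mul (by positivity), hsucc, Real.mul_rpow zero_le_two (hs n).le,
      ← mul_assoc, ← Real.rpow_add two_pos, add_sub_cancel, Real.rpow_one, mul_comm]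
  have hinj : Function.Injective fun n : ℕ => (n : ℤ) - J := fun m n h => by
    simpa using h
  refine ⟨K, concaveSum b ε J, ?_, ?_, ?_, ?_, ?_, ?_, ?_, hKtop⟩
  · intro S T hS hT
    have h1 : (1 : ℝ≥0∞) ≤ ENNReal.ofReal (2 ^ ε) := by
      rw [ENNReal.one_le_ofReal]
      exact Real.one_le_rpow one_le_two hε.le
    refine le_trans ?_ (le_mul_of_one_le_left zero_le h1)
    rw [concaveSum, concaveSum, concaveSum, ← ENNReal.tsum_add]
    refine ENNReal.tsum_le_tsum fun n => ?_
    rw [← mul_add]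
    gcongr
    exact concaveTrace_add_le b (hs n) hS hT
  · intro S T hS hT
    rw [concaveSum, concaveSum, concaveSum, ← ENNReal.tsum_add]
    calc ∑' n : ℕ, (ENNReal.ofReal (((2 : ℝ) ^ ((n : ℤ) - J)) ^ (1 - ε)) *
            concaveTrace b ((2 : ℝ) ^ ((n : ℤ) - J)) S +
          ENNReal.ofReal (((2 : ℝ) ^ ((n : ℤ) - J)) ^ (1 - ε)) *
            concaveTrace b ((2 : ℝ) ^ ((n : ℤ) - J)) T)
        ≤ ∑' n : ℕ, ENNReal.ofReal (2 ^ ε) *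
            (ENNReal.ofReal (((2 : ℝ) ^ (((n + 1 : ℕ) : ℤ) - J)) ^ (1 - ε)) *
            concaveTrace b ((2 : ℝ) ^ (((n + 1 : ℕ) : ℤ) - J)) (S + T)) := by
          refine ENNReal.tsum_le_tsum fun n => ?_
          have h := le_concaveTrace_add b (hs (n + 1)) hS hT
          rw [hhalf] at h
          rw [← mul_add, ← mul_assoc, ← hwsucc, mul_assoc]
          gcongr
      _ ≤ _ := by
          rw [ENNReal.tsum_mul_left]
          refine mul_le_mul_right ?_ _
          exact ENNReal.tsum_comp_le_tsum_of_injective (f := fun n : ℕ => n + 1)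
            (add_left_injective 1) (fun n : ℕ =>
              ENNReal.ofReal (((2 : ℝ) ^ ((n : ℤ) - J)) ^ (1 - ε)) *
                concaveTrace b ((2 : ℝ) ^ ((n : ℤ) - J)) (S + T))
  · intro X
    exact tsum_congr fun n => by rw [concaveTrace_star_mul_self b (hs n)]
  · intro P hP
    calc concaveSum b ε J P
        = (∑' n : ℕ, ENNReal.ofReal (((2 : ℝ) ^ ((n : ℤ) - J)) ^ (1 - ε) *
            (1 + 2 ^ ((n : ℤ) - J))⁻¹)) * opTrace b P := by
          rw [← ENNReal.tsum_mul_right]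
          refine tsum_congr fun n => ?_
          rw [concaveTrace_of_isStarProjection b (hs n) hP,
            ENNReal.ofReal_mul (by positivity), mul_assoc]
      _ ≤ K * opTrace b P := by
          gcongr
          exact ENNReal.tsum_comp_le_tsum_of_injective hinj fun j : ℤ =>
            ENNReal.ofReal (((2 : ℝ) ^ j) ^ (1 - ε) * (1 + 2 ^ j)⁻¹)
  · have h4 : ENNReal.ofReal (1 / 4) * (4 * (M * K)) = M * K := by
      rw [← mul_assoc, ← ENNReal.ofReal_ofNat, ← ENNReal.ofReal_mul (by norm_num)]
      norm_num
    rw [← h4]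
    calc ENNReal.ofReal (1 / 4) * (4 * (M * K))
        ≤ ENNReal.ofReal (1 / 4) * ∑ p ∈ S, ENNReal.ofReal (a p ^ (1 - ε)) := by gcongr
      _ = ∑ p ∈ S, ENNReal.ofReal (1 / 4 * a p ^ (1 - ε)) := by
          rw [Finset.mul_sum]
          exact Finset.sum_congr rfl fun p _ => (ENNReal.ofReal_mul (by norm_num)).symm
      _ ≤ ∑ p ∈ S, ∑' n : ℕ, ENNReal.ofReal (((2 : ℝ) ^ ((n : ℤ) - J)) ^ (1 - ε)) *
            ENNReal.ofReal (a p / (2 ^ ((n : ℤ) - J) + a p)) := by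
          refine Finset.sum_le_sum fun p hp => ?_
          have ha0 := ha p
          -- The single scale s = 2^j with s ≤ a < 2s suffices: s^{1-ε} ≥ a^{1-ε}/2 and a/(s+a) ≥
          -- 1/2, whence the constant 1/4.
          obtain ⟨j, hj1, hj2⟩ := exists_mem_Ico_zpow ha0 one_lt_two
          have hjJ : -(J : ℤ) < j + 1 := by
            have h1 : (2 : ℝ) ^ (-(J : ℤ)) ≤ a p := by
              have := hJ p hp
              rwa [one_div, inv_pow, ← zpow_natCast, ← zpow_neg] at this
            exact (zpow_lt_zpow_iff_right₀ one_lt_two).mp (h1.trans_lt hj2)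
          obtain ⟨n, hn⟩ := Int.eq_ofNat_of_zero_le (show 0 ≤ j + J by lia)
          have hj : (n : ℤ) - J = j := by lia
          refine le_trans ?_ (ENNReal.le_tsum n)
          rw [hj, ← ENNReal.ofReal_mul (by positivity)]
          refine ENNReal.ofReal_le_ofReal ?_
          rw [zpow_add₀ two_ne_zero, zpow_one] at hj2
          set s := (2 : ℝ) ^ j
          have hs0 : 0 < s := two_zpow_pos j
          have h1 : (a p / 2) ^ (1 - ε) ≤ s ^ (1 - ε) :=
            Real.rpow_le_rpow (by positivity) (by linarith) hε1'.le
          have h2 : 1 / 2 * a p ^ (1 - ε) ≤ (a p / 2) ^ (1 - ε) := by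
            rw [Real.div_rpow ha0.le zero_le_two, mul_comm, mul_one_div]
            gcongr
            calc (2 : ℝ) ^ (1 - ε) ≤ 2 ^ (1 : ℝ) :=
                  Real.rpow_le_rpow_of_exponent_le one_le_two (by linarith)
              _ = 2 := Real.rpow_one 2
          have h3 : 1 / 2 ≤ a p / (s + a p) := by
            rw [div_le_div_iff₀ two_pos (by positivity)]
            linarith
          calc 1 / 4 * a p ^ (1 - ε) = (1 / 2 * a p ^ (1 - ε)) * (1 / 2) := by ring
            _ ≤ s ^ (1 - ε) * (a p / (s + a p)) := by
              gcongr
              exact h2.trans h1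
      _ = ∑' n : ℕ, ∑ p ∈ S, ENNReal.ofReal (((2 : ℝ) ^ ((n : ℤ) - J)) ^ (1 - ε)) *
            ENNReal.ofReal (a p / (2 ^ ((n : ℤ) - J) + a p)) :=
          (Summable.tsum_finsetSum fun _ _ => ENNReal.summable).symm
      _ ≤ concaveSum b ε J A := by
          refine ENNReal.tsum_le_tsum fun n => ?_
          rw [← Finset.mul_sum, htr _ (hs n)]
          gcongr
          exact ENNReal.sum_le_tsum S
  -- Only scales s ≥ 2^{-J} occur, so ∑ s^{-ε} converges. The functional is then dominated by a
  -- multiple of the ordinary trace, finite at `A` because ∑ a converges.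
  · have hgeom : Summable fun n : ℕ => ((2 : ℝ) ^ ((n : ℤ) - J)) ^ (-ε) := by
      have h : ∀ n : ℕ, ((2 : ℝ) ^ ((n : ℤ) - J)) ^ (-ε) =
          ((2 : ℝ) ^ (J : ℤ)) ^ ε * ((1 / 2 : ℝ) ^ n) ^ ε := by
        intro n
        rw [Real.rpow_neg (hs n).le, ← Real.inv_rpow (hs n).le, ← zpow_neg,
          ← Real.mul_rpow (by positivity) (by positivity), one_div, inv_pow, ← zpow_natCast,
          ← zpow_neg, ← zpow_add₀ two_ne_zero]
        congr 2
        ring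
      simp only [h]
      exact (summable_rpow_geometric (by norm_num) (by norm_num) hε).mul_left _
    refine ne_top_of_le_ne_top (b := (∑' n : ℕ, ENNReal.ofReal (((2 : ℝ) ^ ((n : ℤ) - J)) ^ (-ε))) *
      ∑' p, ENNReal.ofReal (a p)) (ENNReal.mul_ne_top hgeom.tsum_ofReal_ne_top
        hsum.tsum_ofReal_ne_top) ?_
    rw [← ENNReal.tsum_mul_right]
    refine ENNReal.tsum_le_tsum fun n => ?_
    rw [htr _ (hs n), ← ENNReal.tsum_mul_left, ← ENNReal.tsum_mul_left]
    refine ENNReal.tsum_le_tsum fun p => ?_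
    have ha0 := ha p
    have hs0 := hs n
    generalize (2 : ℝ) ^ ((n : ℤ) - J) = s at hs0
    rw [← ENNReal.ofReal_mul (by positivity), ← ENNReal.ofReal_mul (by positivity)]
    refine ENNReal.ofReal_le_ofReal ?_
    calc s ^ (1 - ε) * (a p / (s + a p)) ≤ s ^ (1 - ε) * (a p / s) := by gcongr; linarith
      _ = s ^ (-ε) * a p := by
        rw [sub_eq_neg_add, Real.rpow_add hs0, Real.rpow_one]
        field_simp
  · have h := ENNReal.le_tsum
      (f := fun j : ℤ => ENNReal.ofReal (((2 : ℝ) ^ j) ^ (1 - ε) * (1 + 2 ^ j)⁻¹)) 0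
    refine (lt_of_lt_of_le ?_ h).ne'
    rw [ENNReal.ofReal_pos]
    positivity

/-- A positive operator whose functional calculus has the same traces as that of a diagonal
operator with eigenvalues `a` is normalized by a singular trace, if `1` is the exponent of
convergence of `∑ a ^ t`. -/
theorem exists_singularTrace_eq_one (b : HilbertBasis ι ℂ H) {A : H →L[ℂ] H} {a : κ → ℝ}
    (ha : ∀ p, 0 < a p)
    (hcc : ∀ s, 0 < s → concaveTrace b s A = ∑' p, ENNReal.ofReal (a p / (s + a p)))
    (hcv : ∀ s, 0 < s → convexTrace b s A = ∑' p, ENNReal.ofReal (a p ^ 2 / (s + a p)))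
    (hsum : ∀ ε : ℝ, 0 < ε → Summable fun p => a p ^ (1 + ε))
    (hdiv : ∀ ε : ℝ, 0 < ε → ε < 1 → ¬ Summable fun p => a p ^ (1 - ε)) :
    ∃ τ : SingularTrace H, τ.toFun A = 1 := by
  refine exists_singularTrace_of_isApproxTrace b fun k => ?_
  have hk : 0 < 1 / ((k : ℝ) + 1) := by positivity
  have hk1 : 1 / ((k : ℝ) + 1) ≤ 1 := by
    rw [div_le_one (by positivity)]
    linarith [(Nat.cast_nonneg k : (0 : ℝ) ≤ k)]
  -- Convergence at the critical exponent itself decides from which side the exponent 1 is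
  -- approached.
  by_cases h : Summable a
  -- Half of 1/(k+1) is used because the concave construction needs ε < 1, also for k = 0.
  · obtain ⟨K, G, hG⟩ := isApproxTrace_concaveSum b ha hcc h (half_pos hk) (by linarith)
      (hdiv _ (half_pos hk) (by linarith)) (k + 1)
    have h2 : ENNReal.ofReal (2 ^ (1 / ((k : ℝ) + 1) / 2)) ≤
        ENNReal.ofReal (2 ^ (1 / ((k : ℝ) + 1))) :=
      ENNReal.ofReal_le_ofReal
        (Real.rpow_le_rpow_of_exponent_le one_le_two (half_le_self hk.le))
    exact ⟨K, G, fun S T hS hT => (hG.add_le S T hS hT).trans (mul_le_mul_left h2 _),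
      fun S T hS hT => (hG.le_add S T hS hT).trans (mul_le_mul_left h2 _), hG.tracial,
      hG.projection_le, hG.mul_le, hG.ne_top, hG.const_ne_zero, hG.const_ne_top⟩
  · exact isApproxTrace_convexSum b ha hcv hsum h hk hk1 (k + 1)

end ConstructionConcave


/-! ### Diagonal operators -/

section Diagonal

variable {ι H : Type*} [NormedAddCommGroup H] [InnerProductSpace ℂ H]

/-- `T` is the diagonal operator with entries `c` with respect to the basis `b`. -/
def IsDiag (b : HilbertBasis ι ℂ H) (T : H →L[ℂ] H) (c : ι → ℂ) : Prop :=
  ∀ i, T (b i) = c i • b i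

/-- The diagonal operator with bounded entries `c` with respect to the basis `b`. -/
def diagOp (b : HilbertBasis ι ℂ H) (c : ι → ℂ) (C : ℝ) (hC : 0 ≤ C) (hc : ∀ i, ‖c i‖ ≤ C) :
    H →L[ℂ] H :=
  (b.repr.symm.toContinuousLinearEquiv : lp (fun _ : ι => ℂ) 2 →L[ℂ] H) ∘L
    scaleOp c C hC hc (Equiv.refl ι) ∘L (b.repr.toContinuousLinearEquiv : H →L[ℂ] _)

variable {b : HilbertBasis ι ℂ H} {S T : H →L[ℂ] H} {c d : ι → ℂ} {a : ι → ℝ}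

lemma isDiag_diagOp {C : ℝ} (hC : 0 ≤ C) (hc : ∀ i, ‖c i‖ ≤ C) :
    IsDiag b (diagOp b c C hC hc) c := by
  classical
  intro i
  apply b.repr.injective
  ext j
  have h : b.repr (diagOp b c C hC hc (b i)) = scaleOp c C hC hc (Equiv.refl ι) (b.repr (b i)) :=
    b.repr.apply_symm_apply _
  rw [h, scaleOp_apply, map_smul, lp.coeFn_smul, Pi.smul_apply, b.repr_self, smul_eq_mul]
  by_cases h : j = i
  · subst h; rfl
  · simp [lp.single_apply, h]

lemma norm_diagOp_le {C : ℝ} (hC : 0 ≤ C) (hc : ∀ i, ‖c i‖ ≤ C) :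
    ‖diagOp b c C hC hc‖ ≤ C := by
  refine ContinuousLinearMap.opNorm_le_bound _ hC fun x => ?_
  have h : ‖diagOp b c C hC hc x‖ = ‖scaleOp c C hC hc (Equiv.refl ι) (b.repr x)‖ :=
    b.repr.symm.norm_map _
  rw [h, ← b.repr.norm_map x]
  exact ContinuousLinearMap.le_of_opNorm_le _ (LinearMap.mkContinuous_norm_le _ hC _) _

namespace IsDiag

lemma eq (hS : IsDiag b S c) (hT : IsDiag b T c) : S = T := by
  refine ContinuousLinearMap.ext_on (s := range b) ?_ ?_
  · exact Submodule.dense_iff_topologicalClosure_eq_top.mpr b.dense_span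
  · rintro _ ⟨i, rfl⟩
    rw [hS, hT]

lemma mul (hS : IsDiag b S c) (hT : IsDiag b T d) : IsDiag b (S * T) fun i => c i * d i :=
  fun i => by rw [mul_apply_eq_comp, hT, map_smul, hS, smul_smul, mul_comm]

lemma add (hS : IsDiag b S c) (hT : IsDiag b T d) : IsDiag b (S + T) fun i => c i + d i :=
  fun i => by rw [add_apply, hS, hT, add_smul]

lemma sub (hS : IsDiag b S c) (hT : IsDiag b T d) : IsDiag b (S - T) fun i => c i - d i :=
  fun i => by rw [sub_apply, hS, hT, sub_smul]

lemma smul (z : ℂ) (hT : IsDiag b T c) : IsDiag b (z • T) fun i => z * c i :=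
  fun i => by rw [smul_apply, hT, smul_smul]

lemma one : IsDiag b 1 fun _ => 1 :=
  fun i => by rw [one_smul, one_apply_eq_self]

lemma real_smul (r : ℝ) (hT : IsDiag b T c) : IsDiag b (r • T) fun i => r * c i := by
  rw [← Complex.coe_smul]
  exact hT.smul r

lemma algebraMap (r : ℝ) : IsDiag b (algebraMap ℝ (H →L[ℂ] H) r) fun _ => r := by
  rw [Algebra.algebraMap_eq_smul_one]
  simpa using (one (b := b)).real_smul r

lemma norm_basis (b : HilbertBasis ι ℂ H) (i : ι) : ‖b i‖ = 1 := b.orthonormal.1 i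

lemma norm_le (hT : IsDiag b T c) (i : ι) : ‖c i‖ ≤ ‖T‖ := by
  have h := T.le_opNorm (b i)
  rwa [hT, norm_smul, norm_basis, mul_one, mul_one] at h

lemma mem_spectrum (hT : IsDiag b T fun i => (a i : ℂ)) (i : ι) : a i ∈ spectrum ℝ T := by
  rw [spectrum.mem_iff]
  intro hu
  obtain ⟨R, hR⟩ := hu.exists_left_inv
  have h1 := (IsDiag.algebraMap (b := b) (a i)).sub hT i
  have h2 := congrArg (fun Q : H →L[ℂ] H => Q (b i)) hR
  simp only [mul_apply_eq_comp, one_apply_eq_self, h1, sub_self, zero_smul, map_zero] at h2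
  have h3 := norm_basis b i
  rw [← h2, norm_zero] at h3
  exact zero_ne_one h3

lemma opTrace (hT : IsDiag b T fun i => (a i : ℂ)) :
    opTrace b T = ∑' i, ENNReal.ofReal (a i) := by
  refine tsum_congr fun i => ?_
  rw [ContinuousLinearMap.reApplyInnerSelf, hT, inner_smul_left, inner_self_eq_norm_sq_to_K,
    norm_basis]
  simp

lemma posResolvent (hT : IsDiag b T fun i => (a i : ℂ)) (ha : ∀ i, 0 ≤ a i) {s : ℝ}
    (hs : 0 < s) : IsDiag b (posResolvent s T) fun i => (((s + a i)⁻¹ : ℝ) : ℂ) := by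
  have hpos : ∀ i, 0 < s + a i := fun i => add_pos_of_pos_of_nonneg hs (ha i)
  obtain ⟨R, hR⟩ : ∃ R, IsDiag b R fun i => (((s + a i)⁻¹ : ℝ) : ℂ) :=
    ⟨_, isDiag_diagOp (inv_nonneg.mpr hs.le) fun i => by
      rw [Complex.norm_real, Real.norm_of_nonneg (inv_nonneg.mpr (hpos i).le)]
      exact inv_anti₀ hs (le_add_of_nonneg_right (ha i))⟩
  have hne : ∀ i, ((s : ℂ) + a i) ≠ 0 := fun i => by exact_mod_cast (hpos i).ne'
  have h : _root_.posResolvent s T = R := by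
    apply posResolvent_eq_of_mul
    · refine (((IsDiag.algebraMap s).add hT).mul hR).eq ?_
      convert IsDiag.one (b := b) using 2 with i
      push_cast
      exact mul_inv_cancel₀ (hne i)
    · refine (hR.mul ((IsDiag.algebraMap s).add hT)).eq ?_
      convert IsDiag.one (b := b) using 2 with i
      push_cast
      exact inv_mul_cancel₀ (hne i)
  rw [h]
  exact hR

variable [CompleteSpace H]

lemma star (hT : IsDiag b T c) : IsDiag b (star T) fun i => star (c i) := by
  classical
  intro i
  apply b.repr.injective
  ext j
  rw [b.repr_apply_apply, b.repr_apply_apply, ContinuousLinearMap.star_eq_adjoint,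
    ContinuousLinearMap.adjoint_inner_right, hT, inner_smul_left, inner_smul_right,
    orthonormal_iff_ite.mp b.orthonormal]
  split_ifs with h
  · rw [h]; rfl
  · rw [mul_zero, mul_zero]

lemma nonneg (hT : IsDiag b T fun i => (a i : ℂ)) (ha : ∀ i, 0 ≤ a i) : 0 ≤ T := by
  have hS := isDiag_diagOp (b := b) (c := fun i => (√(a i) : ℂ)) (Real.sqrt_nonneg ‖T‖)
    fun i => by
      rw [Complex.norm_real, Real.norm_of_nonneg (Real.sqrt_nonneg _)]
      refine Real.sqrt_le_sqrt ?_
      have := hT.norm_le i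
      rwa [Complex.norm_real, Real.norm_of_nonneg (ha i)] at this
  have h := hT.eq (by
    convert hS.star.mul hS using 2 with i
    rw [← starRingEnd_apply, Complex.conj_ofReal, ← Complex.ofReal_mul,
      Real.mul_self_sqrt (ha i)])
  rw [h]
  exact star_mul_self_nonneg _

lemma isSelfAdjoint (hT : IsDiag b T fun i => (a i : ℂ)) : IsSelfAdjoint T := by
  refine hT.star.eq ?_
  convert hT using 2 with i
  exact Complex.conj_ofReal _

/-- Uniqueness of the continuous functional calculus: sending g to the diagonal operator with
entries g(a i) is a continuous star homomorphism that maps the identity function to `T`. -/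
lemma cfc (hT : IsDiag b T fun i => (a i : ℂ)) {f : ℝ → ℝ}
    (hf : ContinuousOn f (spectrum ℝ T)) : IsDiag b (cfc f T) fun i => (f (a i) : ℂ) := by
  have hbound : ∀ (g : C(spectrum ℝ T, ℝ)) (i : ι),
      ‖((g ⟨a i, hT.mem_spectrum i⟩ : ℝ) : ℂ)‖ ≤ ‖g‖ := fun g i => by
    rw [Complex.norm_real]
    exact g.norm_coe_le_norm _
  have hdiag := fun g : C(spectrum ℝ T, ℝ) => isDiag_diagOp (b := b) (norm_nonneg g) (hbound g)
  let Φ : C(spectrum ℝ T, ℝ) →⋆ₐ[ℝ] (H →L[ℂ] H) :=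
    { toFun g := diagOp b _ ‖g‖ (norm_nonneg g) (hbound g)
      map_one' := (hdiag 1).eq (by simpa using one (b := b))
      map_mul' g h := (hdiag (g * h)).eq (by simpa using (hdiag g).mul (hdiag h))
      map_zero' := (hdiag 0).eq fun i => by simp
      map_add' g h := (hdiag (g + h)).eq (by simpa using (hdiag g).add (hdiag h))
      commutes' r := (hdiag _).eq (IsDiag.algebraMap r)
      map_star' g := (hdiag (Star.star g)).eq (by
        convert (hdiag g).star using 2 with i
        exact (Complex.conj_ofReal _).symm) }
  have hΦ : Continuous Φ := by
    refine AddMonoidHomClass.continuous_of_bound Φ 1 fun g => ?_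
    rw [one_mul]
    exact norm_diagOp_le (norm_nonneg g) _
  have h := cfcHom_eq_of_continuous_of_map_id hT.isSelfAdjoint Φ hΦ ((hdiag _).eq hT)
  rw [cfc_apply f T hT.isSelfAdjoint hf, h]
  exact hdiag _

lemma rpow (hT : IsDiag b T fun i => (a i : ℂ)) (ha : ∀ i, 0 ≤ a i) {α : ℝ} (hα : 0 ≤ α) :
    IsDiag b (CFC.rpow T α) fun i => ((a i ^ α : ℝ) : ℂ) := by
  have h : CFC.rpow T α = _root_.cfc (fun x : ℝ => x ^ α) T :=
    CFC.rpow_eq_cfc_real (hT.nonneg ha)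
  rw [h]
  exact hT.cfc (f := fun x => x ^ α) (Real.continuous_rpow_const hα).continuousOn

lemma concaveTrace (hT : IsDiag b T fun i => (a i : ℂ)) (ha : ∀ i, 0 ≤ a i) {s : ℝ}
    (hs : 0 < s) : concaveTrace b s T = ∑' i, ENNReal.ofReal (a i / (s + a i)) := by
  rw [concaveTrace_eq _ hs (hT.nonneg ha)]
  refine IsDiag.opTrace ?_
  convert hT.mul (hT.posResolvent ha hs) using 2 with i
  rw [← Complex.ofReal_mul, div_eq_mul_inv]

lemma convexTrace (hT : IsDiag b T fun i => (a i : ℂ)) (ha : ∀ i, 0 ≤ a i) {s : ℝ}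
    (hs : 0 < s) : convexTrace b s T = ∑' i, ENNReal.ofReal (a i ^ 2 / (s + a i)) := by
  rw [convexTrace_eq _ hs (hT.nonneg ha)]
  refine IsDiag.opTrace ?_
  convert hT.mul (IsDiag.one.sub ((hT.posResolvent ha hs).real_smul s)) using 1
  funext i
  have h : s + a i ≠ 0 := (add_pos_of_pos_of_nonneg hs (ha i)).ne'
  rw [← Complex.ofReal_mul, ← Complex.ofReal_one, ← Complex.ofReal_sub, ← Complex.ofReal_mul]
  congr 1
  field_simp
  ring

theorem exists_singularTrace_eq_one (hT : IsDiag b T fun i => (a i : ℂ)) (ha : ∀ i, 0 < a i)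
    (hsum : ∀ ε : ℝ, 0 < ε → Summable fun i => a i ^ (1 + ε))
    (hdiv : ∀ ε : ℝ, 0 < ε → ε < 1 → ¬ Summable fun i => a i ^ (1 - ε)) :
    ∃ τ : SingularTrace H, τ.toFun T = 1 :=
  _root_.exists_singularTrace_eq_one b ha
    (fun _ hs => hT.concaveTrace (fun i => (ha i).le) hs)
    (fun _ hs => hT.convexTrace (fun i => (ha i).le) hs) hsum hdiv

end IsDiag

end Diagonal


/-! ### Singular values of diagonal operators -/

section Counting

variable {κ : Type*}

/-- If `a` has at most `K t^{-ρ}` entries larger than `t`, then `∑ a ^ γ < ∞` for `γ > ρ`. -/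
lemma summable_rpow_of_card_le {a : κ → ℝ} {M K ρ γ : ℝ} (ha : ∀ i, 0 < a i) (hM : ∀ i, a i ≤ M)
    (hρ : 0 < ρ) (hργ : ρ < γ)
    (h : ∀ t, 0 < t → ∀ S : Finset κ, (∀ i ∈ S, t < a i) → (S.card : ℝ) ≤ K * t ^ (-ρ)) :
    Summable fun i => a i ^ γ := by
  let _ : MeasurableSpace κ := ⊤
  have hγ : 0 < γ := hρ.trans hργ
  have hcount : ∀ t, 0 < t →
      Measure.count {i | t < a i} ≤ ENNReal.ofReal (K * t ^ (-ρ)) := by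
    intro t ht
    have hfin : {i | t < a i}.Finite := by
      by_contra hinf
      obtain ⟨n, hn⟩ := exists_nat_gt (K * t ^ (-ρ))
      obtain ⟨S, hS, hcard⟩ := Set.Infinite.exists_subset_card_eq hinf n
      have := h t ht S fun i hi => hS hi
      rw [hcard] at this
      linarith
    rw [Measure.count_apply_finite _ hfin, ← ENNReal.ofReal_natCast]
    exact ENNReal.ofReal_le_ofReal (h t ht _ fun i hi => by simpa using hi)
  -- Layer cake formula for counting measure: the integrand is at most K t^{γ-1-ρ} on (0, M] and
  -- vanishes beyond M; since γ > ρ it is integrable at 0.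
  have hlc := lintegral_rpow_eq_lintegral_meas_lt_mul (Measure.count : Measure κ)
    (f := a) (Eventually.of_forall fun i => (ha i).le) Measurable.of_discrete.aemeasurable hγ
  rw [lintegral_count] at hlc
  have hint : IntegrableOn (fun t : ℝ => K * t ^ (γ - 1 - ρ)) (Ioc 0 M) := by
    rcases le_or_gt M 0 with hM0 | hM0
    · rw [Ioc_eq_empty_of_le hM0]
      exact integrableOn_empty
    · rw [← intervalIntegrable_iff_integrableOn_Ioc_of_le hM0.le]
      exact (intervalIntegral.intervalIntegrable_rpow' (by linarith)).const_mul K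
  have hle : ∫⁻ t in Ioi (0 : ℝ), Measure.count {i | t < a i} * ENNReal.ofReal (t ^ (γ - 1)) ≤
      ∫⁻ t in Ioc 0 M, ENNReal.ofReal (K * t ^ (γ - 1 - ρ)) := by
    rw [← lintegral_indicator measurableSet_Ioi, ← lintegral_indicator measurableSet_Ioc]
    refine lintegral_mono fun t => ?_
    by_cases ht : 0 < t
    · rw [indicator_of_mem (mem_Ioi.mpr ht)]
      by_cases htM : t ≤ M
      · rw [indicator_of_mem (mem_Ioc.mpr ⟨ht, htM⟩)]
        refine (mul_le_mul_left (hcount t ht) _).trans ?_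
        rw [← ENNReal.ofReal_mul' (by positivity)]
        refine ENNReal.ofReal_le_ofReal (le_of_eq ?_)
        rw [mul_assoc, ← Real.rpow_add ht]
        congr 2
        ring
      · have : {i | t < a i} = ∅ := by
          ext i
          simpa using (hM i).trans (not_le.mp htM).le
        rw [this, measure_empty, zero_mul]
        exact zero_le
    · rw [indicator_of_notMem (by simpa using ht)]
      exact zero_le
  have hfinite : ∑' i, ENNReal.ofReal (a i ^ γ) ≠ ⊤ := by
    rw [hlc]
    refine ENNReal.mul_ne_top ENNReal.ofReal_ne_top (ne_top_of_le_ne_top ?_ hle)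
    exact (hint.lintegral_lt_top).ne
  have := ENNReal.summable_toReal hfinite
  simpa only [ENNReal.toReal_ofReal (Real.rpow_nonneg (ha _).le γ)] using this

end Counting

namespace IsDiag

variable {ι H : Type*} [NormedAddCommGroup H] [InnerProductSpace ℂ H] [CompleteSpace H]
  {b : HilbertBasis ι ℂ H} {T : H →L[ℂ] H} {a : ι → ℝ}

lemma repr_apply (hT : IsDiag b T fun i => (a i : ℂ)) (x : H) (i : ι) :
    b.repr (T x) i = a i * b.repr x i := by
  rw [b.repr_apply_apply, b.repr_apply_apply, ← ContinuousLinearMap.adjoint_inner_left,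
    ← ContinuousLinearMap.star_eq_adjoint, hT.star, inner_smul_left]
  simp

/-- The sum of the eigenspaces of `T` for eigenvalues greater than `t`. -/
lemma iSup_eigenspace_le (hT : IsDiag b T fun i => (a i : ℂ)) {t : ℝ} {S : Finset ι}
    (hS : ∀ i, t < a i → i ∈ S) :
    (⨆ (s : ℝ) (_ : t < s), Module.End.eigenspace (T : Module.End ℂ H) (s : ℂ)) ≤
      Submodule.span ℂ (b '' S) := by
  classical
  refine iSup₂_le fun s hs x hx => ?_
  have hx' : T x = (s : ℂ) • x := Module.End.mem_eigenspace_iff.mp hx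
  have h0 : ∀ i, i ∉ S → b.repr x i = 0 := by
    intro i hi
    have h1 := hT.repr_apply x i
    rw [hx', map_smul, lp.coeFn_smul, Pi.smul_apply, smul_eq_mul] at h1
    have h2 : ((s : ℂ) - a i) * b.repr x i = 0 := by rw [sub_mul, h1, sub_self]
    refine (mul_eq_zero.mp h2).resolve_left ?_
    have h3 : a i ≤ t := not_lt.mp fun h => hi (hS i h)
    rw [← Complex.ofReal_sub]
    exact_mod_cast (sub_pos.mpr (h3.trans_lt hs)).ne'
  have hsum : x = ∑ i ∈ S, b.repr x i • b i := by
    refine (b.hasSum_repr x).unique ?_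
    exact hasSum_sum_of_ne_finset_zero fun i hi => by rw [h0 i hi, zero_smul]
  rw [hsum]
  exact Submodule.sum_mem _ fun i hi =>
    Submodule.smul_mem _ _ (Submodule.subset_span ⟨i, hi, rfl⟩)

lemma abs_eq (hT : IsDiag b T fun i => (a i : ℂ)) (ha : ∀ i, 0 ≤ a i) : CFC.abs T = T :=
  CFC.abs_of_nonneg T (hT.nonneg ha)

lemma singVal_le (hT : IsDiag b T fun i => (a i : ℂ)) (ha : ∀ i, 0 ≤ a i) {t : ℝ} (ht : 0 ≤ t)
    {S : Finset ι} (hS : ∀ i, t < a i → i ∈ S) {k : ℕ} (hk : S.card ≤ k) : singVal T k ≤ t := by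
  classical
  refine csInf_le ⟨0, fun _ h => h.1⟩ ⟨ht, ?_⟩
  rw [hT.abs_eq ha]
  calc Module.rank ℂ ↥(⨆ (s : ℝ) (_ : t < s),
        Module.End.eigenspace (T : Module.End ℂ H) (s : ℂ))
      ≤ Module.rank ℂ (Submodule.span ℂ (b '' S)) := Submodule.rank_mono (hT.iSup_eigenspace_le hS)
    _ ≤ (S.image b).card := by
        rw [← Finset.coe_image]
        exact rank_span_finset_le _
    _ ≤ k := Nat.cast_le.mpr (Finset.card_image_le.trans hk)

lemma le_singVal (hT : IsDiag b T fun i => (a i : ℂ)) (ha : ∀ i, 0 ≤ a i) {t : ℝ}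
    {S : Finset ι} (hS : ∀ i ∈ S, t < a i) {k : ℕ} (hk : k < S.card) : t ≤ singVal T k := by
  refine le_csInf ⟨‖T‖, norm_nonneg T, ?_⟩ fun t' ht' => ?_
  · rw [hT.abs_eq ha]
    have h := hT.iSup_eigenspace_le (t := ‖T‖) (S := ∅) fun i hi => by
      have := hT.norm_le i
      rw [Complex.norm_real, Real.norm_of_nonneg (ha i)] at this
      exact absurd hi (not_lt.mpr this)
    rw [Finset.coe_empty, image_empty, Submodule.span_empty, le_bot_iff] at h
    rw [h, rank_bot]
    exact zero_le
  · by_contra hlt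
    rw [not_le] at hlt
    have h := ht'.2
    rw [hT.abs_eq ha] at h
    have hle : Submodule.span ℂ (range fun i : S => b i) ≤
        ⨆ (s : ℝ) (_ : t' < s), Module.End.eigenspace (T : Module.End ℂ H) (s : ℂ) := by
      rw [Submodule.span_le]
      rintro _ ⟨i, rfl⟩
      refine Submodule.mem_iSup_of_mem (a i) (Submodule.mem_iSup_of_mem
        (hlt.trans (hS i i.2)) ?_)
      exact Module.End.mem_eigenspace_iff.mpr (hT i)
    have hli : LinearIndependent ℂ fun i : S => b i :=
      b.orthonormal.linearIndependent.comp _ Subtype.val_injective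
    have h1 := (Submodule.rank_mono hle).trans h
    rw [rank_span hli] at h1
    have h2 := Cardinal.lift_le.mpr h1
    rw [Cardinal.mk_range_eq_of_injective hli.injective, Cardinal.mk_coe_finset,
      Cardinal.lift_natCast, Cardinal.lift_natCast, Nat.cast_le] at h2
    exact absurd hk (not_lt.mpr h2)

/-- Entries are selected greedily. If all entries above μ_n - δ were among the at most n already
chosen, μ_n would be at most μ_n - δ; so a new one is available, at an error of δ per step. -/
lemma sum_singVal_le_tsum (hT : IsDiag b T fun i => (a i : ℂ)) (ha : ∀ i, 0 ≤ a i)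
    (hsum : Summable a) (n : ℕ) : ∑ k ∈ Finset.range n, singVal T k ≤ ∑' i, a i := by
  classical
  have hfin : ∀ t, 0 < t → {i | t < a i}.Finite := fun t ht => by
    have h := hsum.tendsto_cofinite_zero.eventually (gt_mem_nhds ht)
    exact (show {i | ¬ a i < t}.Finite from h).subset fun i hi => not_lt.mpr (le_of_lt hi)
  have key : ∀ δ : ℝ, 0 < δ → ∀ n : ℕ, ∃ S : Finset ι, S.card ≤ n ∧
      ∑ k ∈ Finset.range n, singVal T k ≤ ∑ i ∈ S, a i + n * δ := by
    intro δ hδ n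
    induction n with
    | zero => exact ⟨∅, le_rfl, by simp⟩
    | succ n ih =>
      obtain ⟨S, hS, hle⟩ := ih
      rw [Finset.sum_range_succ]
      push_cast
      rcases le_or_gt (singVal T n) δ with h | h
      · exact ⟨S, hS.trans n.le_succ, by linarith⟩
      · have ht : 0 < singVal T n - δ := sub_pos.mpr h
        have hex : ∃ i, singVal T n - δ < a i ∧ i ∉ S := by
          by_contra! hcon
          have := hT.singVal_le ha ht.le hcon hS
          linarith
        obtain ⟨i, hi, hiS⟩ := hex
        refine ⟨insert i S, ?_, ?_⟩
        · rw [Finset.card_insert_of_notMem hiS]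
          exact Nat.succ_le_succ hS
        · rw [Finset.sum_insert hiS]
          linarith
  refine le_of_forall_pos_le_add fun δ hδ => ?_
  obtain ⟨S, -, hS⟩ := key (δ / (n + 1)) (by positivity) n
  have h1 := hsum.sum_le_tsum S fun i _ => ha i
  have h2 : (n : ℝ) * (δ / (n + 1)) ≤ δ := by
    rw [← mul_div_assoc, div_le_iff₀ (by positivity)]
    nlinarith
  linarith

lemma singVal_nonneg (T : H →L[ℂ] H) (k : ℕ) : 0 ≤ singVal T k :=
  Real.sInf_nonneg fun _ h => h.1

lemma memL1InftyZero (hT : IsDiag b T fun i => (a i : ℂ)) (ha : ∀ i, 0 ≤ a i)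
    (hc : IsCompactOperator T) (hsum : Summable a) : MemL1InftyZero T := by
  refine ⟨hc, Asymptotics.IsBigO.trans_isLittleO (g := fun _ : ℕ => (1 : ℝ)) ?_ ?_⟩
  · refine Asymptotics.IsBigO.of_bound (∑' i, a i) (Eventually.of_forall fun n => ?_)
    rw [norm_one, mul_one, Real.norm_of_nonneg (Finset.sum_nonneg fun k _ => singVal_nonneg T k)]
    exact hT.sum_singVal_le_tsum ha hsum n
  · rw [Asymptotics.isLittleO_const_left]
    right
    exact tendsto_norm_atTop_atTop.comp (Real.tendsto_log_atTop.comp tendsto_natCast_atTop_atTop)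

/-- If n entries exceed t, then n t is at most the sum of the first n singular values, which is
O(log n) and so O(n^{1-1/ρ}). This gives n ≤ (C/t)^ρ, with ρ chosen strictly between 1 and γ. -/
lemma summable_rpow_of_memL1Infty (hT : IsDiag b T fun i => (a i : ℂ)) (ha : ∀ i, 0 < a i)
    (h : MemL1Infty T) {γ : ℝ} (hγ : 1 < γ) : Summable fun i => a i ^ γ := by
  set ρ := (1 + γ) / 2 with hρdef
  have hρ1 : 1 < ρ := by linarith
  have hρ0 : 0 < ρ := by linarith
  have hθ : 0 < 1 - 1 / ρ := by
    rw [sub_pos, div_lt_one hρ0]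
    exact hρ1
  have hO := h.2.trans ((isLittleO_log_rpow_atTop hθ).comp_tendsto
    tendsto_natCast_atTop_atTop).isBigO
  obtain ⟨C, hC, hbound⟩ := Asymptotics.bound_of_isBigO_nat_atTop hO
  refine summable_rpow_of_card_le (M := ‖T‖) (K := C ^ ρ) ha (fun i => ?_) hρ0 (by linarith)
    fun t ht S hS => ?_
  · have := hT.norm_le i
    rwa [Complex.norm_real, Real.norm_of_nonneg (ha i).le] at this
  rcases S.card.eq_zero_or_pos with h0 | hpos
  · rw [h0, Nat.cast_zero]
    positivity
  set n := S.card
  have hn : (0 : ℝ) < n := by exact_mod_cast hpos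
  have h1 := hbound (x := n) (Real.rpow_pos_of_pos hn _).ne'
  simp only [Function.comp_apply] at h1
  rw [Real.norm_of_nonneg (Finset.sum_nonneg fun k _ => singVal_nonneg T k),
    Real.norm_of_nonneg (by positivity)] at h1
  have h2 : n * t ≤ ∑ k ∈ Finset.range n, singVal T k := by
    have := Finset.card_nsmul_le_sum (Finset.range n) (fun k => singVal T k) t fun k hk =>
      hT.le_singVal (fun i => (ha i).le) hS (Finset.mem_range.mp hk)
    simpa using this
  have h3 : n * t ≤ C * (n / (n : ℝ) ^ (1 / ρ)) := by
    have := h2.trans h1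
    rwa [Real.rpow_sub hn, Real.rpow_one] at this
  have h4 : (n : ℝ) ^ (1 / ρ) ≤ C / t := by
    rw [le_div_iff₀ ht]
    have hp : 0 < (n : ℝ) ^ (1 / ρ) := by positivity
    rw [← mul_div_assoc, le_div_iff₀ hp] at h3
    nlinarith
  calc (n : ℝ) = ((n : ℝ) ^ (1 / ρ)) ^ ρ := by
        rw [← Real.rpow_mul hn.le, one_div_mul_cancel hρ0.ne', Real.rpow_one]
    _ ≤ (C / t) ^ ρ := Real.rpow_le_rpow (by positivity) h4 hρ0.le
    _ = C ^ ρ * t ^ (-ρ) := by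
        rw [Real.div_rpow hC.le ht.le, Real.rpow_neg ht.le, div_eq_mul_inv]

end IsDiag


/-! ### The dimension of Connes' spectral triple -/

namespace Gap

variable {F : Set ℝ}

lemma length_rpow_nonneg (α : ℝ) (g : Gap F) : 0 ≤ g.length ^ α :=
  Real.rpow_nonneg g.length_pos.le α

instance [CompactSpace F] : Countable (Gap F) := by
  have h : (univ : Set (Gap F)) = ⋃ n : ℕ, {g : Gap F | 1 / ((n : ℝ) + 1) < g.length} := by
    ext g
    simpa using exists_nat_one_div_lt g.length_pos
  exact countable_univ_iff.mp (h ▸ countable_iUnion fun n =>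
    (finite_length_gt (by positivity)).countable)

lemma summable_length [CompactSpace F] : Summable (length : Gap F → ℝ) := by
  have hb : Bornology.IsBounded F := (isCompact_iff_compactSpace.mpr inferInstance).isBounded
  obtain ⟨R, hR⟩ := hb.subset_closedBall 0
  have hsub : (⋃ g : Gap F, Ioo g.1.1 g.1.2) ⊆ Metric.closedBall 0 R := by
    refine iUnion_subset fun g => ?_
    have h1 := hR g.2.2.1
    have h2 := hR g.2.2.2.1
    rw [Real.closedBall_eq_Icc] at h1 h2 ⊢
    exact fun x hx => ⟨h1.1.trans hx.1.le, hx.2.le.trans h2.2⟩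
  have h := (tsum_meas_le_meas_iUnion_of_disjoint (volume : Measure ℝ)
    (As := fun g : Gap F => Ioo g.1.1 g.1.2) (fun _ => measurableSet_Ioo)
    pairwise_disjoint).trans_lt ((measure_mono hsub).trans_lt measure_closedBall_lt_top)
  have h2 := ENNReal.summable_toReal h.ne
  simp only [Real.volume_Ioo] at h2
  refine h2.congr fun g => ?_
  exact ENNReal.toReal_ofReal g.length_pos.le

lemma summable_prod_length_rpow {α : ℝ} :
    (Summable fun p : Gap F × Bool => p.1.length ^ α) ↔
      Summable fun g : Gap F => g.length ^ α := by
  rw [summable_prod_of_nonneg fun p => length_rpow_nonneg α p.1]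
  simp only [tsum_fintype, Finset.sum_const, Finset.card_univ, Fintype.card_bool, nsmul_eq_mul]
  refine ⟨fun h => ?_, fun h => ⟨fun g => (hasSum_fintype _).summable, h.mul_left _⟩⟩
  exact (summable_mul_left_iff (by norm_num : ((2 : ℕ) : ℝ) ≠ 0)).mp h.2

end Gap

lemma SpectralTriple.isDiag_absNegPow {𝓐 ι H : Type*} [Ring 𝓐] [StarRing 𝓐] [Algebra ℂ 𝓐]
    [NormedAddCommGroup H] [InnerProductSpace ℂ H] [CompleteSpace H] {T : SpectralTriple 𝓐 H}
    {b : HilbertBasis ι ℂ H} {L : H →L[ℂ] H} {a : ι → ℝ} (hL : IsDiag b L fun i => (a i : ℂ))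
    (ha : ∀ i, 0 ≤ a i) (hsq : L * L = star T.inv * T.inv) {α : ℝ} (hα : 0 ≤ α) :
    IsDiag b (T.absNegPow α) fun i => ((a i ^ α : ℝ) : ℂ) := by
  have h : CFC.abs T.inv = L := CFC.sqrt_unique hsq (hL.nonneg ha)
  rw [SpectralTriple.absNegPow, h]
  exact hL.rpow ha hα

namespace Connes

variable (F : Set ℝ)

/-- The standard basis of the Hilbert space of the spectral triple. -/
def stdBasis : HilbertBasis (Gap F × Bool) ℂ (Hilb F) := ⟨LinearIsometryEquiv.refl ℂ _⟩

variable {F}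

lemma isDiag_of_apply {T : Hilb F →L[ℂ] Hilb F} {c : Gap F × Bool → ℂ}
    (h : ∀ ξ p, T ξ p = c p * ξ p) : IsDiag (stdBasis F) T c := by
  classical
  intro p
  have hb : stdBasis F p = lp.single 2 p (1 : ℂ) := by
    rw [← HilbertBasis.repr_symm_single]
    rfl
  ext q
  rw [h, lp.coeFn_smul, Pi.smul_apply, smul_eq_mul, hb]
  by_cases hq : q = p
  · rw [hq]
  · simp [lp.single_apply, hq]

variable [CompactSpace F]

/-- Both ends of a gap carry the same length, so the exchange commutes with the diagonal operator of
lengths and disappears in the square of `D⁻¹`. Hence |D⁻¹| is that diagonal operator. -/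
lemma isDiag_absNegPow {α : ℝ} (hα : 0 ≤ α) : IsDiag (stdBasis F) ((connesTriple F).absNegPow α)
    fun p => ((p.1.length ^ α : ℝ) : ℂ) := by
  let L : Hilb F →L[ℂ] Hilb F := scaleOp (fun p => (p.1.length : ℂ)) (Metric.diam F)
    Metric.diam_nonneg (fun p => by
      rw [Complex.norm_real, Real.norm_of_nonneg p.1.length_pos.le]
      exact p.1.length_le) (Equiv.refl _)
  have hL : IsDiag (stdBasis F) L fun p => (p.1.length : ℂ) := isDiag_of_apply fun _ _ => rfl
  have hself : star (diracInv F) = diracInv F := by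
    rw [ContinuousLinearMap.star_eq_adjoint, eq_comm, ContinuousLinearMap.eq_adjoint_iff]
    exact inner_diracInv F
  have hsq : L * L = star (diracInv F) * diracInv F := by
    rw [hself]
    ext ξ p
    simp [L, diracInv_apply]
  exact SpectralTriple.isDiag_absNegPow (T := connesTriple F) hL
    (fun p => p.1.length_pos.le) hsq hα

lemma isCompactOperator_absNegPow {α : ℝ} (hα : 0 < α) :
    IsCompactOperator ((connesTriple F).absNegPow α) := by
  have hT := isDiag_absNegPow (F := F) hα.le
  have hc := scaleOp_compact (norm_nonneg _) hT.norm_le (Equiv.refl _) fun δ hδ => by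
    refine ((Gap.finite_length_gt (F := F) (Real.rpow_pos_of_pos hδ α⁻¹)).prod
      (Set.finite_univ (α := Bool))).subset ?_
    intro p hp
    have hp0 := p.1.length_pos
    simp only [Set.mem_ofPred_eq, Complex.norm_real,
      Real.norm_of_nonneg (Real.rpow_nonneg hp0.le α)] at hp
    refine ⟨?_, trivial⟩
    have := Real.rpow_lt_rpow hδ.le hp (inv_pos.mpr hα)
    rwa [Real.rpow_rpow_inv hp0.le hα.ne'] at this
  have e := (isDiag_of_apply fun _ _ => rfl : IsDiag (stdBasis F)
    (scaleOp _ _ (norm_nonneg _) hT.norm_le (Equiv.refl _)) _).eq hT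
  rwa [e] at hc

lemma memL1InftyZero_of_summable {α : ℝ} (hα : 0 < α)
    (h : Summable fun g : Gap F => g.length ^ α) :
    MemL1InftyZero ((connesTriple F).absNegPow α) :=
  (isDiag_absNegPow hα.le).memL1InftyZero (fun p => Real.rpow_nonneg p.1.length_pos.le α)
    (isCompactOperator_absNegPow hα) (Gap.summable_prod_length_rpow.mpr h)

lemma memL1Infty_of_summable {α : ℝ} (hα : 0 < α)
    (h : Summable fun g : Gap F => g.length ^ α) : MemL1Infty ((connesTriple F).absNegPow α) :=
  ⟨isCompactOperator_absNegPow hα, (memL1InftyZero_of_summable hα h).2.isBigO⟩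

lemma summable_of_memL1Infty {α β : ℝ} (hα : 0 < α) (hαβ : α < β)
    (h : MemL1Infty ((connesTriple F).absNegPow α)) :
    Summable fun g : Gap F => g.length ^ β := by
  rw [← Gap.summable_prod_length_rpow]
  have h1 := (isDiag_absNegPow hα.le).summable_rpow_of_memL1Infty
    (fun p => Real.rpow_pos_of_pos p.1.length_pos α) h ((one_lt_div hα).mpr hαβ)
  refine h1.congr fun p => ?_
  rw [← Real.rpow_mul p.1.length_pos.le, mul_div_cancel₀ _ hα.ne']

lemma dim_le_of_summable {α : ℝ} (hα : 0 < α) (h : Summable fun g : Gap F => g.length ^ α) :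
    (connesTriple F).dim ≤ ENNReal.ofReal α :=
  sInf_le ⟨α, ⟨hα, memL1InftyZero_of_summable hα h⟩, rfl⟩

lemma summable_of_dim_lt {α : ℝ} (h : (connesTriple F).dim < ENNReal.ofReal α) :
    Summable fun g : Gap F => g.length ^ α := by
  obtain ⟨_, ⟨β, ⟨hβ, hmem⟩, rfl⟩, hlt⟩ := sInf_lt_iff.mp h
  exact summable_of_memL1Infty hβ ((ENNReal.ofReal_lt_ofReal_iff_of_nonneg hβ.le).mp hlt)
    ⟨hmem.1, hmem.2.isBigO⟩

lemma supDim_le_of_summable {α : ℝ} (h : Summable fun g : Gap F => g.length ^ α) :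
    (connesTriple F).supDim ≤ ENNReal.ofReal α := by
  refine sSup_le ?_
  rintro _ ⟨β, ⟨hβ, hmem⟩, rfl⟩
  refine ENNReal.ofReal_le_ofReal (not_lt.mp fun hlt => hmem (memL1Infty_of_summable hβ ?_))
  have hpos : ∀ g : Gap F, 0 < g.length := fun g => g.length_pos
  have hD : ∀ g : Gap F, g.length ≤ Metric.diam F := fun g => g.length_le
  refine Summable.of_nonneg_of_le (fun g => (Real.rpow_pos_of_pos (hpos g) β).le) (fun g => ?_)
    (h.mul_left (Metric.diam F ^ (β - α)))
  calc g.length ^ β = g.length ^ (β - α) * g.length ^ α := by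
        rw [← Real.rpow_add (hpos g), sub_add_cancel]
    _ ≤ Metric.diam F ^ (β - α) * g.length ^ α :=
        mul_le_mul_of_nonneg_right (Real.rpow_le_rpow (hpos g).le (hD g) (sub_pos.mpr hlt).le)
          (Real.rpow_pos_of_pos (hpos g) α).le

lemma summable_of_supDim_lt {α : ℝ} (h : (connesTriple F).supDim < ENNReal.ofReal α) :
    Summable fun g : Gap F => g.length ^ α := by
  -- The extra exponent `β'` guarantees that `β` is strictly positive.
  obtain ⟨β', hβ', h1, h2⟩ := ENNReal.lt_iff_exists_real_btwn.mp h
  obtain ⟨β, hβ, h3, h4⟩ := ENNReal.lt_iff_exists_real_btwn.mp h2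
  have h5 := (ENNReal.ofReal_lt_ofReal_iff_of_nonneg hβ').mp h3
  have h6 := (ENNReal.ofReal_lt_ofReal_iff_of_nonneg hβ).mp h4
  have hβ0 : 0 < β := hβ'.trans_lt h5
  refine summable_of_memL1Infty hβ0 h6 ?_
  by_contra hmem
  exact absurd (le_sSup ⟨β, ⟨hβ0, hmem⟩, rfl⟩ : ENNReal.ofReal β ≤ (connesTriple F).supDim)
    (not_le.mpr (h1.trans h3))

/-- Each side is at most α once ∑ ℓ^α converges (α > 0), and is below α only if it converges. -/
lemma dim_eq_supDim : (connesTriple F).dim = (connesTriple F).supDim := by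
  refine le_antisymm (le_of_forall_gt fun x hx => ?_) (le_of_forall_gt fun x hx => ?_)
  · obtain ⟨α, hα, h1, h2⟩ := ENNReal.lt_iff_exists_real_btwn.mp hx
    have hα0 : 0 < α := ENNReal.ofReal_pos.mp (pos_of_gt h1)
    exact (dim_le_of_summable hα0 (summable_of_supDim_lt h1)).trans_lt h2
  · obtain ⟨α, hα, h1, h2⟩ := ENNReal.lt_iff_exists_real_btwn.mp hx
    exact (supDim_le_of_summable (summable_of_dim_lt h1)).trans_lt h2

lemma dim_le_one : (connesTriple F).dim ≤ ENNReal.ofReal 1 :=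
  dim_le_of_summable one_pos (by simpa only [Real.rpow_one] using Gap.summable_length)

end Connes


/-! ### The upper box dimension -/

namespace Gap

variable {F : Set ℝ}

/-- The sum of `ℓ ^ α` over the gaps to the left of `x`. -/
def cumulative (F : Set ℝ) (α x : ℝ) : ℝ :=
  ∑' g, {g : Gap F | g.1.2 ≤ x}.indicator (fun g => g.length ^ α) g

lemma cumulative_nonneg (α x : ℝ) : 0 ≤ cumulative F α x :=
  tsum_nonneg fun g => Set.indicator_nonneg (fun g _ => length_rpow_nonneg α g) g

lemma cumulative_le {α : ℝ} (hs : Summable fun g : Gap F => g.length ^ α) (x : ℝ) :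
    cumulative F α x ≤ ∑' g : Gap F, g.length ^ α :=
  Summable.tsum_le_tsum (fun g => indicator_le_self' (fun g _ => length_rpow_nonneg α g) g)
    (hs.indicator _) hs

variable [CompactSpace F]

/-- A point outside `F` between two points of `F` lies in a gap between them. -/
lemma exists_mem_Ioo {x y z : ℝ} (hx : x ∈ F) (hy : y ∈ F) (hz : z ∈ Icc x y) (hzF : z ∉ F) :
    ∃ g : Gap F, x ≤ g.1.1 ∧ g.1.2 ≤ y ∧ z ∈ Ioo g.1.1 g.1.2 := by
  have hF : IsCompact F := isCompact_iff_compactSpace.mpr inferInstance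
  obtain ⟨a, ha⟩ := (hF.inter_right isClosed_Iic).exists_isGreatest (⟨x, hx, hz.1⟩ :
    (F ∩ Iic z).Nonempty)
  obtain ⟨b, hb⟩ := (hF.inter_right isClosed_Ici).exists_isLeast (⟨y, hy, hz.2⟩ :
    (F ∩ Ici z).Nonempty)
  have haz : a < z := lt_of_le_of_ne ha.1.2 fun h => hzF (h ▸ ha.1.1)
  have hzb : z < b := lt_of_le_of_ne hb.1.2 fun h => hzF (h.symm ▸ hb.1.1)
  refine ⟨⟨(a, b), haz.trans hzb, ha.1.1, hb.1.1, ?_⟩, ha.2 ⟨hx, hz.1⟩, hb.2 ⟨hy, hz.2⟩, haz, hzb⟩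
  rw [Set.disjoint_left]
  intro w hw hwF
  rcases le_total w z with h | h
  · exact absurd (ha.2 ⟨hwF, h⟩) (not_le.mpr hw.1)
  · exact absurd (hb.2 ⟨hwF, h⟩) (not_le.mpr hw.2)

/-- The set of gaps between `x` and `y`. -/
def between (F : Set ℝ) (x y : ℝ) : Set (Gap F) := {g | x ≤ g.1.1 ∧ g.1.2 ≤ y}

/-- The interval [x, y] is covered by the null set F and the gaps between x and y. -/
lemma sub_le_tsum_between (h0 : volume F = 0) {x y : ℝ} (hx : x ∈ F) (hy : y ∈ F) :
    y - x ≤ ∑' g, (between F x y).indicator length g := by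
  have hnn : ∀ g, 0 ≤ (between F x y).indicator length g :=
    fun g => Set.indicator_nonneg (fun g _ => g.length_pos.le) g
  have hs : Summable ((between F x y).indicator length) := summable_length.indicator _
  have hsub : Icc x y ⊆ F ∪ ⋃ g : between F x y, Ioo g.1.1.1 g.1.1.2 := by
    intro z hz
    by_cases hzF : z ∈ F
    · exact Or.inl hzF
    · obtain ⟨g, h1, h2, h3⟩ := exists_mem_Ioo hx hy hz hzF
      exact Or.inr (mem_iUnion.mpr ⟨⟨g, h1, h2⟩, h3⟩)
  have h := (measure_mono hsub).trans (measure_union_le (μ := volume) _ _)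
  rw [h0, zero_add, Real.volume_Icc] at h
  have h2 := h.trans (measure_iUnion_le _)
  simp only [Real.volume_Ioo] at h2
  have h3 : ∑' g : between F x y, ENNReal.ofReal (g.1.1.2 - g.1.1.1) =
      ∑' g, ENNReal.ofReal ((between F x y).indicator length g) := by
    have := tsum_subtype (between F x y) fun g : Gap F => ENNReal.ofReal g.length
    refine this.trans (tsum_congr fun g => ?_)
    by_cases hg : g ∈ between F x y <;> simp [hg]
  rw [h3, ← ENNReal.ofReal_tsum_of_nonneg hnn hs] at h2
  exact (ENNReal.ofReal_le_ofReal_iff (tsum_nonneg hnn)).mp h2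

/-- Each gap between x and y has ℓ ≤ y - x, hence ℓ ≤ (y-x)^{1-α} ℓ^α as α ≤ 1. Sum over these gaps
and cancel (y-x)^{1-α}. -/
lemma rpow_sub_le_tsum_between (h0 : volume F = 0) {α : ℝ} (hα1 : α ≤ 1)
    (hs : Summable fun g : Gap F => g.length ^ α) {x y : ℝ} (hx : x ∈ F) (hy : y ∈ F)
    (hxy : x < y) :
    (y - x) ^ α ≤ ∑' g, (between F x y).indicator (fun g => g.length ^ α) g := by
  have hd : 0 < y - x := sub_pos.mpr hxy
  have h1 : y - x ≤ (y - x) ^ (1 - α) *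
      ∑' g, (between F x y).indicator (fun g => g.length ^ α) g := by
    refine (sub_le_tsum_between h0 hx hy).trans ?_
    rw [← tsum_mul_left]
    refine Summable.tsum_le_tsum (fun g => ?_) (summable_length.indicator _)
      ((hs.indicator _).mul_left _)
    by_cases hg : g ∈ between F x y
    · rw [indicator_of_mem hg, indicator_of_mem hg]
      have hl := g.length_pos
      have hle : g.length ≤ y - x := sub_le_sub hg.2 hg.1
      calc g.length = g.length ^ (1 - α) * g.length ^ α := by
            rw [← Real.rpow_add hl, sub_add_cancel, Real.rpow_one]
        _ ≤ (y - x) ^ (1 - α) * g.length ^ α := by gcongr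
    · rw [indicator_of_notMem hg, indicator_of_notMem hg, mul_zero]
  have h2 : (y - x) ^ (1 - α) * (y - x) ^ α = y - x := by
    rw [← Real.rpow_add hd, sub_add_cancel, Real.rpow_one]
  exact le_of_mul_le_mul_left (h2.le.trans h1) (Real.rpow_pos_of_pos hd _)

lemma cumulative_add_le (h0 : volume F = 0) {α : ℝ} (hα1 : α ≤ 1)
    (hs : Summable fun g : Gap F => g.length ^ α) {x y : ℝ} (hx : x ∈ F) (hy : y ∈ F)
    (hxy : x < y) : cumulative F α x + (y - x) ^ α ≤ cumulative F α y := by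
  refine (add_le_add_right (rpow_sub_le_tsum_between h0 hα1 hs hx hy hxy) _).trans ?_
  rw [cumulative, ← (hs.indicator _).tsum_add (hs.indicator _)]
  refine Summable.tsum_le_tsum (fun g => ?_) ((hs.indicator _).add (hs.indicator _))
    (hs.indicator _)
  have hl := length_rpow_nonneg α g
  by_cases h1 : g.1.2 ≤ x
  · have h2 : g ∉ between F x y := fun h => absurd (h.1.trans_lt g.2.1) (not_lt.mpr h1)
    have h3 : g.1.2 ≤ y := h1.trans hxy.le
    simp [h1, h2, h3]
  · by_cases h2 : g ∈ between F x y
    · simp [h1, h2, h2.2]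
    · simp only [Set.mem_ofPred_eq, h1, h2, not_false_eq_true, indicator_of_notMem, add_zero]
      exact Set.indicator_nonneg (fun g _ => length_rpow_nonneg α g) g

/-- By `cumulative_add_le`, two points of F at which `cumulative` has the same integer part in units
of ε^α are at most ε apart. One representative per integer part gives a cover. -/
lemma externalCoveringNumber_le (h0 : volume F = 0) {α : ℝ} (hα : 0 < α) (hα1 : α ≤ 1)
    (hs : Summable fun g : Gap F => g.length ^ α) {ε : ℝ≥0} (hε : 0 < ε) :
    ((Metric.externalCoveringNumber ε F).toNat : ℝ) ≤
      (∑' g : Gap F, g.length ^ α) * (ε : ℝ) ^ (-α) + 1 := by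
  classical
  have hε' : (0 : ℝ) < ε := hε
  have hεα : 0 < (ε : ℝ) ^ α := Real.rpow_pos_of_pos hε' α
  set Z := ∑' g : Gap F, g.length ^ α
  have hZ : 0 ≤ Z := tsum_nonneg (length_rpow_nonneg α)
  let n : ℝ → ℕ := fun x => ⌊cumulative F α x / (ε : ℝ) ^ α⌋₊
  let m := ⌊Z / (ε : ℝ) ^ α⌋₊
  -- The default 0 is a superfluous centre for empty classes; it need not lie in F.
  let r : ℕ → ℝ := fun k => if h : ∃ x ∈ F, n x = k then h.choose else 0
  have hcover : Metric.IsCover ε F (r '' (Finset.range (m + 1) : Set ℕ)) := by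
    intro x hx
    have hex : ∃ y ∈ F, n y = n x := ⟨x, hx, rfl⟩
    have hr : r (n x) = hex.choose := dif_pos hex
    obtain ⟨hyF, hny⟩ := hex.choose_spec
    rw [← hr] at hyF hny
    have hm : n x ∈ (Finset.range (m + 1) : Set ℕ) := by
      have : n x ≤ m := Nat.floor_le_floor (div_le_div_of_nonneg_right (cumulative_le hs x) hεα.le)
      simpa using Nat.lt_succ_of_le this
    refine ⟨r (n x), mem_image_of_mem r hm, ?_⟩
    have key : ∀ {u v : ℝ}, u ∈ F → v ∈ F → u < v → n u = n v → v - u ≤ ε := by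
      intro u v hu hv huv hn
      have h1 := cumulative_add_le h0 hα1 hs hu hv huv
      have h2 := Nat.floor_le (div_nonneg (cumulative_nonneg (F := F) α u) hεα.le)
      have h3 := Nat.lt_floor_add_one (cumulative F α v / (ε : ℝ) ^ α)
      have h4 : (⌊cumulative F α u / (ε : ℝ) ^ α⌋₊ : ℝ) = ⌊cumulative F α v / (ε : ℝ) ^ α⌋₊ :=
        congrArg Nat.cast hn
      rw [le_div_iff₀ hεα] at h2
      rw [div_lt_iff₀ hεα] at h3
      have h5 : (v - u) ^ α < (ε : ℝ) ^ α := by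
        rw [h4] at h2
        linarith
      exact ((Real.rpow_lt_rpow_iff (sub_pos.mpr huv).le hε'.le hα).mp h5).le
    change edist x (r (n x)) ≤ ε
    rw [edist_le_coe, ← NNReal.coe_le_coe, coe_nndist, Real.dist_eq]
    rcases lt_trichotomy x (r (n x)) with h | h | h
    · rw [abs_sub_comm, abs_of_pos (sub_pos.mpr h)]
      exact key hx hyF h hny.symm
    · rw [← h, sub_self, abs_zero]
      exact hε'.le
    · rw [abs_of_pos (sub_pos.mpr h)]
      exact key hyF hx h hny
  have h1 : Metric.externalCoveringNumber ε F ≤ ((m + 1 : ℕ) : ℕ∞) := by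
    refine hcover.externalCoveringNumber_le_encard.trans ((encard_image_le _ _).trans ?_)
    rw [encard_coe_eq_coe_finsetCard, Finset.card_range]
  have h2 : (Metric.externalCoveringNumber ε F).toNat ≤ m + 1 :=
    ENat.toNat_le_of_le_natCast h1
  calc ((Metric.externalCoveringNumber ε F).toNat : ℝ) ≤ ((m + 1 : ℕ) : ℝ) := Nat.cast_le.mpr h2
    _ ≤ Z / (ε : ℝ) ^ α + 1 := by
        push_cast
        exact add_le_add_left (Nat.floor_le (div_nonneg hZ hεα.le)) 1
    _ = _ := by rw [Real.rpow_neg hε'.le, div_eq_mul_inv]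

/-- The left ends of two distinct gaps longer than 2ε are more than 2ε apart, so no centre is within
ε of both. -/
lemma card_le_externalCoveringNumber {ε : ℝ≥0} (hε : 0 < ε) (S : Finset (Gap F))
    (hS : ∀ g ∈ S, 2 * (ε : ℝ) < g.length) :
    (S.card : ℝ) ≤ ((Metric.externalCoveringNumber ε F).toNat : ℝ) := by
  have hF : IsCompact F := isCompact_iff_compactSpace.mpr inferInstance
  have hne : Metric.externalCoveringNumber ε F ≠ ⊤ := by
    obtain ⟨C, -, hCfin, hC⟩ := Metric.exists_finite_isCover_of_totallyBounded hε.ne'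
      hF.totallyBounded
    exact ne_top_of_le_ne_top (encard_ne_top_iff.mpr hCfin) hC.externalCoveringNumber_le_encard
  rw [Nat.cast_le]
  refine ENat.natCast_le_natCast.mp ?_
  rw [ENat.natCast_toNat hne, ← encard_coe_eq_coe_finsetCard]
  refine le_iInf₂ fun C hC => ?_
  have hex : ∀ g : Gap F, ∃ c ∈ C, |g.1.1 - c| ≤ ε := by
    intro g
    obtain ⟨c, hc, hd⟩ := hC g.2.2.1
    refine ⟨c, hc, ?_⟩
    change edist g.1.1 c ≤ ε at hd
    rwa [edist_le_coe, ← NNReal.coe_le_coe, coe_nndist, Real.dist_eq] at hd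
  choose c hc hd using hex
  refine encard_le_encard_of_injOn (f := c) (fun g _ => hc g) fun g hg g' hg' h => ?_
  have key : ∀ {u v : Gap F}, u ∈ S → c u = c v → ¬ u.1.1 < v.1.1 := by
    intro u v hu huv hlt
    have h1 : u.1.2 ≤ v.1.1 := not_lt.mp fun h' =>
      Set.disjoint_left.mp u.2.2.2.2 ⟨hlt, h'⟩ v.2.2.1
    have h2 := abs_le.mp (hd u)
    have h3 := abs_le.mp (hd v)
    rw [huv] at h2
    have h4 : 2 * (ε : ℝ) < u.1.2 - u.1.1 := hS u hu
    linarith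
  have h1 : g.1.1 = g'.1.1 :=
    le_antisymm (not_lt.mp (key hg' h.symm)) (not_lt.mp (key hg h))
  -- Distinct gaps with a common left end would overlap just to the right of it.
  by_contra hne'
  have h2 : Disjoint (Ioo g.1.1 g.1.2) (Ioo g'.1.1 g'.1.2) := pairwise_disjoint hne'
  have hmin : 0 < min g.length g'.length := lt_min g.length_pos g'.length_pos
  have hm1 := min_le_left g.length g'.length
  have hm2 := min_le_right g.length g'.length
  have e1 : g.length = g.1.2 - g.1.1 := rfl
  have e2 : g'.length = g'.1.2 - g'.1.1 := rfl
  have h3 : g.1.1 + min g.length g'.length / 2 ∈ Ioo g.1.1 g.1.2 := ⟨by linarith, by linarith⟩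
  exact Set.disjoint_left.mp h2 h3 ⟨by linarith, by linarith⟩

end Gap

/-! ### Box dimension and exponent of convergence -/

namespace Connes

lemma eventually_nhdsGT_zero {P : ℝ≥0 → Prop} :
    (∀ᶠ ε in 𝓝[>] (0 : ℝ≥0), P ε) ↔ ∃ ε₀ > 0, ∀ ε, 0 < ε → ε < ε₀ → P ε := by
  rw [(nhdsGT_basis (0 : ℝ≥0)).eventually_iff]
  simp [and_imp]

lemma upperBoxDim_nonneg {X : Type*} [PseudoMetricSpace X] {E : Set X} : 0 ≤ upperBoxDim E := by
  refine le_limsup_of_frequently_le (Eventually.frequently ?_)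
  refine eventually_nhdsGT_zero.mpr ⟨1, one_pos, fun ε hε hε1 => ?_⟩
  refine EReal.coe_nonneg.mpr (div_nonneg (Real.log_natCast_nonneg _) ?_)
  exact neg_nonneg.mpr (Real.log_nonpos ε.2 hε1.le)

variable {F : Set ℝ} [CompactSpace F]

lemma upperBoxDim_le (h0 : volume F = 0) {α : ℝ} (hα : 0 < α) (hα1 : α ≤ 1)
    (hs : Summable fun g : Gap F => g.length ^ α) : upperBoxDim F ≤ (α : EReal) := by
  set Z := ∑' g : Gap F, g.length ^ α
  have hZ : 0 ≤ Z := tsum_nonneg (Gap.length_rpow_nonneg α)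
  have hlim : Tendsto (fun ε : ℝ≥0 => ((α + Real.log (Z + 1) / (-Real.log (ε : ℝ)) : ℝ) : EReal))
      (𝓝[>] 0) (𝓝 (α : EReal)) := by
    have h1 : Tendsto (fun ε : ℝ≥0 => (ε : ℝ)) (𝓝[>] 0) (𝓝[>] 0) := by
      refine tendsto_nhdsWithin_iff.mpr ⟨?_, ?_⟩
      · exact (NNReal.continuous_coe.tendsto 0).mono_left nhdsWithin_le_nhds
      · filter_upwards [self_mem_nhdsWithin] with ε hε
        exact hε
    have h2 : Tendsto (fun ε : ℝ≥0 => -Real.log (ε : ℝ)) (𝓝[>] 0) atTop :=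
      tendsto_neg_atBot_atTop.comp (Real.tendsto_log_nhdsGT_zero.comp h1)
    have h3 := (h2.const_div_atTop (Real.log (Z + 1))).const_add α
    rw [add_zero] at h3
    exact (continuous_coe_real_ereal.tendsto α).comp h3
  rw [upperBoxDim, ← hlim.limsup_eq]
  refine limsup_le_limsup ?_
  refine eventually_nhdsGT_zero.mpr ⟨1, one_pos, fun ε hε hε1 => ?_⟩
  have hε' : (0 : ℝ) < ε := hε
  have hε1' : (ε : ℝ) < 1 := hε1
  have hlog : 0 < -Real.log (ε : ℝ) := neg_pos.mpr (Real.log_neg hε' hε1')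
  refine EReal.coe_le_coe_iff.mpr ?_
  rw [div_le_iff₀ hlog, add_mul, div_mul_cancel₀ _ hlog.ne']
  have hN := Gap.externalCoveringNumber_le h0 hα hα1 hs hε
  have h1 : (1 : ℝ) ≤ (ε : ℝ) ^ (-α) :=
    Real.one_le_rpow_of_pos_of_le_one_of_nonpos hε' hε1'.le (neg_nonpos.mpr hα.le)
  -- The value 0 is separated since the logarithm is monotone only on positive numbers; there log 0
  -- = 0.
  rcases (Metric.externalCoveringNumber ε F).toNat.eq_zero_or_pos with hN0 | hN0
  · rw [hN0, Nat.cast_zero, Real.log_zero]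
    have := Real.log_nonneg (by linarith : (1 : ℝ) ≤ Z + 1)
    positivity
  · have hN0' : (0 : ℝ) < (Metric.externalCoveringNumber ε F).toNat := Nat.cast_pos.mpr hN0
    calc Real.log (Metric.externalCoveringNumber ε F).toNat
        ≤ Real.log ((Z + 1) * (ε : ℝ) ^ (-α)) := Real.log_le_log hN0' (by nlinarith)
      _ = α * -Real.log ε + Real.log (Z + 1) := by
        rw [Real.log_mul (by positivity) (by positivity), Real.log_rpow hε']
        ring

lemma summable_of_upperBoxDim_lt {α : ℝ} (hα : 0 < α) (h : upperBoxDim F < (α : EReal)) :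
    Summable fun g : Gap F => g.length ^ α := by
  obtain ⟨β, hβ, hβα⟩ := EReal.lt_iff_exists_real_btwn.mp
    (max_lt h (EReal.coe_lt_coe_iff.mpr hα))
  have hβ0 : 0 < β := EReal.coe_lt_coe_iff.mp ((le_max_right _ _).trans_lt hβ)
  have hβα' : β < α := EReal.coe_lt_coe_iff.mp hβα
  have hev := eventually_lt_of_limsup_lt ((le_max_left _ _).trans_lt hβ)
  obtain ⟨ε₁, hε₁, hev⟩ := eventually_nhdsGT_zero.mp hev
  obtain ⟨ε₀, hε₀, hε₀lt⟩ := exists_between (lt_min hε₁ one_pos)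
  have hε₀' : (0 : ℝ) < ε₀ := hε₀
  have hcard : ∀ ε : ℝ≥0, 0 < ε → ε ≤ ε₀ → ∀ S : Finset (Gap F),
      (∀ g ∈ S, 2 * (ε : ℝ) < g.length) → (S.card : ℝ) ≤ (ε : ℝ) ^ (-β) := by
    intro ε hε hεle S hS
    have hlt := hεle.trans_lt hε₀lt
    have hε' : (0 : ℝ) < ε := hε
    have hε1 : (ε : ℝ) < 1 := hlt.trans_le (min_le_right _ _)
    have hlog : 0 < -Real.log (ε : ℝ) := neg_pos.mpr (Real.log_neg hε' hε1)
    refine (Gap.card_le_externalCoveringNumber hε S hS).trans ?_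
    rcases (Metric.externalCoveringNumber ε F).toNat.eq_zero_or_pos with hN0 | hN0
    · rw [hN0, Nat.cast_zero]
      positivity
    · have h1 := EReal.coe_lt_coe_iff.mp (hev ε hε (hlt.trans_le (min_le_left _ _)))
      rw [div_lt_iff₀ hlog] at h1
      have hN0' : (0 : ℝ) < (Metric.externalCoveringNumber ε F).toNat := Nat.cast_pos.mpr hN0
      rw [← Real.log_le_log_iff hN0' (by positivity), Real.log_rpow hε']
      linarith
  set D := Metric.diam F
  have hD0 : 0 ≤ D := Metric.diam_nonneg
  -- The term 2^β serves t ≤ 2ε₀, where the count at t/2 is used. For larger t the count at ε₀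
  -- suffices, and t ≤ D gives the term (D/ε₀)^β.
  refine summable_rpow_of_card_le (M := D) (K := 2 ^ β + (D / ε₀) ^ β) (fun g => g.length_pos)
    (fun g => g.length_le) hβ0 hβα' fun t ht S hS => ?_
  have hDε : 0 ≤ (D / ε₀) ^ β := by positivity
  rcases S.eq_empty_or_nonempty with rfl | ⟨g₀, hg₀⟩
  · simp only [Finset.card_empty, Nat.cast_zero]
    positivity
  have htD : t ≤ D := (hS g₀ hg₀).le.trans g₀.length_le
  rcases le_or_gt (t / 2) ε₀ with hle | hgt
  · have h1 := hcard ⟨t / 2, (half_pos ht).le⟩ (half_pos ht) hle S fun g hg => by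
      have : 2 * (t / 2) < g.length := by
        rw [mul_div_cancel₀ _ two_ne_zero]
        exact hS g hg
      exact this
    refine h1.trans ?_
    change (t / 2) ^ (-β) ≤ _
    rw [Real.div_rpow ht.le zero_le_two, Real.rpow_neg zero_le_two, div_inv_eq_mul, mul_comm]
    gcongr
    linarith
  · have h1 := hcard ε₀ hε₀ le_rfl S fun g hg => by
      have := hS g hg
      linarith
    refine h1.trans ?_
    calc (ε₀ : ℝ) ^ (-β) = (t / ε₀) ^ β * t ^ (-β) := by
          rw [Real.div_rpow ht.le hε₀'.le, Real.rpow_neg hε₀'.le, Real.rpow_neg ht.le]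
          field_simp
      _ ≤ (2 ^ β + (D / ε₀) ^ β) * t ^ (-β) := by
          gcongr
          have h2 : (t / ε₀) ^ β ≤ (D / ε₀) ^ β := by gcongr
          have h3 : (0 : ℝ) < 2 ^ β := by positivity
          linarith

lemma coe_dim_eq_upperBoxDim (h0 : volume F = 0) :
    ((connesTriple F).dim : EReal) = upperBoxDim F := by
  refine le_antisymm (le_of_forall_gt fun x hx => ?_) (le_of_forall_gt fun x hx => ?_)
  · obtain ⟨α, h1, h2⟩ := EReal.lt_iff_exists_real_btwn.mp hx
    have hα0 : 0 < α := EReal.coe_lt_coe_iff.mp (upperBoxDim_nonneg.trans_lt h1)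
    refine lt_of_le_of_lt ?_ h2
    have h3 := dim_le_of_summable hα0 (summable_of_upperBoxDim_lt hα0 h1)
    have h4 := EReal.coe_ennreal_le_coe_ennreal_iff.mpr h3
    rwa [EReal.coe_ennreal_ofReal, max_eq_left hα0.le] at h4
  · obtain ⟨α, h1, h2⟩ := EReal.lt_iff_exists_real_btwn.mp hx
    have hα0 : 0 < α := EReal.coe_lt_coe_iff.mp ((EReal.coe_ennreal_nonneg _).trans_lt h1)
    refine lt_of_le_of_lt ?_ h2
    have h3 : (connesTriple F).dim < ENNReal.ofReal α := by
      rw [← EReal.coe_ennreal_lt_coe_ennreal_iff, EReal.coe_ennreal_ofReal, max_eq_left hα0.le]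
      exact h1
    -- The covering bound needs an exponent at most 1; above 1 the exponent 1 itself is used.
    rcases le_or_gt α 1 with h4 | h4
    · exact upperBoxDim_le h0 hα0 h4 (summable_of_dim_lt h3)
    · refine (upperBoxDim_le h0 one_pos le_rfl ?_).trans (EReal.coe_le_coe_iff.mpr h4.le)
      simpa only [Real.rpow_one] using Gap.summable_length

end Connes


/-! ### Hausdorff–Besicovitch functionals as measures -/

section Riesz

variable {X : Type*} [TopologicalSpace X]

/-- A real continuous function, regarded as a complex one. -/
def ContinuousMap.ofRealComplex (g : C(X, ℝ)) : C(X, ℂ) :=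
  ⟨fun x => (g x : ℂ), Complex.continuous_ofReal.comp g.continuous⟩

variable [CompactSpace X]

/-- A linear functional on `C(X, ℂ)` that is nonnegative on nonnegative functions is given by a
finite measure. -/
theorem exists_measure_of_nonneg [T2Space X] [MeasurableSpace X] [BorelSpace X]
    (L : C(X, ℂ) →ₗ[ℂ] ℂ)
    (hL : ∀ g : C(X, ℝ), (∀ x, 0 ≤ g x) → ∃ r : ℝ, 0 ≤ r ∧ L g.ofRealComplex = r) :
    ∃ μ : Measure X, IsFiniteMeasure μ ∧ ∀ f : C(X, ℂ), L f = ∫ x, f x ∂μ := by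
  have hsub : ∀ g h : C(X, ℝ), L (g - h).ofRealComplex = L g.ofRealComplex - L h.ofRealComplex := by
    intro g h
    rw [← map_sub]
    congr 1
    ext x
    exact Complex.ofReal_sub _ _
  -- Every real g is the difference of the nonnegative functions ‖g‖ and ‖g‖ - g.
  have hreal : ∀ g : C(X, ℝ), L g.ofRealComplex = (L g.ofRealComplex).re := by
    intro g
    let k : C(X, ℝ) := ContinuousMap.const X ‖g‖
    obtain ⟨r, -, hr⟩ := hL k fun x => norm_nonneg g
    obtain ⟨s, -, hs⟩ := hL (k - g) fun x =>
      sub_nonneg.mpr ((le_abs_self _).trans (g.norm_coe_le_norm x))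
    rw [hsub, hr] at hs
    rw [← sub_sub_cancel (r : ℂ) (L g.ofRealComplex), hs, ← Complex.ofReal_sub, Complex.ofReal_re]
  let Λ : CompactlySupportedContinuousMap X ℝ →ₚ[ℝ] ℝ :=
    { toFun := fun g => (L (ContinuousMap.ofRealComplex g)).re
      map_add' := fun g h => by
        rw [← Complex.add_re, ← map_add]
        congr 2
        ext x
        exact Complex.ofReal_add _ _
      map_smul' := fun c g => by
        rw [RingHom.id_apply, smul_eq_mul, ← Complex.re_ofReal_mul, ← smul_eq_mul, ← map_smul]
        congr 2
        ext x
        exact Complex.ofReal_mul _ _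
      monotone' := fun g h hgh => by
        obtain ⟨r, hr, hr'⟩ := hL ((h : C(X, ℝ)) - (g : C(X, ℝ))) fun x => sub_nonneg.mpr (hgh x)
        have h1 := congrArg Complex.re hr'
        rw [hsub, Complex.sub_re, Complex.ofReal_re] at h1
        exact sub_nonneg.mp (h1 ▸ hr) }
  have hint : ∀ g : C(X, ℝ), L g.ofRealComplex = ((∫ x, g x ∂(RealRMK.rieszMeasure Λ) : ℝ) : ℂ) := by
    intro g
    have h := RealRMK.integral_rieszMeasure Λ ⟨g, HasCompactSupport.of_compactSpace _⟩
    rw [hreal]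
    exact congrArg Complex.ofReal h.symm
  refine ⟨RealRMK.rieszMeasure Λ, inferInstance, fun f => ?_⟩
  let u : C(X, ℝ) := ⟨fun x => (f x).re, by fun_prop⟩
  let v : C(X, ℝ) := ⟨fun x => (f x).im, by fun_prop⟩
  have hf : f = u.ofRealComplex + Complex.I • v.ofRealComplex := by
    ext x
    change f x = ((f x).re : ℂ) + Complex.I * (f x).im
    rw [mul_comm, Complex.re_add_im]
  have hfi : Integrable f (RealRMK.rieszMeasure Λ) :=
    f.continuous.integrable_of_hasCompactSupport (HasCompactSupport.of_compactSpace _)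
  have h := integral_re_add_im (𝕜 := ℂ) hfi
  rw [← h]
  conv_lhs => rw [hf, map_add, map_smul, hint, hint, smul_eq_mul, mul_comm]
  rfl

end Riesz

/-! ### The measure attached to a singular trace and a diagonal operator -/

namespace SingularTrace

variable {ι H X : Type*} [NormedAddCommGroup H] [InnerProductSpace ℂ H] [CompleteSpace H]
  [TopologicalSpace X] [CompactSpace X]
  {b : HilbertBasis ι ℂ H} {A T : H →L[ℂ] H} {a : ι → ℝ} {e : ι → X} (τ : SingularTrace H)

/-- In the operator order, 0 ≤ T ≤ ‖g‖ A. -/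
lemma nonneg_and_lt_top_of_isDiag (ha : ∀ i, 0 ≤ a i) (hA : IsDiag b A fun i => (a i : ℂ))
    (hτ : τ.toFun A < ⊤) {g : C(X, ℝ)} (hg : ∀ x, 0 ≤ g x)
    (hT : IsDiag b T fun i => ((g (e i) * a i : ℝ) : ℂ)) : 0 ≤ T ∧ τ.toFun T < ⊤ := by
  have hT0 := hT.nonneg fun i => mul_nonneg (hg (e i)) (ha i)
  have hle : T ≤ ((‖g‖₊ : ℝ) : ℂ) • A := by
    have hd : IsDiag b (((‖g‖₊ : ℝ) : ℂ) • A - T) fun i => (((‖g‖ - g (e i)) * a i : ℝ) : ℂ) := by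
      convert (hA.smul ((‖g‖₊ : ℝ) : ℂ)).sub hT using 2 with i
      push_cast
      ring
    exact sub_nonneg.mp (hd.nonneg fun i => mul_nonneg
      (sub_nonneg.mpr ((le_abs_self _).trans (g.norm_coe_le_norm (e i)))) (ha i))
  refine ⟨hT0, (τ.mono hT0 hle).trans_lt ?_⟩
  rw [τ.map_smul _ _ (hA.nonneg ha)]
  exact ENNReal.mul_lt_top ENNReal.coe_lt_top hτ

lemma mem_domain_of_isDiag (ha : ∀ i, 0 ≤ a i) (hA : IsDiag b A fun i => (a i : ℂ))
    (hτ : τ.toFun A < ⊤) {f : C(X, ℂ)} (hT : IsDiag b T fun i => f (e i) * a i) :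
    T ∈ τ.domain := by
  have hreal : ∀ g : C(X, ℝ), ∃ S ∈ τ.domain, IsDiag b S fun i => ((g (e i) * a i : ℝ) : ℂ) := by
    intro g
    have hpos : ∀ h : C(X, ℝ), (∀ x, 0 ≤ h x) →
        ∃ S ∈ τ.domain, IsDiag b S fun i => ((h (e i) * a i : ℝ) : ℂ) := by
      intro h hh
      have hS := isDiag_diagOp (b := b) (c := fun i => ((h (e i) * a i : ℝ) : ℂ))
        (mul_nonneg (norm_nonneg h) (norm_nonneg A)) fun i => by
          have h1 := hA.norm_le i
          rw [Complex.norm_real] at h1 ⊢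
          rw [norm_mul]
          exact mul_le_mul (h.norm_coe_le_norm _) h1 (norm_nonneg _) (norm_nonneg _)
      have := τ.nonneg_and_lt_top_of_isDiag ha hA hτ hh hS
      exact ⟨_, τ.mem_domain this.1 this.2, hS⟩
    let k : C(X, ℝ) := ContinuousMap.const X ‖g‖
    obtain ⟨S, hS, hSd⟩ := hpos k fun x => norm_nonneg g
    obtain ⟨R, hR, hRd⟩ := hpos (k - g) fun x =>
      sub_nonneg.mpr ((le_abs_self _).trans (g.norm_coe_le_norm x))
    refine ⟨S - R, sub_mem hS hR, ?_⟩
    convert hSd.sub hRd using 2 with i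
    rw [ContinuousMap.sub_apply]
    push_cast
    ring
  obtain ⟨S, hS, hSd⟩ := hreal ⟨fun x => (f x).re, by fun_prop⟩
  obtain ⟨R, hR, hRd⟩ := hreal ⟨fun x => (f x).im, by fun_prop⟩
  have h : T = S + Complex.I • R := by
    refine hT.eq ?_
    convert hSd.add (hRd.smul Complex.I) using 2 with i
    conv_lhs => rw [← Complex.re_add_im (f (e i))]
    simp only [ContinuousMap.coe_mk]
    push_cast
    ring
  rw [h]
  exact add_mem hS (Submodule.smul_mem _ _ hR)

/-- If `τ(A) = 1` for a positive diagonal operator `A`, then `f ↦ τ(f A)`, for functions `f` on the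
index set that come from continuous functions on a compact space, is given by a measure. -/
theorem exists_measure_of_isDiag [T2Space X] [MeasurableSpace X] [BorelSpace X]
    (ha : ∀ i, 0 ≤ a i) (hA : IsDiag b A fun i => (a i : ℂ)) (hτ : τ.toFun A = 1)
    {σ : τ.domain →ₗ[ℂ] ℂ} (hσ : τ.IsLinearExtension σ) (e : ι → X) :
    ∃ μ : Measure X, IsFiniteMeasure μ ∧ μ ≠ 0 ∧ ∀ (f : C(X, ℂ)) (T : H →L[ℂ] H),
      (IsDiag b T fun i => f (e i) * a i) →
        ∃ h : T ∈ τ.domain, σ ⟨T, h⟩ = ∫ x, f x ∂μ := by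
  have hfin : τ.toFun A < ⊤ := hτ ▸ ENNReal.one_lt_top
  have hex : ∀ f : C(X, ℂ), ∃ S : τ.domain, IsDiag b (S : H →L[ℂ] H) fun i => f (e i) * a i := by
    intro f
    have hS := isDiag_diagOp (b := b) (c := fun i => f (e i) * a i)
      (mul_nonneg (norm_nonneg f) (norm_nonneg A)) fun i => by
        rw [norm_mul]
        exact mul_le_mul (f.norm_coe_le_norm _) (hA.norm_le i) (norm_nonneg _) (norm_nonneg _)
    exact ⟨⟨_, τ.mem_domain_of_isDiag ha hA hfin hS⟩, hS⟩
  choose M hM using hex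
  have hMeq : ∀ (f : C(X, ℂ)) (S : τ.domain),
      (IsDiag b (S : H →L[ℂ] H) fun i => f (e i) * a i) → M f = S :=
    fun f S hS => Subtype.ext ((hM f).eq hS)
  -- The functional is defined on all continuous functions, as the Riesz theorem requires.
  let L : C(X, ℂ) →ₗ[ℂ] ℂ :=
    { toFun := fun f => σ (M f)
      map_add' := fun f g => by
        rw [← LinearMap.map_add]
        refine congrArg σ (hMeq _ _ ?_)
        simpa only [ContinuousMap.add_apply, Submodule.coe_add, add_mul] using (hM f).add (hM g)
      map_smul' := fun z f => by
        rw [← LinearMap.map_smulₛₗ]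
        refine congrArg σ (hMeq _ _ ?_)
        simpa only [ContinuousMap.smul_apply, Submodule.coe_smul, smul_eq_mul, mul_assoc] using (hM f).smul z }
  obtain ⟨μ, hμ, hL⟩ := exists_measure_of_nonneg L fun g hg => by
    have h : IsDiag b (M g.ofRealComplex : H →L[ℂ] H) fun i => ((g (e i) * a i : ℝ) : ℂ) := by
      convert hM g.ofRealComplex using 2 with i
      exact Complex.ofReal_mul _ _
    have h2 := τ.nonneg_and_lt_top_of_isDiag ha hA hfin hg h
    exact ⟨_, ENNReal.toReal_nonneg, hσ _ h2.1 h2.2⟩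
  refine ⟨μ, hμ, ?_, fun f T hT => ?_⟩
  -- At f = 1 the functional is τ(A) = 1, so the measure is not zero.
  · rintro rfl
    have h1 : A ∈ τ.domain := τ.mem_domain (hA.nonneg ha) hfin
    have h2 : M 1 = ⟨A, h1⟩ := hMeq _ _ (by simpa using hA)
    have h3 : σ (M 1) = 1 := by
      rw [h2, hσ ⟨A, h1⟩ (hA.nonneg ha) hfin, hτ]
      simp
    have h4 := hL 1
    rw [integral_zero_measure] at h4
    exact one_ne_zero (h3.symm.trans h4)
  · have h := τ.mem_domain_of_isDiag ha hA hfin hT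
    refine ⟨h, ?_⟩
    rw [← hMeq f ⟨T, h⟩ hT]
    exact hL f

end SingularTrace

/-! ### The functional at the critical exponent -/

namespace Connes

variable {F : Set ℝ} [CompactSpace F]

/-- Since d is the exponent of convergence for ℓ, it is 1 for ℓ^d: the exponents d(1+ε) and d(1-ε)
lie on either side of d. -/
lemma exists_singularTrace_absNegPow_dim {d : ℝ} (hd : 0 < d)
    (hdim : ENNReal.ofReal d = (connesTriple F).dim) :
    ∃ τ : SingularTrace (Hilb F), τ.toFun ((connesTriple F).absNegPow d) = 1 := by
  refine (isDiag_absNegPow hd.le).exists_singularTrace_eq_one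
    (fun p => Real.rpow_pos_of_pos p.1.length_pos d) (fun ε hε => ?_) (fun ε hε hε1 hs => ?_)
  · simp only [← Real.rpow_mul (Gap.length_pos _).le]
    refine Gap.summable_prod_length_rpow.mpr (summable_of_dim_lt ?_)
    rw [← hdim]
    exact (ENNReal.ofReal_lt_ofReal_iff_of_nonneg hd.le).mpr (by nlinarith)
  · simp only [← Real.rpow_mul (Gap.length_pos _).le] at hs
    have h1 : 0 < d * (1 - ε) := mul_pos hd (sub_pos.mpr hε1)
    have h2 := dim_le_of_summable h1 (Gap.summable_prod_length_rpow.mp hs)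
    rw [← hdim, ENNReal.ofReal_le_ofReal_iff h1.le] at h2
    nlinarith

lemma isDiag_rep_mul_absNegPow {d : ℝ} (hd : 0 ≤ d) (f : lipAlgebra F) :
    IsDiag (stdBasis F) ((connesTriple F).rep f * (connesTriple F).absNegPow d)
      fun p => (f : C(F, ℂ)) (Gap.endpoint p) * ((p.1.length ^ d : ℝ) : ℂ) :=
  IsDiag.mul (isDiag_of_apply fun _ _ => rfl) (isDiag_absNegPow hd)

lemma exists_isHausdorffBesicovitch {d : ℝ} (hd : 0 < d)
    (hdim : ENNReal.ofReal d = (connesTriple F).dim) :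
    ∃ φ : lipAlgebra F →ₗ[ℂ] ℂ, (connesTriple F).IsHausdorffBesicovitch d φ ∧
      ∃ μ : Measure F, IsFiniteMeasure μ ∧ μ ≠ 0 ∧
        ∀ f : lipAlgebra F, φ f = ∫ x, (f : C(F, ℂ)) x ∂μ := by
  obtain ⟨τ, hτ⟩ := exists_singularTrace_absNegPow_dim hd hdim
  obtain ⟨σ, hσ⟩ := τ.exists_isLinearExtension
  obtain ⟨μ, hμ, hμ0, h⟩ := τ.exists_measure_of_isDiag
    (fun p => Gap.length_rpow_nonneg d p.1) (isDiag_absNegPow hd.le) hτ hσ Gap.endpoint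
  have hi : ∀ f : C(F, ℂ), Integrable f μ := fun f =>
    f.continuous.integrable_of_hasCompactSupport (HasCompactSupport.of_compactSpace _)
  let φ : lipAlgebra F →ₗ[ℂ] ℂ :=
    { toFun := fun f => ∫ x, (f : C(F, ℂ)) x ∂μ
      map_add' := fun f g => integral_add (hi f) (hi g)
      map_smul' := fun z f => integral_const_mul z _ }
  refine ⟨φ, ⟨hd, τ, hτ, σ, hσ, fun f => ?_⟩, μ, hμ, hμ0, fun f => rfl⟩
  obtain ⟨h1, h2⟩ := h f _ (isDiag_rep_mul_absNegPow hd.le f)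
  exact ⟨h1, h2.symm⟩

end Connes

theorem mainTheorem4 (F : Set ℝ) [CompactSpace F] (hne : F.Nonempty)
    (hdisc : IsTotallyDisconnected F) (hperf : Preperfect F) :
    (volume F = 0 → ((connesTriple F).dim : EReal) = upperBoxDim F) ∧
    (connesTriple F).dim = (connesTriple F).supDim ∧
    ((connesTriple F).dim ≠ 0 →
      ∃ d : ℝ, ENNReal.ofReal d = (connesTriple F).dim ∧
        ∃ φ : lipAlgebra F →ₗ[ℂ] ℂ, (connesTriple F).IsHausdorffBesicovitch d φ ∧
          ∃ μ : Measure F, IsFiniteMeasure μ ∧ μ ≠ 0 ∧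
            ∀ f : lipAlgebra F, φ f = ∫ x, (f : C(F, ℂ)) x ∂μ) := by
  refine ⟨Connes.coe_dim_eq_upperBoxDim, Connes.dim_eq_supDim, fun h0 => ?_⟩
  have htop : (connesTriple F).dim ≠ ⊤ :=
    ne_top_of_le_ne_top ENNReal.ofReal_ne_top Connes.dim_le_one
  have hdim := ENNReal.ofReal_toReal htop
  exact ⟨_, hdim, Connes.exists_isHausdorffBesicovitch (ENNReal.toReal_pos h0 htop) hdim⟩
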